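/- **Model.** An algebraic RAM over a commutative ring $\mathbb D$ has a fixed finite set of input/output arrays of ring elements, algebraic registers (one ring element each) and pointer registers (one bounded natural number each). Atomic operations, of unit cost, are: ring operations and inversion of units on algebraic registers, copies, loads and stores at an array position given by a pointer register, addition, truncated subtraction, halving and literal assignment on pointer registers, and comparison of two pointer registers. A program is a finite text built from these by sequencing, branching and while loops (no recursion, no allocation), so it uses the arrays and a fixed number of registers; it is the same text for all rings and all lengths. All pointer values are at most a constant times the length of the arrays. A program is *in-place* if it runs in this model and restores every input array that is not its output; it is *over-place* if it replaces its input array by the output. **Transforms.** Let $\omega\in\mathbb D$ be a principal $N$-th root of unity, $N=2^p$ (i.e. $\omega^N=1$, $\sum_{j<N}\omega^{ij}=0$ for $0<i<N$, and $N$ is a unit of $\mathbb D$), and let $[i]_p=\sum_{j<p}d_j2^{p-1-j}$ be the bit reversal of $i=\sum_{j<p}d_j2^j$. For $n\le N$ and $F\in\mathbb D[X]$ with $\deg F<n$ put $\mathrm{brTFT}_n(F,\omega)=(F(\omega^{[0]_p}),\dots,F(\omega^{[n-1]_p}))$, and $\mathrm{brDFT}_N=\mathrm{brTFT}_N$. For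 an array $\vec f$ of length $n$ holding $F$, and for $2^\ell\le n$, $(k+1)2^\ell\le 2^p$, let $\mathrm{partTFT}_{k,\ell}(\vec f)$ be the program: $f_i\leftarrow f_i\,\omega^{i[k2^\ell]_p}$ for $0\le i<n$; $f_{i-2^\ell}\leftarrow f_{i-2^\ell}+f_i$ for $i=n-1$ down to $2^\ell$; apply $\mathrm{brDFT}_{2^\ell}(\cdot,\omega^{2^{p-\ell}})$ over-place to $f_0,\dots,f_{2^\ell-1}$. Its inverse $\mathrm{partTFT}^{-1}_{k,\ell}$ undoes these three steps in reverse order, using $\mathrm{brDFT}^{-1}_{2^\ell}$. The powers of $\omega$ are computed on the fly in O(1) registers. **Algorithm.** Input: arrays $\vec a,\vec b,\vec c$ of lengths $m,n,m+n-1$ with $1\le m\le n$, holding $A,B,C\in\mathbb D[X]$, and a principal $2^p$-th root of unity $\omega\in\mathbb D$ with $2^{p-1}<m+n-1\le 2^p$. 1. $\vec c\leftarrow \mathrm{brTFT}_{m+n-1}(\vec c,\omega)$; $r\leftarrow m+n-1$. 2. While $r>0$: let $\ell=\lfloor\log_2\min(r,m)\rfloor$, $t=\lfloor\log_2\min(r,n)\rfloor-\ell$,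 $k=(m+n-1-r)/2^{\ell+t}$ (an integer); $\vec b\leftarrow\mathrm{partTFT}_{k,\ell+t}(\vec b)$; for $s=0,\dots,2^t-1$ do: $\vec a\leftarrow \mathrm{partTFT}_{k2^t+s,\ell}(\vec a)$, then $c_{i+(k2^t+s)2^\ell}\leftarrow c_{i+(k2^t+s)2^\ell}+a_i b_{i+s2^\ell}$ for $0\le i<2^\ell$, then $\vec a\leftarrow \mathrm{partTFT}^{-1}_{k2^t+s,\ell}(\vec a)$; finally $\vec b\leftarrow\mathrm{partTFT}^{-1}_{k,\ell+t}(\vec b)$ and $r\leftarrow r-2^{\ell+t}$. 3. $\vec c\leftarrow\mathrm{brTFT}^{-1}_{m+n-1}(\vec c,\omega)$. **Theorem.** Let the algorithm use any over-place programs for $\mathrm{brDFT}^{\pm1}$ (lengths $2^\ell$) and $\mathrm{brTFT}^{\pm1}$ (lengths $n$ with $2^{p-1}<n\le 2^p$). (a) The algorithm is correct and in-place: for all $1\le m\le n$ it halts with $\vec c$ containing the coefficients of $C+AB$ and with $\vec a,\vec b$ in their initial state; it uses $O(1)$ registers besides those of the transform programs, and its pointer values are $O(n)$. (b) If the $\mathrm{brDFT}^{\pm1}$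 programs and the $\mathrm{brTFT}^{\pm1}$ programs take time $O(n\log n)$, then the algorithm takes time $O(n\log n)$, uniformly in $m\le n$. The bound depends only on the time bounds of the transform programs, and not on $\mathbb D$, $\omega$ or the data. (c) If the $\mathrm{brDFT}^{\pm1}$ programs take time $O(n\log n)$, then over-place $\mathrm{brTFT}^{\pm1}$ programs that take time $O(n\log n)$ exist, with time and pointer bounds that depend only on those of the $\mathrm{brDFT}^{\pm1}$ programs. So the cost of $\mathrm{brDFT}^{\pm1}$ is the only assumption needed in (b). -/

import Mathlib

open Polynomial

/-! ### The algebraic RAM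

A machine has arrays of ring elements (indexed by `ι`), algebraic registers, each holding one ring
element, and pointer registers, each holding one bounded natural number. A program is a finite text,
the same for all rings and all array lengths; it has no recursion and cannot allocate memory. -/

namespace AlgRAM

/-- Atomic instructions. Registers are named by natural numbers, `p q r` are pointer registers and
`x y z` are algebraic registers. -/
inductive Instr (ι : Type) : Type
  /-- `p ← k` for a literal `k` -/
  | pset (p k : ℕ)
  /-- `p ← q` -/
  | pmov (p q : ℕ)
  /-- `p ← q + r` -/
  | padd (p q r : ℕ)
  /-- `p ← max (q - r) 0` -/
  | psub (p q r : ℕ)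
  /-- `p ← ⌊q / 2⌋` -/
  | phalf (p q : ℕ)
  /-- `x ← A[p]` -/
  | load (x : ℕ) (A : ι) (p : ℕ)
  /-- `A[p] ← x` -/
  | store (A : ι) (p x : ℕ)
  /-- `x ← 0` -/
  | zero (x : ℕ)
  /-- `x ← 1` -/
  | one (x : ℕ)
  /-- `x ← y` -/
  | mov (x y : ℕ)
  /-- `x ← y + z` -/
  | add (x y z : ℕ)
  /-- `x ← y - z` -/
  | sub (x y z : ℕ)
  /-- `x ← y * z` -/
  | mul (x y z : ℕ)
  /-- `x ← y⁻¹`, for an invertible `y` -/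
  | inv (x y : ℕ)

/-- Tests, which look at pointer registers only. -/
inductive Test : Type
  | le (p q : ℕ)
  | lt (p q : ℕ)

/-- Programs. -/
inductive Stmt (ι : Type) : Type
  | skip
  | op (i : Instr ι)
  | seq (s s' : Stmt ι)
  | ite (c : Test) (s s' : Stmt ι)
  | loop (c : Test) (s : Stmt ι)

/-- Sequential composition of a list of programs. -/
def block {ι : Type} : List (Stmt ι) → Stmt ι
  | [] => .skip
  | s :: l => .seq s (block l)

/-- Contents of the memory. Only the first `len A` entries of `arr A` are memory cells, where
`len A` is the length of the array `A`: other entries cannot be accessed, see `Instr.step`. -/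
structure State (D : Type*) (ι : Type) where
  arr : ι → ℕ → D
  alg : ℕ → D
  ptr : ℕ → ℕ

section Semantics

variable {D : Type*} [CommRing D] {ι : Type} [DecidableEq ι]

/-- Write `v` into the pointer register `p`; impossible if `v` exceeds the word bound `W`. -/
def State.setPtr (σ : State D ι) (W p v : ℕ) : Option (State D ι) :=
  if v ≤ W then some { σ with ptr := Function.update σ.ptr p v } else none

/-- Write `v` into the algebraic register `x`. -/
def State.setAlg (σ : State D ι) (x : ℕ) (v : D) : State D ι :=
  { σ with alg := Function.update σ.alg x v }

/-- Write `v` into entry `i` of the array `A`. -/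
def State.setArr (σ : State D ι) (A : ι) (i : ℕ) (v : D) : State D ι :=
  { σ with arr := Function.update σ.arr A (Function.update (σ.arr A) i v) }

open Classical in
/-- The effect of an instruction. The machine is stuck (`none`) on a pointer value above the word
bound, on an array access out of bounds and on the inversion of a non-unit. -/
noncomputable def Instr.step (W : ℕ) (len : ι → ℕ) (σ : State D ι) :
    Instr ι → Option (State D ι)
  | .pset p k => σ.setPtr W p k
  | .pmov p q => σ.setPtr W p (σ.ptr q)
  | .padd p q r => σ.setPtr W p (σ.ptr q + σ.ptr r)
  | .psub p q r => σ.setPtr W p (σ.ptr q - σ.ptr r)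
  | .phalf p q => σ.setPtr W p (σ.ptr q / 2)
  | .load x A p => if σ.ptr p < len A then some (σ.setAlg x (σ.arr A (σ.ptr p))) else none
  | .store A p x => if σ.ptr p < len A then some (σ.setArr A (σ.ptr p) (σ.alg x)) else none
  | .zero x => some (σ.setAlg x 0)
  | .one x => some (σ.setAlg x 1)
  | .mov x y => some (σ.setAlg x (σ.alg y))
  | .add x y z => some (σ.setAlg x (σ.alg y + σ.alg z))
  | .sub x y z => some (σ.setAlg x (σ.alg y - σ.alg z))
  | .mul x y z => some (σ.setAlg x (σ.alg y * σ.alg z))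
  | .inv x y => if IsUnit (σ.alg y) then some (σ.setAlg x (Ring.inverse (σ.alg y))) else none

/-- The outcome of a test. -/
def Test.holds (σ : State D ι) : Test → Prop
  | .le p q => σ.ptr p ≤ σ.ptr q
  | .lt p q => σ.ptr p < σ.ptr q

/-- `Exec W len s σ t σ'`: on a machine with word bound `W` and array lengths `len`, the program `s`
started in `σ` halts in `σ'` after `t` atomic steps (instructions and tests). -/
inductive Exec (W : ℕ) (len : ι → ℕ) : Stmt ι → State D ι → ℕ → State D ι → Prop
  | skip (σ : State D ι) : Exec W len .skip σ 0 σ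
  | op {i : Instr ι} {σ σ' : State D ι} (h : i.step W len σ = some σ') :
      Exec W len (.op i) σ 1 σ'
  | seq {s s' : Stmt ι} {σ σ' σ'' : State D ι} {t t' : ℕ} (h : Exec W len s σ t σ')
      (h' : Exec W len s' σ' t' σ'') : Exec W len (.seq s s') σ (t + t') σ''
  | ite_true {c : Test} {s s' : Stmt ι} {σ σ' : State D ι} {t : ℕ} (hc : c.holds σ)
      (h : Exec W len s σ t σ') : Exec W len (.ite c s s') σ (t + 1) σ'
  | ite_false {c : Test} {s s' : Stmt ι} {σ σ' : State D ι} {t : ℕ} (hc : ¬ c.holds σ)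
      (h : Exec W len s' σ t σ') : Exec W len (.ite c s s') σ (t + 1) σ'
  | loop_true {c : Test} {s : Stmt ι} {σ σ' σ'' : State D ι} {t t' : ℕ} (hc : c.holds σ)
      (h : Exec W len s σ t σ') (h' : Exec W len (.loop c s) σ' t' σ'') :
      Exec W len (.loop c s) σ (t + t' + 1) σ''
  | loop_false {c : Test} {s : Stmt ι} {σ : State D ι} (hc : ¬ c.holds σ) :
      Exec W len (.loop c s) σ 1 σ

end Semantics

/-! ### Renaming and register count -/

/-- Rename the arrays by `f` and add `d` to the names of all registers. -/
def Instr.rename {ι κ : Type} (f : ι → κ) (d : ℕ) : Instr ι → Instr κ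
  | .pset p k => .pset (p + d) k
  | .pmov p q => .pmov (p + d) (q + d)
  | .padd p q r => .padd (p + d) (q + d) (r + d)
  | .psub p q r => .psub (p + d) (q + d) (r + d)
  | .phalf p q => .phalf (p + d) (q + d)
  | .load x A p => .load (x + d) (f A) (p + d)
  | .store A p x => .store (f A) (p + d) (x + d)
  | .zero x => .zero (x + d)
  | .one x => .one (x + d)
  | .mov x y => .mov (x + d) (y + d)
  | .add x y z => .add (x + d) (y + d) (z + d)
  | .sub x y z => .sub (x + d) (y + d) (z + d)
  | .mul x y z => .mul (x + d) (y + d) (z + d)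
  | .inv x y => .inv (x + d) (y + d)

/-- Add `d` to the names of the registers of a test. -/
def Test.rename (d : ℕ) : Test → Test
  | .le p q => .le (p + d) (q + d)
  | .lt p q => .lt (p + d) (q + d)

/-- Rename the arrays by `f` and add `d` to the names of all registers. -/
def Stmt.rename {ι κ : Type} (f : ι → κ) (d : ℕ) : Stmt ι → Stmt κ
  | .skip => .skip
  | .op i => .op (i.rename f d)
  | .seq s s' => .seq (s.rename f d) (s'.rename f d)
  | .ite c s s' => .ite (c.rename d) (s.rename f d) (s'.rename f d)
  | .loop c s => .loop (c.rename d) (s.rename f d)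

/-- A number above the names of all registers that occur in an instruction. -/
def Instr.numRegs {ι : Type} : Instr ι → ℕ
  | .pset p _ => p + 1
  | .pmov p q => max p q + 1
  | .padd p q r => max p (max q r) + 1
  | .psub p q r => max p (max q r) + 1
  | .phalf p q => max p q + 1
  | .load x _ p => max x p + 1
  | .store _ p x => max p x + 1
  | .zero x => x + 1
  | .one x => x + 1
  | .mov x y => max x y + 1
  | .add x y z => max x (max y z) + 1
  | .sub x y z => max x (max y z) + 1
  | .mul x y z => max x (max y z) + 1
  | .inv x y => max x y + 1

/-- A number above the names of all registers that occur in a test. -/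
def Test.numRegs : Test → ℕ
  | .le p q => max p q + 1
  | .lt p q => max p q + 1

/-- A number above the names of all registers that occur in a program: it uses at most this many
pointer registers and at most this many algebraic registers. -/
def Stmt.numRegs {ι : Type} : Stmt ι → ℕ
  | .skip => 0
  | .op i => i.numRegs
  | .seq s s' => max s.numRegs s'.numRegs
  | .ite c s s' => max c.numRegs (max s.numRegs s'.numRegs)
  | .loop c s => max c.numRegs s.numRegs

end AlgRAM

/-! ### Bit-reversed (truncated) Fourier transforms -/

namespace FFTAccu

open AlgRAM

/-- The length-`p` bit reversal of `i`. -/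
def bitRev (p i : ℕ) : ℕ :=
  ∑ j ∈ Finset.range p, if i.testBit j then 2 ^ (p - 1 - j) else 0

/-- `ω` is a principal `N`-th root of unity in `D`, and `N` is invertible in `D`. -/
structure IsPrincipalRoot {D : Type*} [CommRing D] (ω : D) (N : ℕ) : Prop where
  pow_eq_one : ω ^ N = 1
  sum_eq_zero : ∀ i, 0 < i → i < N → ∑ j ∈ Finset.range N, ω ^ (i * j) = 0
  isUnit : IsUnit (N : D)

/-- The polynomial whose coefficients are the first `n` entries of an array. -/
noncomputable def toPoly {D : Type*} [CommRing D] (n : ℕ) (f : ℕ → D) : D[X] :=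
  ∑ i ∈ Finset.range n, C (f i) * X ^ i

/-- Entry `i` of the length-`n` bit-reversed truncated Fourier transform, at the `2 ^ p`-th root of
unity `ω`, of the polynomial with coefficients `f 0, …, f (n - 1)`. For `n = 2 ^ p` this is the
bit-reversed discrete Fourier transform. -/
noncomputable def brTFT {D : Type*} [CommRing D] (ω : D) (p n : ℕ) (f : ℕ → D) (i : ℕ) : D :=
  (toPoly n f).eval (ω ^ bitRev p i)

/-- Lengths `n` and exponents `p` of a DFT. -/
def DFTSize (n p : ℕ) : Prop := n = 2 ^ p

/-- Lengths `n` and exponents `p` of a TFT: `2 ^ p` is the least power of two that is at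
least `n`, where `n ≥ 1`. -/
def TFTSize (n p : ℕ) : Prop := n ≤ 2 ^ p ∧ 2 ^ p < 2 * n

/-- Calling convention of a transform on one array of length `n`: pointer registers `0` and `1` hold
`n` and `2 ^ p`, algebraic register `0` holds the root of unity; all else is arbitrary. -/
structure TransformInput {D : Type*} [CommRing D] (n p : ℕ) (ω : D) (σ : State D Unit) : Prop where
  ptr_zero : σ.ptr 0 = n
  ptr_one : σ.ptr 1 = 2 ^ p
  alg_zero : σ.alg 0 = ω

/-- `P` and `Q` compute over-place (on a machine with one array, of length exactly `n`, and with word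
bound `κ * n`) the bit-reversed TFT and its inverse, for all sizes allowed by `dom`. -/
structure OverPlaceTransform (D : Type*) [CommRing D] (dom : ℕ → ℕ → Prop) (κ : ℕ)
    (P Q : Stmt Unit) : Prop where
  forward : ∀ (n p : ℕ) (ω : D), dom n p → IsPrincipalRoot ω (2 ^ p) →
    ∀ σ : State D Unit, TransformInput n p ω σ →
      ∃ t σ', Exec (κ * n) (fun _ => n) P σ t σ' ∧
        ∀ i < n, σ'.arr () i = brTFT ω p n (σ.arr ()) i
  backward : ∀ (n p : ℕ) (ω : D), dom n p → IsPrincipalRoot ω (2 ^ p) →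
    ∀ (σ : State D Unit) (f : ℕ → D), TransformInput n p ω σ →
      (∀ i < n, σ.arr () i = brTFT ω p n f i) →
      ∃ t σ', Exec (κ * n) (fun _ => n) Q σ t σ' ∧ ∀ i < n, σ'.arr () i = f i

/-- The transform program `P` takes at most `T n` steps on arrays of length `n`. -/
def TransformTime (D : Type*) [CommRing D] (dom : ℕ → ℕ → Prop) (T : ℕ → ℕ) (P : Stmt Unit) :
    Prop :=
  ∀ (n p : ℕ) (ω : D), dom n p → IsPrincipalRoot ω (2 ^ p) →
    ∀ σ : State D Unit, TransformInput n p ω σ →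
      ∀ W t σ', Exec W (fun _ => n) P σ t σ' → t ≤ T n

/-- `T n = O(n log n)`. -/
def IsQuasiLinear (T : ℕ → ℕ) : Prop :=
  (fun n => (T n : ℝ)) =O[Filter.atTop] fun n : ℕ => (n : ℝ) * Real.log n

/-! ### The algorithm -/

/-- The three arrays. -/
inductive Arr : Type
  | a
  | b
  | c
  deriving DecidableEq

/-- Pointer registers of the algorithm; `pM` and `pN` are the input registers holding the lengths of
`a` and `b`, and `pOrd` receives the order `2 ^ p` of the root of unity. -/
abbrev pM : ℕ := 0
abbrev pN : ℕ := 1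
abbrev pOrd : ℕ := 2
abbrev pLen : ℕ := 3
abbrev pR : ℕ := 4
abbrev pOff : ℕ := 5
abbrev pLb : ℕ := 6
abbrev pLa : ℕ := 7
abbrev pOffA : ℕ := 8
abbrev pEnd : ℕ := 9
abbrev pZero : ℕ := 10
abbrev pOne : ℕ := 11
abbrev pI : ℕ := 12
abbrev pJ : ℕ := 13
abbrev pH : ℕ := 14
abbrev pK : ℕ := 15

/-- Algebraic registers of the algorithm; `xW` is the input register holding `ω`. -/
abbrev xW : ℕ := 0
abbrev xTwist : ℕ := 1
abbrev xG : ℕ := 2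
abbrev xPow : ℕ := 3
abbrev xX : ℕ := 4
abbrev xY : ℕ := 5

/-- Run the transform `P` on the first entries of the array `A`; the length, the order and the root
are in the registers `pl`, `po`, `xr`. The registers of `P` are kept apart from those above. -/
def callTransform (P : Stmt Unit) (A : Arr) (pl po xr : ℕ) : Stmt Arr :=
  block [
    .op (.pmov (0 + 16) pl),
    .op (.pmov (1 + 16) po),
    .op (.mov (0 + 16) xr),
    P.rename (fun _ => A) 16]

/-- `xTwist ← ω ^ [s]_p`, where `s` is in `ps`. -/
def loadTwist (ps : ℕ) : Stmt Arr :=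
  block [
    .op (.one xTwist),
    .op (.mov xG xW),
    .op (.pmov pK ps),
    .op (.phalf pH pOrd),
    .loop (.le pOne pH) (block [
      .ite (.le pH pK)
        (block [
          .op (.psub pK pK pH),
          .op (.mul xTwist xTwist xG)])
        .skip,
      .op (.mul xG xG xG),
      .op (.phalf pH pH)])]

/-- `f_i ← f_i * xTwist ^ i` for all entries of `A`, whose length is in `pl`. -/
def scale (A : Arr) (pl : ℕ) : Stmt Arr :=
  block [
    .op (.one xPow),
    .op (.pset pI 0),
    .loop (.lt pI pl) (block [
      .op (.load xX A pI),
      .op (.mul xX xX xPow),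
      .op (.store A pI xX),
      .op (.mul xPow xPow xTwist),
      .op (.padd pI pI pOne)])]

/-- `xG ← ω ^ (2 ^ p / L)`, where the power of two `L` is in `pL`. -/
def loadRoot (pL : ℕ) : Stmt Arr :=
  block [
    .op (.mov xG xW),
    .op (.pmov pH pL),
    .loop (.lt pH pOrd) (block [
      .op (.mul xG xG xG),
      .op (.padd pH pH pH)])]

/-- `for i = len - 1 downto L do f_{i-L} += f_i`. -/
def fold (A : Arr) (pl pL : ℕ) : Stmt Arr :=
  block [
    .op (.pmov pI pl),
    .loop (.lt pL pI) (block [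
      .op (.psub pI pI pOne),
      .op (.psub pJ pI pL),
      .op (.load xX A pJ),
      .op (.load xY A pI),
      .op (.add xX xX xY),
      .op (.store A pJ xX)])]

/-- `for i = L to len - 1 do f_{i-L} -= f_i`. -/
def unfold (A : Arr) (pl pL : ℕ) : Stmt Arr :=
  block [
    .op (.pmov pI pL),
    .loop (.lt pI pl) (block [
      .op (.psub pJ pI pL),
      .op (.load xX A pJ),
      .op (.load xY A pI),
      .op (.sub xX xX xY),
      .op (.store A pJ xX),
      .op (.padd pI pI pOne)])]

/-- The partial TFT: replace the first `L` entries of `A` by the values at `ω ^ [s]_p`, …,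
`ω ^ [s + L - 1]_p` of the polynomial stored in `A`, where `s = k * L` and `L = 2 ^ ℓ`. The
length of `A` is in `pl`, `s` is in `ps`, `L` is in `pL`. -/
def partTFT (dft : Stmt Unit) (A : Arr) (pl ps pL : ℕ) : Stmt Arr :=
  block [
    loadTwist ps,
    scale A pl,
    fold A pl pL,
    loadRoot pL,
    callTransform dft A pL pL xG]

/-- The inverse of the partial TFT. -/
def partTFTInv (idft : Stmt Unit) (A : Arr) (pl ps pL : ℕ) : Stmt Arr :=
  block [
    loadRoot pL,
    callTransform idft A pL pL xG,
    unfold A pl pL,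
    loadTwist ps,
    .op (.inv xTwist xTwist),
    scale A pl]

/-- `pL ←` the largest power of two that is at most the minimum of `pR` and `pl`. -/
def loadPow2 (pL pl : ℕ) : Stmt Arr :=
  block [
    .ite (.le pR pl) (.op (.pmov pJ pR)) (.op (.pmov pJ pl)),
    .op (.pset pL 1),
    .op (.pset pK 2),
    .loop (.le pK pJ) (block [
      .op (.pmov pL pK),
      .op (.padd pK pK pK)])]

/-- `for i = 0 to 2 ^ ℓ - 1 do c_{u+i} += a_i * b_{u-v+i}`, with `u` in `pOffA`, `v` in `pOff`. -/
def mulAcc : Stmt Arr :=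
  block [
    .op (.pset pI 0),
    .loop (.lt pI pLa) (block [
      .op (.load xX .a pI),
      .op (.psub pJ pOffA pOff),
      .op (.padd pJ pJ pI),
      .op (.load xY .b pJ),
      .op (.mul xX xX xY),
      .op (.padd pJ pOffA pI),
      .op (.load xY .c pJ),
      .op (.add xY xY xX),
      .op (.store .c pJ xY),
      .op (.padd pI pI pOne)])]

/-- One iteration of the while loop of the algorithm: with `2 ^ ℓ` in `pLa`, `2 ^ (ℓ + t)` in `pLb`
and `k * 2 ^ (ℓ + t) = m + n - 1 - r` in `pOff`, update `2 ^ (ℓ + t)` entries of `c`. -/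
def iteration (dft idft : Stmt Unit) : Stmt Arr :=
  block [
    loadPow2 pLa pM,
    loadPow2 pLb pN,
    .op (.psub pOff pLen pR),
    partTFT dft .b pN pOff pLb,
    .op (.pmov pOffA pOff),
    .op (.padd pEnd pOff pLb),
    .loop (.lt pOffA pEnd) (block [
      partTFT dft .a pM pOffA pLa,
      mulAcc,
      partTFTInv idft .a pM pOffA pLa,
      .op (.padd pOffA pOffA pLa)]),
    partTFTInv idft .b pN pOff pLb,
    .op (.psub pR pR pLb)]

/-- In-place fast accumulating polynomial multiplication, using the programs `dft`, `idft` for the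
bit-reversed DFT and its inverse, and `tft`, `itft` for the bit-reversed TFT and its inverse. -/
def fftAccu (dft idft tft itft : Stmt Unit) : Stmt Arr :=
  block [
    .op (.pset pZero 0),
    .op (.pset pOne 1),
    .op (.padd pLen pM pN),
    .op (.psub pLen pLen pOne),
    .op (.pset pOrd 1),
    .loop (.lt pOrd pLen) (.op (.padd pOrd pOrd pOrd)),
    callTransform tft .c pLen pOrd xW,
    .op (.pmov pR pLen),
    .loop (.lt pZero pR) (iteration dft idft),
    callTransform itft .c pLen pOrd xW]

/-! ### Specification of in-place accumulating multiplication -/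

/-- The lengths of the arrays. -/
def lens (m n : ℕ) : Arr → ℕ
  | .a => m
  | .b => n
  | .c => m + n - 1

/-- Admissible inputs: `1 ≤ m ≤ n` are in pointer registers `0` and `1`, and algebraic register `0`
holds a principal `2 ^ p`-th root of unity, where `2 ^ p` is the least power of two that is at least
`m + n - 1`. The arrays and all other registers are arbitrary. -/
structure MulInput {D : Type*} [CommRing D] (m n : ℕ) (σ : State D Arr) : Prop where
  one_le : 1 ≤ m
  le : m ≤ n
  root : ∃ p, TFTSize (m + n - 1) p ∧ IsPrincipalRoot (σ.alg xW) (2 ^ p)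
  ptr_m : σ.ptr pM = m
  ptr_n : σ.ptr pN = n

/-- On a machine whose memory consists of the arrays `a`, `b`, `c` of lengths `m`, `n`, `m + n - 1`
and of the registers, with word bound `κ * n`, the program `P` replaces the coefficients of `C` by
those of `C + A * B`, and leaves `a` and `b` in their initial state. -/
def AccumulatesProduct (D : Type*) [CommRing D] (κ : ℕ) (P : Stmt Arr) : Prop :=
  ∀ (m n : ℕ) (σ : State D Arr), MulInput m n σ →
    ∃ t σ', Exec (κ * n) (lens m n) P σ t σ' ∧
      (∀ i < m, σ'.arr .a i = σ.arr .a i) ∧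
      (∀ i < n, σ'.arr .b i = σ.arr .b i) ∧
      toPoly (m + n - 1) (σ'.arr .c) =
        toPoly (m + n - 1) (σ.arr .c) + toPoly m (σ.arr .a) * toPoly n (σ.arr .b)

/-- The program `P` takes at most `T n` steps on inputs of lengths `m ≤ n`. -/
def MulTime (D : Type*) [CommRing D] (T : ℕ → ℕ) (P : Stmt Arr) : Prop :=
  ∀ (m n : ℕ) (σ : State D Arr), MulInput m n σ →
    ∀ W t σ', Exec W (lens m n) P σ t σ' → t ≤ T n

end FFTAccu

/-! Multiplication. If 2^ℓ divides s and i < 2^ℓ, then [s+i]_p = [s]_p + 2^(p-ℓ) [i]_ℓ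
(`bitRev_two_pow_mul_add`). So the points ω^[s], …, ω^[s+2^ℓ-1] are ω^[s] times the 2^ℓ-th roots of
unity in bit-reversed order. After the substitution of ω^[s] X for X, the values there depend only
on the remainder modulo X^(2^ℓ) - 1, which folding computes (`brTFT_partial`). Scaling, folding and
the DFT can each be undone exactly, so a and b are restored. Evaluation is a ring homomorphism, so
adding products of values to the TFT of C gives the TFT of C + AB (`accArr_tftArr`), and the inverse
TFT finishes.

Time. An iteration on B = 2^(ℓ+t) entries of c costs O(n + B log n): apart from the DFTs, the 2^t
partial transforms of a cost O(2^t m) up to lower terms, and 2^t m ≤ 2n (`two_pow_mul_le`). There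
are at most log₂ n + 3 iterations, because each one removes either the largest power of two below n,
at most three times, or the leading binary digit of r (`rounds_sub`, `rounds_le`). The blocks B add
up to m + n - 1.

TFT from DFT. Cut the array along the binary digits of n. When S + 1 blocks of length L = 2^k are
left, with S even, the last block is split off: it receives the polynomial modulo the annihilator of
its own points, the other S blocks receive the polynomial modulo the annihilator of theirs. After
scaling by ω^[SL] the first annihilator is X^L - 1. The second one is M(X^L), where M is the sum of
y^u over the submasks u of S, that is the product of 1 + y^(2^j) over the binary digits j of S
(`maskSum_eq_zero`). M is monic of degree S with coefficients 0 and 1, so division by M(X^L)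
consists of subtracting the last block from some of the others. The sum of all original blocks is
recovered from the reduced ones and M(1) times the last block. M(1) is a power of two, hence a unit,
so everything happens in place and can be undone (`splitArr`). A level costs O(n + (n/2^k) log n)
and one DFT, which sums to O(n log n).

Machine. `WP` is total correctness with running time, which handles correctness and cost together.
Determinism carries the time bounds to every halting run, under any word bound. -/

namespace AlgRAM

/-! ### Weakest preconditions with running time -/

section WeakestPrecondition

variable {D : Type*} [CommRing D] {ι : Type} [DecidableEq ι] {W : ℕ} {len : ι → ℕ}

/-- The program `s` started in `σ` halts, and its running time and its final state satisfy `Q`. -/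
def WP (W : ℕ) (len : ι → ℕ) (s : Stmt ι) (Q : ℕ → State D ι → Prop) (σ : State D ι) : Prop :=
  ∃ t σ', Exec W len s σ t σ' ∧ Q t σ'

theorem WP.mono {s : Stmt ι} {Q Q' : ℕ → State D ι → Prop} {σ : State D ι}
    (h : WP W len s Q σ) (hQ : ∀ t σ', Q t σ' → Q' t σ') : WP W len s Q' σ := by
  obtain ⟨t, σ', h, h'⟩ := h
  exact ⟨t, σ', h, hQ _ _ h'⟩

theorem wp_skip {Q : ℕ → State D ι → Prop} {σ : State D ι} :
    WP W len .skip Q σ ↔ Q 0 σ := by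
  constructor
  · rintro ⟨t, σ', h, hQ⟩
    cases h
    exact hQ
  · exact fun h => ⟨0, σ, .skip σ, h⟩

theorem wp_seq {s s' : Stmt ι} {Q : ℕ → State D ι → Prop} {σ : State D ι} :
    WP W len (.seq s s') Q σ ↔
      WP W len s (fun t σ' => WP W len s' (fun t' => Q (t + t')) σ') σ := by
  constructor
  · rintro ⟨t, σ', h, hQ⟩
    cases h with
    | seq h h' => exact ⟨_, _, h, _, _, h', hQ⟩
  · rintro ⟨t, σ', h, t', σ'', h', hQ⟩
    exact ⟨_, _, .seq h h', hQ⟩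

theorem wp_ite {c : Test} {s s' : Stmt ι} {Q : ℕ → State D ι → Prop} {σ : State D ι} :
    WP W len (.ite c s s') Q σ ↔
      (c.holds σ → WP W len s (fun t => Q (t + 1)) σ) ∧
      (¬ c.holds σ → WP W len s' (fun t => Q (t + 1)) σ) := by
  constructor
  · rintro ⟨t, σ', h, hQ⟩
    cases h with
    | ite_true hc h => exact ⟨fun _ => ⟨_, _, h, hQ⟩, fun h' => absurd hc h'⟩
    | ite_false hc h => exact ⟨fun h' => absurd h' hc, fun _ => ⟨_, _, h, hQ⟩⟩
  · rintro ⟨h, h'⟩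
    by_cases hc : c.holds σ
    · obtain ⟨t, σ', h, hQ⟩ := h hc
      exact ⟨_, _, .ite_true hc h, hQ⟩
    · obtain ⟨t, σ', h, hQ⟩ := h' hc
      exact ⟨_, _, .ite_false hc h, hQ⟩

theorem wp_op {i : Instr ι} {Q : ℕ → State D ι → Prop} {σ : State D ι} :
    WP W len (.op i) Q σ ↔ ∃ σ', i.step W len σ = some σ' ∧ Q 1 σ' := by
  constructor
  · rintro ⟨t, σ', h, hQ⟩
    cases h with
    | op h => exact ⟨_, h, hQ⟩
  · rintro ⟨σ', h, hQ⟩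
    exact ⟨_, _, .op h, hQ⟩

theorem wp_block_nil {Q : ℕ → State D ι → Prop} {σ : State D ι} :
    WP W len (block []) Q σ ↔ Q 0 σ := wp_skip

theorem wp_block_cons {s : Stmt ι} {l : List (Stmt ι)} {Q : ℕ → State D ι → Prop}
    {σ : State D ι} :
    WP W len (block (s :: l)) Q σ ↔
      WP W len s (fun t σ' => WP W len (block l) (fun t' => Q (t + t')) σ') σ := wp_seq

section Instructions

variable {Q : ℕ → State D ι → Prop} {σ : State D ι} {p q r k x y z : ℕ} {A : ι}

theorem wp_pset : WP W len (.op (.pset p k)) Q σ ↔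
    k ≤ W ∧ Q 1 ⟨σ.arr, σ.alg, Function.update σ.ptr p k⟩ := by
  simp [wp_op, Instr.step, State.setPtr]

theorem wp_pmov : WP W len (.op (.pmov p q)) Q σ ↔
    σ.ptr q ≤ W ∧ Q 1 ⟨σ.arr, σ.alg, Function.update σ.ptr p (σ.ptr q)⟩ := by
  simp [wp_op, Instr.step, State.setPtr]

theorem wp_padd : WP W len (.op (.padd p q r)) Q σ ↔
    σ.ptr q + σ.ptr r ≤ W ∧
      Q 1 ⟨σ.arr, σ.alg, Function.update σ.ptr p (σ.ptr q + σ.ptr r)⟩ := by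
  simp [wp_op, Instr.step, State.setPtr]

theorem wp_psub : WP W len (.op (.psub p q r)) Q σ ↔
    σ.ptr q - σ.ptr r ≤ W ∧
      Q 1 ⟨σ.arr, σ.alg, Function.update σ.ptr p (σ.ptr q - σ.ptr r)⟩ := by
  simp only [wp_op, Instr.step, State.setPtr, Option.ite_none_right_eq_some, Option.some.injEq,
    and_assoc, exists_and_left, exists_eq_left']

theorem wp_phalf : WP W len (.op (.phalf p q)) Q σ ↔
    σ.ptr q / 2 ≤ W ∧ Q 1 ⟨σ.arr, σ.alg, Function.update σ.ptr p (σ.ptr q / 2)⟩ := by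
  simp [wp_op, Instr.step, State.setPtr]

theorem wp_load : WP W len (.op (.load x A p)) Q σ ↔
    σ.ptr p < len A ∧
      Q 1 ⟨σ.arr, Function.update σ.alg x (σ.arr A (σ.ptr p)), σ.ptr⟩ := by
  simp [wp_op, Instr.step, State.setAlg]

theorem wp_store : WP W len (.op (.store A p x)) Q σ ↔
    σ.ptr p < len A ∧
      Q 1 ⟨Function.update σ.arr A (Function.update (σ.arr A) (σ.ptr p) (σ.alg x)),
        σ.alg, σ.ptr⟩ := by
  simp [wp_op, Instr.step, State.setArr]

theorem wp_zero : WP W len (.op (.zero x)) Q σ ↔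
    Q 1 ⟨σ.arr, Function.update σ.alg x 0, σ.ptr⟩ := by
  simp [wp_op, Instr.step, State.setAlg]

theorem wp_one : WP W len (.op (.one x)) Q σ ↔
    Q 1 ⟨σ.arr, Function.update σ.alg x 1, σ.ptr⟩ := by
  simp [wp_op, Instr.step, State.setAlg]

theorem wp_mov : WP W len (.op (.mov x y)) Q σ ↔
    Q 1 ⟨σ.arr, Function.update σ.alg x (σ.alg y), σ.ptr⟩ := by
  simp [wp_op, Instr.step, State.setAlg]

theorem wp_add : WP W len (.op (.add x y z)) Q σ ↔
    Q 1 ⟨σ.arr, Function.update σ.alg x (σ.alg y + σ.alg z), σ.ptr⟩ := by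
  simp [wp_op, Instr.step, State.setAlg]

theorem wp_sub : WP W len (.op (.sub x y z)) Q σ ↔
    Q 1 ⟨σ.arr, Function.update σ.alg x (σ.alg y - σ.alg z), σ.ptr⟩ := by
  simp [wp_op, Instr.step, State.setAlg]

theorem wp_mul : WP W len (.op (.mul x y z)) Q σ ↔
    Q 1 ⟨σ.arr, Function.update σ.alg x (σ.alg y * σ.alg z), σ.ptr⟩ := by
  simp [wp_op, Instr.step, State.setAlg]

theorem wp_inv : WP W len (.op (.inv x y)) Q σ ↔
    IsUnit (σ.alg y) ∧
      Q 1 ⟨σ.arr, Function.update σ.alg x (Ring.inverse (σ.alg y)), σ.ptr⟩ := by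
  simp [wp_op, Instr.step, State.setAlg]

end Instructions

/-- Loop rule, for an invariant that depends on a variant `k` and on the elapsed time `t`. -/
theorem wp_loop {c : Test} {s : Stmt ι} {Q : ℕ → State D ι → Prop}
    (I : ℕ → ℕ → State D ι → Prop)
    (hI : ∀ k t σ, I k t σ → c.holds σ →
      WP W len s (fun t' σ' => ∃ k' < k, I k' (t + t' + 1) σ') σ)
    (hQ : ∀ k t σ, I k t σ → ¬ c.holds σ → Q (t + 1) σ)
    {k : ℕ} {σ : State D ι} (h : I k 0 σ) : WP W len (.loop c s) Q σ := by
  suffices H : ∀ k t σ, I k t σ → WP W len (.loop c s) (fun t' => Q (t + t')) σ by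
    simpa using H k 0 σ h
  intro k
  induction k using Nat.strong_induction_on with
  | _ k ih =>
    intro t σ h
    by_cases hc : c.holds σ
    · obtain ⟨t', σ', he, k', hk, h'⟩ := hI k t σ h hc
      obtain ⟨t'', σ'', he', h''⟩ := ih k' hk _ _ h'
      refine ⟨_, _, .loop_true hc he he', ?_⟩
      convert h'' using 1
      ring
    · exact ⟨_, _, .loop_false hc, hQ k t σ h hc⟩

/-- Loop rule for a loop whose body is executed `N` times. -/
theorem wp_for {c : Test} {s : Stmt ι} {Q : ℕ → State D ι → Prop}
    (N : ℕ) (I : ℕ → ℕ → State D ι → Prop)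
    (hI : ∀ i t σ, i < N → I i t σ →
      c.holds σ ∧ WP W len s (fun t' σ' => I (i + 1) (t + t' + 1) σ') σ)
    (hQ : ∀ t σ, I N t σ → ¬ c.holds σ ∧ Q (t + 1) σ)
    {σ : State D ι} (h : I 0 0 σ) : WP W len (.loop c s) Q σ := by
  refine wp_loop (fun k t σ => k ≤ N ∧ I (N - k) t σ) ?_ ?_ (k := N) ⟨le_rfl, by simpa using h⟩
  · rintro k t σ ⟨hk, h⟩ hc
    rcases Nat.eq_zero_or_pos k with rfl | hk0
    · exact absurd hc (hQ t σ h).1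
    · refine (hI _ t σ (by omega) h).2.mono fun t' σ' h' => ⟨k - 1, by omega, by omega, ?_⟩
      rwa [show N - (k - 1) = N - k + 1 by omega]
  · rintro k t σ ⟨hk, h⟩ hc
    rcases Nat.eq_zero_or_pos k with rfl | hk0
    · exact (hQ t σ h).2
    · exact absurd (hI _ t σ (by omega) h).1 hc

end WeakestPrecondition

/-! ### Determinism and untouched memory -/

section Determinism

variable {D : Type*} [CommRing D] {ι : Type} [DecidableEq ι] {W W' : ℕ} {len : ι → ℕ}

/-- The word bound only decides whether an instruction succeeds, never what it produces, so two
different bounds are allowed. -/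
theorem Instr.step_unique {i : Instr ι} {σ σ₁ σ₂ : State D ι} (h₁ : i.step W len σ = some σ₁)
    (h₂ : i.step W' len σ = some σ₂) : σ₁ = σ₂ := by
  cases i <;> simp only [Instr.step, State.setPtr, Option.ite_none_right_eq_some,
    Option.some.injEq] at h₁ h₂ <;> simp_all

/-- Halting executions agree, whatever the word bounds. -/
theorem Exec.unique {s : Stmt ι} {σ σ₁ σ₂ : State D ι} {t₁ t₂ : ℕ} (h₁ : Exec W len s σ t₁ σ₁)
    (h₂ : Exec W' len s σ t₂ σ₂) : t₁ = t₂ ∧ σ₁ = σ₂ := by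
  induction h₁ generalizing t₂ σ₂ with
  | skip => cases h₂; exact ⟨rfl, rfl⟩
  | op h => cases h₂ with | op h' => exact ⟨rfl, Instr.step_unique h h'⟩
  | seq _ _ ih ih' =>
    cases h₂ with
    | seq h h' =>
      obtain ⟨rfl, rfl⟩ := ih h
      obtain ⟨rfl, rfl⟩ := ih' h'
      exact ⟨rfl, rfl⟩
  | ite_true hc _ ih =>
    cases h₂ with
    | ite_true _ h => obtain ⟨rfl, rfl⟩ := ih h; exact ⟨rfl, rfl⟩
    | ite_false hc' _ => exact absurd hc hc'
  | ite_false hc _ ih =>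
    cases h₂ with
    | ite_false _ h => obtain ⟨rfl, rfl⟩ := ih h; exact ⟨rfl, rfl⟩
    | ite_true hc' _ => exact absurd hc' hc
  | loop_true hc _ _ ih ih' =>
    cases h₂ with
    | loop_true _ h h' =>
      obtain ⟨rfl, rfl⟩ := ih h
      obtain ⟨rfl, rfl⟩ := ih' h'
      exact ⟨rfl, rfl⟩
    | loop_false hc' => exact absurd hc hc'
  | loop_false hc =>
    cases h₂ with
    | loop_true hc' _ _ => exact absurd hc' hc
    | loop_false _ => exact ⟨rfl, rfl⟩

/-- Time bounds speak of all halting runs under all word bounds; one run under a sufficient bound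
decides them. -/
theorem WP.of_exec {s : Stmt ι} {Q : ℕ → State D ι → Prop} {σ σ' : State D ι} {t : ℕ}
    (h : WP W len s Q σ) (h' : Exec W' len s σ t σ') : Q t σ' := by
  obtain ⟨t₁, σ₁, h₁, hQ⟩ := h
  obtain ⟨rfl, rfl⟩ := Exec.unique h₁ h'
  exact hQ

theorem Instr.step_arr_of_le {i : Instr ι} {σ σ' : State D ι} (h : i.step W len σ = some σ')
    {A : ι} {j : ℕ} (hj : len A ≤ j) : σ'.arr A j = σ.arr A j := by
  cases i with
  | store B p x =>
    simp only [Instr.step, State.setArr, Option.ite_none_right_eq_some, Option.some.injEq] at h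
    obtain ⟨hp, rfl⟩ := h
    rcases eq_or_ne A B with rfl | hA
    · have : j ≠ σ.ptr p := by omega
      simp [this]
    · simp [hA]
  | _ =>
    simp only [Instr.step, State.setPtr, State.setAlg, Option.ite_none_right_eq_some,
      Option.some.injEq] at h
    obtain ⟨-, rfl⟩ := h
    rfl

/-- A program does not change what lies beyond the ends of the arrays. -/
theorem Exec.arr_of_le {s : Stmt ι} {σ σ' : State D ι} {t : ℕ} (h : Exec W len s σ t σ')
    {A : ι} {j : ℕ} (hj : len A ≤ j) : σ'.arr A j = σ.arr A j := by
  induction h with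
  | skip => rfl
  | op h => exact Instr.step_arr_of_le h hj
  | seq _ _ ih ih' => rw [ih', ih]
  | ite_true _ _ ih => exact ih
  | ite_false _ _ ih => exact ih
  | loop_true _ _ _ ih ih' => rw [ih', ih]
  | loop_false _ => rfl

end Determinism

/-! ### Running a one-array program as a subroutine -/

section Renaming

variable {D : Type*} [CommRing D] {κ : Type} [DecidableEq κ]

/-- Put the memory of a machine with one array into the array `A` and into the registers from `d`
on. -/
def State.embed (τ : State D κ) (A : κ) (d : ℕ) (σ : State D Unit) : State D κ where
  arr := Function.update τ.arr A (σ.arr ())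
  alg i := if i < d then τ.alg i else σ.alg (i - d)
  ptr i := if i < d then τ.ptr i else σ.ptr (i - d)

variable {τ : State D κ} {A : κ} {d L W W' : ℕ} {len : κ → ℕ}

theorem update_embed {α : Type*} (f g : ℕ → α) (p : ℕ) (v : α) :
    Function.update (fun i => if i < d then f i else g (i - d)) (p + d) v =
      fun i => if i < d then f i else Function.update g p v (i - d) := by
  funext i
  by_cases hi : i < d
  · have : i ≠ p + d := by omega
    simp [hi, this]
  · by_cases h : i = p + d
    · subst h
      simp
    · have : i - d ≠ p := by omega
      simp [hi, h, this]

/-- Success carries over because the host machine has at least as long an array and at least as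
large a word bound. -/
theorem Instr.step_rename {i : Instr Unit} {σ σ' : State D Unit}
    (h : i.step W (fun _ => L) σ = some σ') (hL : L ≤ len A) (hW : W ≤ W') :
    (i.rename (fun _ => A) d).step W' len (τ.embed A d σ) = some (τ.embed A d σ') := by
  cases i <;>
    simp only [Instr.step, Instr.rename, State.setPtr, State.setAlg, State.setArr,
      Option.ite_none_right_eq_some, Option.some.injEq] at h ⊢ <;>
    first
      | subst h
      | obtain ⟨h0, rfl⟩ := h
        refine ⟨?_, ?_⟩ <;> try first | exact h0.trans hW | exact h0.trans_le hL
  all_goals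
    simp only [State.embed, update_embed, Function.update_self, Function.update_idem,
      Nat.not_lt.2 (Nat.le_add_left d _), if_false, Nat.add_sub_cancel] at *
    try first | assumption | exact h0.trans hW | exact h0.trans_le hL

theorem Test.holds_rename {D : Type*} {τ : State D κ} {c : Test} {σ : State D Unit} :
    (c.rename d).holds (τ.embed A d σ) ↔ c.holds σ := by
  cases c <;> simp [Test.rename, Test.holds, State.embed]

/-- A renamed program simulates the original one, on the first `L` entries of an array. -/
theorem Exec.rename {s : Stmt Unit} {σ σ' : State D Unit} {t : ℕ}
    (h : Exec W (fun _ => L) s σ t σ') (hL : L ≤ len A) (hW : W ≤ W') :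
    Exec W' len (s.rename (fun _ => A) d) (τ.embed A d σ) t (τ.embed A d σ') := by
  induction h with
  | skip => exact .skip _
  | op h => exact .op (Instr.step_rename h hL hW)
  | seq _ _ ih ih' => exact .seq ih ih'
  | ite_true hc _ ih => exact .ite_true (Test.holds_rename.2 hc) ih
  | ite_false hc _ ih => exact .ite_false (mt Test.holds_rename.1 hc) ih
  | loop_true hc _ _ ih ih' => exact .loop_true (Test.holds_rename.2 hc) ih ih'
  | loop_false hc => exact .loop_false (mt Test.holds_rename.1 hc)

theorem wp_rename {s : Stmt Unit} {Q : ℕ → State D Unit → Prop}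
    (h : WP W (fun _ => L) s Q ⟨fun _ => τ.arr A, fun i => τ.alg (i + d), fun i => τ.ptr (i + d)⟩)
    (hL : L ≤ len A) (hW : W ≤ W') :
    WP W' len (s.rename (fun _ => A) d) (fun t τ' => ∃ σ', Q t σ' ∧ τ' = τ.embed A d σ' ∧
      ∀ j, L ≤ j → σ'.arr () j = τ.arr A j) τ := by
  obtain ⟨t, σ', h, hQ⟩ := h
  have h' := Exec.rename (τ := τ) (d := d) h hL hW
  -- The small machine starts with what the large one already holds in these places, so embedding it
  -- changes nothing.
  have : τ.embed A d ⟨fun _ => τ.arr A, fun i => τ.alg (i + d), fun i => τ.ptr (i + d)⟩ = τ := by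
    cases τ
    simp only [State.embed, Function.update_eq_self, State.mk.injEq, true_and]
    constructor <;> funext i <;> split_ifs with hi <;>
      first | rfl | exact congrArg _ (Nat.sub_add_cancel (Nat.le_of_not_lt hi))
  rw [this] at h'
  exact ⟨t, _, h', σ', hQ, rfl, fun j hj => h.arr_of_le hj⟩

end Renaming

end AlgRAM

namespace FFTAccu

open AlgRAM

/-! ### Bit reversal -/

section BitReversal

theorem bitRev_succ (p i : ℕ) : bitRev (p + 1) i = 2 ^ p * (i % 2) + bitRev p (i / 2) := by
  rw [bitRev, Finset.sum_range_succ', bitRev, add_comm]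
  congr 1
  · rcases Nat.mod_two_eq_zero_or_one i with h | h <;> simp [Nat.testBit_zero, h]
  · refine Finset.sum_congr rfl fun j _ => ?_
    rw [Nat.testBit_succ, show p + 1 - 1 - (j + 1) = p - 1 - j by omega]

/-- The top digit of `i` becomes the lowest one. `loadTwist` consumes its exponent in this order,
whereas `bitRev_succ` serves inductions from the lowest digit. -/
theorem bitRev_succ_eq_two_mul (p i : ℕ) :
    bitRev (p + 1) i = 2 * bitRev p i + if i.testBit p then 1 else 0 := by
  rw [bitRev, Finset.sum_range_succ, bitRev, Finset.mul_sum]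
  congr 1
  · refine Finset.sum_congr rfl fun j hj => ?_
    have := Finset.mem_range.1 hj
    rw [mul_ite, ← pow_succ', show p - 1 - j + 1 = p + 1 - 1 - j by omega, mul_zero]
  · simp

theorem bitRev_succ_of_lt {p i : ℕ} (h : i < 2 ^ p) : bitRev (p + 1) i = 2 * bitRev p i := by
  simp [bitRev_succ_eq_two_mul, Nat.testBit_lt_two_pow h]

theorem bitRev_succ_two_pow_add {p i : ℕ} (h : i < 2 ^ p) :
    bitRev (p + 1) (2 ^ p + i) = 2 * bitRev p i + 1 := by
  have h1 : (2 ^ p + i).testBit p = true := by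
    rw [Nat.testBit_two_pow_add_eq, Nat.testBit_lt_two_pow h]; rfl
  have h2 : bitRev p (2 ^ p + i) = bitRev p i := by
    refine Finset.sum_congr rfl fun j hj => ?_
    rw [Nat.testBit_two_pow_add_gt (Finset.mem_range.1 hj)]
  rw [bitRev_succ_eq_two_mul, h1, h2, if_pos rfl]

theorem bitRev_zero (p : ℕ) : bitRev p 0 = 0 := by simp [bitRev]

/-- The low `ℓ` digits and the remaining ones are reversed separately and exchange their places.
This makes an aligned block of points a coset of a group of roots of unity. -/
theorem bitRev_two_pow_mul_add {ℓ p : ℕ} (hℓ : ℓ ≤ p) (u : ℕ) {i : ℕ} (hi : i < 2 ^ ℓ) :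
    bitRev p (2 ^ ℓ * u + i) = bitRev (p - ℓ) u + 2 ^ (p - ℓ) * bitRev ℓ i := by
  induction ℓ generalizing p i with
  | zero =>
    obtain rfl : i = 0 := by simpa using hi
    simp [bitRev_zero]
  | succ ℓ ih =>
    obtain ⟨p, rfl⟩ : ∃ p', p = p' + 1 := ⟨p - 1, by omega⟩
    rw [pow_succ] at hi
    rw [bitRev_succ p, bitRev_succ ℓ, show (2 ^ (ℓ + 1) * u + i) / 2 = 2 ^ ℓ * u + i / 2 by
      rw [pow_succ, mul_comm _ 2, mul_assoc]; omega,
      show (2 ^ (ℓ + 1) * u + i) % 2 = i % 2 by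
      rw [pow_succ, mul_comm _ 2, mul_assoc]; omega, ih (by omega) (by omega),
      show p + 1 - (ℓ + 1) = p - ℓ by omega, mul_add, ← mul_assoc, ← pow_add,
      Nat.sub_add_cancel (by omega : ℓ ≤ p)]
    ring

theorem bitRev_two_pow_mul {ℓ p : ℕ} (hℓ : ℓ ≤ p) (u : ℕ) :
    bitRev p (2 ^ ℓ * u) = bitRev (p - ℓ) u := by
  simpa [bitRev_zero] using bitRev_two_pow_mul_add hℓ u (i := 0) (by positivity)

end BitReversal

/-! ### Principal roots of unity of two-power order -/

section PrincipalRoots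

variable {D : Type*} [CommRing D] {ω : D} {p : ℕ}

theorem sum_range_two_pow_succ (y : D) (k : ℕ) :
    ∑ j ∈ Finset.range (2 ^ (k + 1)), y ^ j =
      (1 + y ^ 2 ^ k) * ∑ j ∈ Finset.range (2 ^ k), y ^ j := by
  rw [pow_succ, mul_two, Finset.sum_range_add, add_mul, one_mul, Finset.mul_sum]
  simp [pow_add]

/-- The geometric sum is the product of 1 + y^(2^j) over j < k, and the factor with j = v vanishes.
-/
theorem sum_range_two_pow_eq_zero {y : D} {v k : ℕ} (hv : v < k) (h : y ^ 2 ^ v = -1) :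
    ∑ j ∈ Finset.range (2 ^ k), y ^ j = 0 := by
  induction k with
  | zero => omega
  | succ k ih =>
    rw [sum_range_two_pow_succ]
    rcases Nat.lt_succ_iff_lt_or_eq.1 hv with hv | rfl
    · rw [ih hv, mul_zero]
    · rw [h]; simp

theorem IsPrincipalRoot.isUnit_two (h : IsPrincipalRoot ω (2 ^ (p + 1))) : IsUnit (2 : D) := by
  have := h.isUnit
  push_cast at this
  exact isUnit_of_dvd_unit (dvd_pow_self _ (Nat.succ_ne_zero p)) this

/-- `D` may have zero divisors, so ω^N = 1 does not suffice. The vanishing sum for i = 2^p has terms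
alternating between 1 and ω^(2^p), which gives 2^p (1 + ω^(2^p)) = 0, and 2 is a unit. -/
theorem IsPrincipalRoot.pow_half (h : IsPrincipalRoot ω (2 ^ (p + 1))) : ω ^ 2 ^ p = -1 := by
  have h1 := h.sum_eq_zero (2 ^ p) (by positivity) (by rw [pow_succ]; have := Nat.two_pow_pos p; omega)
  have h2 : ∀ k, ∑ j ∈ Finset.range (2 * k), ω ^ (2 ^ p * j) = k * (1 + ω ^ 2 ^ p) := by
    intro k
    induction k with
    | zero => simp
    | succ k ih =>
      have : ω ^ (2 ^ p * (2 * k)) = 1 := by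
        rw [← mul_assoc, ← pow_succ, pow_mul, h.pow_eq_one, one_pow]
      rw [mul_add 2 k, mul_one, Finset.sum_range_succ, Finset.sum_range_succ, ih,
        mul_add (2 ^ p) (2 * k), mul_one, pow_add, this]
      push_cast
      ring
  rw [pow_succ' 2 p, h2] at h1
  push_cast at h1
  have h3 := (h.isUnit_two.pow p).mul_right_eq_zero.1 h1
  linear_combination h3

/-- For i = 2^v u with u odd, the power 2^(p-v) of ω^i is (-1)^u = -1, which kills a factor of the
geometric sum. -/
theorem IsPrincipalRoot.of_pow_half (h2 : IsUnit (2 : D)) (h : ω ^ 2 ^ p = -1) :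
    IsPrincipalRoot ω (2 ^ (p + 1)) where
  pow_eq_one := by rw [pow_succ, pow_mul, h]; simp
  sum_eq_zero i hi hi' := by
    simp_rw [pow_mul]
    obtain ⟨v, u, hu, rfl⟩ := Nat.exists_eq_two_pow_mul_odd hi.ne'
    have hv : v < p + 1 := by
      refine (Nat.pow_lt_pow_iff_right (by norm_num : 1 < 2)).1 (lt_of_le_of_lt ?_ hi')
      exact Nat.le_mul_of_pos_right _ hu.pos
    refine sum_range_two_pow_eq_zero (v := p - v) (by omega) ?_
    rw [← pow_mul, mul_right_comm, ← pow_add, Nat.add_sub_cancel' (by omega), pow_mul, h,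
      hu.neg_one_pow]
  isUnit := by push_cast; exact h2.pow _

theorem isPrincipalRoot_one_iff : IsPrincipalRoot ω (2 ^ 0) ↔ ω = 1 := by
  refine ⟨fun h => by simpa using h.pow_eq_one, fun h => ⟨by simp [h], fun i hi hi' => ?_, by simp⟩⟩
  simp only [pow_zero] at hi'
  omega

theorem IsPrincipalRoot.pow_two_pow (h : IsPrincipalRoot ω (2 ^ p)) {ℓ : ℕ} (hℓ : ℓ ≤ p) :
    IsPrincipalRoot (ω ^ 2 ^ (p - ℓ)) (2 ^ ℓ) := by
  cases ℓ with
  | zero => rw [isPrincipalRoot_one_iff, Nat.sub_zero, h.pow_eq_one]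
  | succ ℓ =>
    obtain ⟨p, rfl⟩ : ∃ p', p = p' + 1 := ⟨p - 1, by omega⟩
    refine .of_pow_half h.isUnit_two ?_
    rw [← pow_mul, ← pow_add, show p + 1 - (ℓ + 1) + ℓ = p by omega, h.pow_half]

theorem IsPrincipalRoot.isUnit_root (h : IsPrincipalRoot ω (2 ^ p)) : IsUnit ω :=
  IsUnit.of_pow_eq_one h.pow_eq_one (by positivity)

end PrincipalRoots

/-! ### Scaling, folding and the partial transform -/

section Transforms

variable {D : Type*} [CommRing D] {ω : D} {p : ℕ}

theorem eval_toPoly (n : ℕ) (f : ℕ → D) (x : D) :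
    (toPoly n f).eval x = ∑ i ∈ Finset.range n, f i * x ^ i := by
  simp [toPoly, eval_finsetSum]

theorem brTFT_eq_sum (ω : D) (p n : ℕ) (f : ℕ → D) (i : ℕ) :
    brTFT ω p n f i = ∑ q ∈ Finset.range n, f q * (ω ^ bitRev p i) ^ q :=
  eval_toPoly _ _ _

theorem brTFT_congr {n : ℕ} {f g : ℕ → D} (h : ∀ q < n, f q = g q) (i : ℕ) :
    brTFT ω p n f i = brTFT ω p n g i := by
  rw [brTFT_eq_sum, brTFT_eq_sum]
  exact Finset.sum_congr rfl fun q hq => by rw [h q (Finset.mem_range.1 hq)]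

/-- Multiply entry `i` by `x ^ i`, for `i < n`. -/
def scaleArr (n : ℕ) (x : D) (f : ℕ → D) (i : ℕ) : D := if i < n then f i * x ^ i else f i

theorem scaleArr_scaleArr (n : ℕ) {x y : D} (h : x * y = 1) (f : ℕ → D) :
    scaleArr n y (scaleArr n x f) = f := by
  funext i
  unfold scaleArr
  split_ifs
  · rw [mul_assoc, ← mul_pow, h, one_pow, mul_one]
  · rfl

theorem sum_scaleArr (n : ℕ) (x y : D) (f : ℕ → D) :
    ∑ q ∈ Finset.range n, scaleArr n x f q * y ^ q =
      ∑ q ∈ Finset.range n, f q * (x * y) ^ q := by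
  refine Finset.sum_congr rfl fun q hq => ?_
  rw [scaleArr, if_pos (Finset.mem_range.1 hq), mul_pow, mul_assoc]

/-- For `i = L + k - 1` down to `L`, add entry `i` to entry `i - L`. -/
def foldArr (L : ℕ) : ℕ → (ℕ → D) → ℕ → D
  | 0, f => f
  | k + 1, f => foldArr L k (Function.update f k (f k + f (L + k)))

/-- For `i = L` to `L + k - 1`, subtract entry `i` from entry `i - L`. -/
def unfoldArr (L : ℕ) : ℕ → (ℕ → D) → ℕ → D
  | 0, f => f
  | k + 1, f =>
    Function.update (unfoldArr L k f) k (unfoldArr L k f k - unfoldArr L k f (L + k))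

/-- As `L` is positive, each addition reads an entry other than the one it changes, so a subtraction
undoes it; the order is reversed. -/
theorem unfoldArr_foldArr {L : ℕ} (hL : 0 < L) (k : ℕ) (f : ℕ → D) :
    unfoldArr L k (foldArr L k f) = f := by
  induction k generalizing f with
  | zero => rfl
  | succ k ih =>
    rw [unfoldArr, foldArr, ih]
    have : L + k ≠ k := by omega
    rw [Function.update_self, Function.update_of_ne this, add_sub_cancel_right,
      Function.update_idem, Function.update_eq_self]

/-- Folding is reduction modulo X^L - 1. It runs downwards so that entries which are folded into
positions above `L` are folded again later. -/
theorem sum_foldArr {L : ℕ} (hL : 0 < L) (k : ℕ) {y : D} (hy : y ^ L = 1) (f : ℕ → D) :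
    ∑ q ∈ Finset.range L, foldArr L k f q * y ^ q =
      ∑ q ∈ Finset.range (L + k), f q * y ^ q := by
  induction k generalizing f with
  | zero => rfl
  | succ k ih =>
    rw [foldArr, ih, ← add_assoc, Finset.sum_range_succ _ (L + k), pow_add, hy, one_mul]
    have hk : k ∈ Finset.range (L + k) := Finset.mem_range.2 (by omega)
    rw [← Finset.add_sum_erase _ _ hk, ← Finset.add_sum_erase (Finset.range (L + k)) _ hk,
      Finset.sum_congr rfl fun q hq => by
        rw [Function.update_of_ne (Finset.ne_of_mem_erase hq)], Function.update_self]
    ring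

theorem bitRev_pow_pow {ℓ : ℕ} (h : IsPrincipalRoot ω (2 ^ p)) (hℓ : ℓ ≤ p) (i : ℕ) :
    ((ω ^ 2 ^ (p - ℓ)) ^ bitRev ℓ i) ^ 2 ^ ℓ = 1 := by
  rw [pow_right_comm, (h.pow_two_pow hℓ).pow_eq_one, one_pow]

theorem pow_bitRev_add {ℓ : ℕ} (hℓ : ℓ ≤ p) {s i : ℕ} (hs : 2 ^ ℓ ∣ s) (hi : i < 2 ^ ℓ) :
    ω ^ bitRev p (s + i) = ω ^ bitRev p s * (ω ^ 2 ^ (p - ℓ)) ^ bitRev ℓ i := by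
  obtain ⟨u, rfl⟩ := hs
  rw [bitRev_two_pow_mul_add hℓ u hi, bitRev_two_pow_mul hℓ, pow_add, pow_mul]

theorem brTFT_partial (h : IsPrincipalRoot ω (2 ^ p)) {ℓ n s i : ℕ} (hℓ : ℓ ≤ p)
    (hn : 2 ^ ℓ ≤ n) (hs : 2 ^ ℓ ∣ s) (hi : i < 2 ^ ℓ) (f : ℕ → D) :
    brTFT (ω ^ 2 ^ (p - ℓ)) ℓ (2 ^ ℓ)
      (foldArr (2 ^ ℓ) (n - 2 ^ ℓ) (scaleArr n (ω ^ bitRev p s) f)) i =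
    brTFT ω p n f (s + i) := by
  rw [brTFT_eq_sum, sum_foldArr (by positivity) _ (bitRev_pow_pow h hℓ i), Nat.add_sub_cancel' hn, sum_scaleArr,
    brTFT_eq_sum, pow_bitRev_add hℓ hs hi]

end Transforms

end FFTAccu

/-! ### Frame conditions for registers -/

namespace AlgRAM

attribute [simp] wp_block_nil wp_block_cons wp_skip wp_ite wp_pset wp_pmov wp_padd wp_psub
  wp_phalf wp_load wp_store wp_zero wp_one wp_mov wp_add wp_sub wp_mul wp_inv Test.holds

/-- The registers below `k` agree. -/
def EqBelow {α : Type*} (k : ℕ) (f g : ℕ → α) : Prop := ∀ q < k, f q = g q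

/-- The registers that are not listed agree. -/
def EqOff {α : Type*} (l : List ℕ) (f g : ℕ → α) : Prop := ∀ x, x ∉ l → f x = g x

section Frame

variable {α : Type*} {k p : ℕ} {l : List ℕ} {f g h : ℕ → α} {v : α}

@[simp] theorem EqBelow.refl : EqBelow k f f := fun _ _ => rfl

@[simp] theorem EqOff.refl : EqOff l f f := fun _ _ => rfl

theorem EqBelow.trans (h₁ : EqBelow k f g) (h₂ : EqBelow k g h) : EqBelow k f h :=
  fun q hq => (h₁ q hq).trans (h₂ q hq)

theorem EqOff.trans (h₁ : EqOff l f g) (h₂ : EqOff l g h) : EqOff l f h :=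
  fun q hq => (h₁ q hq).trans (h₂ q hq)

theorem EqOff.mono {l' : List ℕ} (h₁ : EqOff l f g) (h : l ⊆ l') : EqOff l' f g :=
  fun q hq => h₁ q (mt (@h q) hq)

theorem eqBelow_update (hp : k ≤ p) :
    EqBelow k (Function.update f p v) g ↔ EqBelow k f g :=
  forall₂_congr fun q hq => by rw [Function.update_of_ne (by omega)]

@[simp] theorem eqOff_update (hp : p ∈ l) :
    EqOff l (Function.update f p v) g ↔ EqOff l f g :=
  forall₂_congr fun q hq => by rw [Function.update_of_ne (by rintro rfl; exact hq hp)]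

end Frame

end AlgRAM

namespace FFTAccu

open AlgRAM

section Frame

variable {α : Type*} {f g : ℕ → α} {v : α}

-- Pointer registers 12 to 15 are scratch, so that `EqBelow 12` is the frame condition of the
-- auxiliary programs.
@[simp] theorem eqBelow_update_pI :
    EqBelow 12 (Function.update f pI v) g ↔ EqBelow 12 f g := eqBelow_update le_rfl

@[simp] theorem eqBelow_update_pJ :
    EqBelow 12 (Function.update f pJ v) g ↔ EqBelow 12 f g := eqBelow_update (by norm_num)

@[simp] theorem eqBelow_update_pH :
    EqBelow 12 (Function.update f pH v) g ↔ EqBelow 12 f g := eqBelow_update (by norm_num)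

@[simp] theorem eqBelow_update_pK :
    EqBelow 12 (Function.update f pK v) g ↔ EqBelow 12 f g := eqBelow_update (by norm_num)

end Frame

/-! ### Auxiliary programs common to multiplication and TFT -/

section Programs

variable {ι : Type}

/-- `loadTwist`, for an arbitrary set of arrays. -/
def twistProg (ps : ℕ) : Stmt ι :=
  block [
    .op (.one xTwist),
    .op (.mov xG xW),
    .op (.pmov pK ps),
    .op (.phalf pH pOrd),
    .loop (.le pOne pH) (block [
      .ite (.le pH pK)
        (block [
          .op (.psub pK pK pH),
          .op (.mul xTwist xTwist xG)])
        .skip,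
      .op (.mul xG xG xG),
      .op (.phalf pH pH)])]

/-- `scale`, for an arbitrary set of arrays. -/
def scaleProg (A : ι) (pl : ℕ) : Stmt ι :=
  block [
    .op (.one xPow),
    .op (.pset pI 0),
    .loop (.lt pI pl) (block [
      .op (.load xX A pI),
      .op (.mul xX xX xPow),
      .op (.store A pI xX),
      .op (.mul xPow xPow xTwist),
      .op (.padd pI pI pOne)])]

/-- `loadRoot`, for an arbitrary set of arrays. -/
def rootProg (pL : ℕ) : Stmt ι :=
  block [
    .op (.mov xG xW),
    .op (.pmov pH pL),
    .loop (.lt pH pOrd) (block [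
      .op (.mul xG xG xG),
      .op (.padd pH pH pH)])]

/-- `callTransform`, for an arbitrary set of arrays. -/
def callProg (P : Stmt Unit) (A : ι) (pl po xr : ℕ) : Stmt ι :=
  block [
    .op (.pmov (0 + 16) pl),
    .op (.pmov (1 + 16) po),
    .op (.mov (0 + 16) xr),
    P.rename (fun _ => A) 16]

end Programs

section Specifications

variable {D : Type*} [CommRing D] {ι : Type} [DecidableEq ι] {W : ℕ} {len : ι → ℕ}
  {σ : State D ι}

theorem wp_twistProg {ps p : ℕ} (hOne : σ.ptr pOne = 1)
    (hOrd : σ.ptr pOrd = 2 ^ p) (hs : σ.ptr ps < 2 ^ p) (hW : 2 ^ p ≤ W) :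
    WP W len (twistProg ps) (fun t σ' => t ≤ 6 * p + 5 ∧ σ'.arr = σ.arr ∧
      EqBelow 12 σ'.ptr σ.ptr ∧ EqOff [xTwist, xG] σ'.alg σ.alg ∧
      σ'.alg xTwist = σ.alg xW ^ bitRev p (σ.ptr ps)) σ := by
  have hpsW : σ.ptr ps ≤ W := by omega
  have hpW : 2 ^ p / 2 ≤ W := by omega
  simp [twistProg, hOrd, hpsW, hpW]
  -- Here `e` counts the digits left. Removing the top digit of `pK` moves one factor `xG` into
  -- `xTwist`, and squaring `xG` halves the exponent that remains, so the product in the last clause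
  -- is constant. At `e = 0` the division in `2 ^ e / 2` gives 0, which ends the loop.
  refine wp_loop (fun e t τ => t + 6 * e ≤ 6 * p ∧ e ≤ p ∧
    τ.arr = σ.arr ∧ EqBelow 12 τ.ptr σ.ptr ∧ EqOff [xTwist, xG] τ.alg σ.alg ∧
      τ.ptr pH = 2 ^ e / 2 ∧ τ.ptr pK < 2 ^ e ∧
      τ.alg xTwist * τ.alg xG ^ bitRev e (τ.ptr pK) = σ.alg xW ^ bitRev p (σ.ptr ps))
    ?_ ?_ (k := p) ?_
  · rintro e t τ ⟨ht, hep, harr, hptr, halg, hH, hK, hV⟩ hc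
    have h11 := hptr 11 (by norm_num)
    obtain ⟨e, rfl⟩ : ∃ e', e = e' + 1 := by
      refine ⟨e - 1, ?_⟩
      rcases e with _ | e
      · simp_all
      · omega
    have h2 : 2 ^ (e + 1) / 2 = 2 ^ e := by simp [pow_succ]
    have h3 : 2 ^ (e + 1) ≤ 2 ^ p := Nat.pow_le_pow_right (by norm_num) hep
    have h4 := pow_succ 2 e
    have h5 : τ.ptr pK ≤ W + 2 ^ e := by omega
    have h6 : 2 ^ e / 2 ≤ W := by omega
    simp [hH, h2, hptr, halg, h5, h6]
    refine ⟨fun hle => ⟨e, le_rfl, by omega, by omega, harr, rfl, by omega, ?_⟩,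
      fun hlt => ⟨e, le_rfl, by omega, by omega, harr, rfl, by omega, ?_⟩⟩
    · rw [← hV, ← Nat.add_sub_of_le hle, bitRev_succ_two_pow_add (by omega),
        Nat.add_sub_cancel_left]
      ring
    · rw [← hV, bitRev_succ_of_lt hlt]
      ring
  · rintro e t τ ⟨ht, hep, harr, hptr, halg, hH, hK, hV⟩ hc
    have h11 := hptr 11 (by norm_num)
    simp [h11, hH, hOne] at hc
    obtain rfl : e = 0 := by
      by_contra he
      have := Nat.pow_le_pow_right (n := 2) (by norm_num) (by omega : 1 ≤ e)
      omega
    refine ⟨by omega, harr, hptr, halg, ?_⟩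
    simpa [bitRev] using hV
  · simp [hs]

theorem wp_rootProg {pL p ℓ : ℕ} (hℓ : ℓ ≤ p) (hL : σ.ptr pL = 2 ^ ℓ)
    (hOrd : σ.ptr pOrd = 2 ^ p) (hW : 2 ^ p ≤ W) :
    WP W len (rootProg pL) (fun t σ' => t ≤ 3 * p + 3 ∧ σ'.arr = σ.arr ∧
      EqBelow 12 σ'.ptr σ.ptr ∧ EqOff [xG] σ'.alg σ.alg ∧
      σ'.alg xG = σ.alg xW ^ 2 ^ (p - ℓ)) σ := by
  have hpow : 2 ^ ℓ ≤ 2 ^ p := Nat.pow_le_pow_right (by norm_num) hℓ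
  simp [rootProg, hL, hpow.trans hW]
  refine wp_for (p - ℓ) (fun i t τ => t = 3 * i ∧ τ.arr = σ.arr ∧ EqBelow 12 τ.ptr σ.ptr ∧
      EqOff [xG] τ.alg σ.alg ∧ τ.ptr pH = 2 ^ (ℓ + i) ∧ τ.alg xG = σ.alg xW ^ 2 ^ i) ?_ ?_ ?_
  · rintro i t τ hi ⟨ht, harr, hptr, halg, hH, hG⟩
    have h2 := hptr 2 (by norm_num)
    have h3 : 2 ^ (ℓ + i + 1) ≤ 2 ^ p := Nat.pow_le_pow_right (by norm_num) (by omega)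
    have h4 := pow_succ 2 (ℓ + i)
    have h5 := Nat.two_pow_pos (ℓ + i)
    have h6 : 2 ^ (ℓ + i) + 2 ^ (ℓ + i) ≤ W := by omega
    simp [hH, hG, h2, hOrd, h6, harr, hptr, halg]
    refine ⟨by omega, by omega, by rw [← add_assoc]; omega, by ring⟩
  · rintro t τ ⟨ht, harr, hptr, halg, hH, hG⟩
    have h2 := hptr 2 (by norm_num)
    simp [hH, hG, h2, hOrd, harr, hptr, halg]
    refine ⟨by rw [Nat.add_sub_cancel' hℓ], by omega⟩
  · simp

theorem scaleArr_succ (n : ℕ) (x : D) (f : ℕ → D) :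
    scaleArr (n + 1) x f = Function.update (scaleArr n x f) n (f n * x ^ n) := by
  funext i
  rcases lt_trichotomy i n with h | rfl | h
  · simp [scaleArr, h, h.ne, h.trans (Nat.lt_succ_self n)]
  · simp [scaleArr]
  · simp [scaleArr, h.ne', h.not_gt, show ¬ i < n + 1 by omega]

theorem wp_scaleProg {A : ι} {pl : ℕ} (hpl : pl < 12) (hOne : σ.ptr pOne = 1)
    (hlen : σ.ptr pl ≤ len A) (hW : σ.ptr pl ≤ W) :
    WP W len (scaleProg A pl) (fun t σ' => t ≤ 6 * σ.ptr pl + 3 ∧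
      σ'.arr = Function.update σ.arr A (scaleArr (σ.ptr pl) (σ.alg xTwist) (σ.arr A)) ∧
      EqBelow 12 σ'.ptr σ.ptr ∧ EqOff [xPow, xX] σ'.alg σ.alg) σ := by
  simp [scaleProg]
  refine wp_for (σ.ptr pl) (fun i t τ => t = 6 * i ∧
    τ.arr = Function.update σ.arr A (scaleArr i (σ.alg xTwist) (σ.arr A)) ∧
    EqBelow 12 τ.ptr σ.ptr ∧ EqOff [xPow, xX] τ.alg σ.alg ∧ τ.ptr pI = i ∧
    τ.alg xPow = σ.alg xTwist ^ i) ?_ ?_ ?_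
  · rintro i t τ hi ⟨ht, harr, hptr, halg, hI, hP⟩
    have h11 := hptr 11 (by norm_num)
    have hl := hptr pl hpl
    have hx := halg 1 (by simp)
    have h1 : i < len A := by omega
    have h2 : i + 1 ≤ W := by omega
    simp [hI, h11, hl, hi, h1, h2, hOne, hptr, halg, hP, hx, harr, pow_succ, scaleArr_succ]
    simp [scaleArr]
    omega
  · rintro t τ ⟨ht, harr, hptr, halg, hI, hP⟩
    simp [hptr pl hpl, hI, harr, hptr, halg]
    omega
  · have : scaleArr 0 (σ.alg xTwist) (σ.arr A) = σ.arr A := by funext i; simp [scaleArr]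
    simp [this]

end Specifications
/-- The effect of an over-place transform on an array, of which the first `n` entries are used. -/
noncomputable def tftArr {D : Type*} [CommRing D] (ω : D) (p n : ℕ) (f : ℕ → D) (i : ℕ) : D :=
  if i < n then brTFT ω p n f i else f i

/-- `P` and `Q` compute a transform and its inverse over-place and, if `τ` holds, in time `T`. -/
structure TimedTransform (D : Type*) [CommRing D] (dom : ℕ → ℕ → Prop) (κ : ℕ) (τ : Prop)
    (T : ℕ → ℕ) (P Q : Stmt Unit) : Prop where
  forward : ∀ (n p : ℕ) (ω : D), dom n p → IsPrincipalRoot ω (2 ^ p) →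
    ∀ σ : State D Unit, TransformInput n p ω σ →
      WP (κ * n) (fun _ => n) P (fun t σ' => (τ → t ≤ T n) ∧
        σ'.arr () = tftArr ω p n (σ.arr ())) σ
  backward : ∀ (n p : ℕ) (ω : D), dom n p → IsPrincipalRoot ω (2 ^ p) →
    ∀ (σ : State D Unit) (f : ℕ → D), TransformInput n p ω σ → σ.arr () = tftArr ω p n f →
      WP (κ * n) (fun _ => n) Q (fun t σ' => (τ → t ≤ T n) ∧ σ'.arr () = f) σ

/-! ### Transforms as subroutines -/

section

variable {D : Type*} [CommRing D] {dom : ℕ → ℕ → Prop} {κ : ℕ} {τ : Prop} {T : ℕ → ℕ}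
  {P Q : Stmt Unit}

/-- A program cannot touch entries beyond the length of the array, so statements about the first `n`
entries become equations between functions. Guarding the time by `τ` lets one proof serve
correctness alone (`False`) and cost (`True`). -/
theorem OverPlaceTransform.timed (h : OverPlaceTransform D dom κ P Q)
    (hP : τ → TransformTime D dom T P) (hQ : τ → TransformTime D dom T Q) :
    TimedTransform D dom κ τ T P Q where
  forward n p ω hd hω σ hσ := by
    obtain ⟨t, σ', he, hv⟩ := h.forward n p ω hd hω σ hσ
    refine ⟨t, σ', he, fun hτ => hP hτ n p ω hd hω σ hσ _ _ _ he, funext fun i => ?_⟩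
    unfold tftArr
    split_ifs with hi
    · exact hv i hi
    · exact he.arr_of_le (not_lt.1 hi)
  backward n p ω hd hω σ f hσ hf := by
    obtain ⟨t, σ', he, hv⟩ := h.backward n p ω hd hω σ f hσ fun i hi => by simp [hf, tftArr, hi]
    refine ⟨t, σ', he, fun hτ => hQ hτ n p ω hd hω σ hσ _ _ _ he, funext fun i => ?_⟩
    by_cases hi : i < n
    · exact hv i hi
    · rw [he.arr_of_le (not_lt.1 hi), hf, tftArr, if_neg hi]

variable {ι : Type} [DecidableEq ι] {W : ℕ} {len : ι → ℕ} {σ : State D ι} {A : ι}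
  {pl po xr : ℕ}

/-- The registers from 16 on hold leftovers of earlier calls, so `hP` must cover every state that
meets the calling convention. -/
theorem wp_callProg {R : ℕ → State D Unit → Prop} {W₀ n p : ℕ} {ω : D}
    (hP : ∀ υ : State D Unit, TransformInput n p ω υ → υ.arr () = σ.arr A →
      WP W₀ (fun _ => n) P R υ)
    (hn : σ.ptr pl = n) (hp : σ.ptr po = 2 ^ p) (hω : σ.alg xr = ω)
    (hpo : po < 16) (hA : n ≤ len A) (hW₀ : W₀ ≤ W) (hnW : n ≤ W)
    (hpW : 2 ^ p ≤ W) :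
    WP W len (callProg P A pl po xr) (fun t σ' => ∃ t' υ, t = t' + 3 ∧ R t' υ ∧
      σ'.arr = Function.update σ.arr A (υ.arr ()) ∧
      EqBelow 16 σ'.ptr σ.ptr ∧ EqBelow 16 σ'.alg σ.alg) σ := by
  -- Register 16 is overwritten before `po` is read.
  have h16 : po ≠ 16 := by omega
  simp [callProg, hn, hp, hω, hnW, hpW, h16]
  refine (wp_rename (d := 16) (hP _ ⟨?_, ?_, ?_⟩ ?_) hA hW₀).mono ?_
  iterate 4 simp
  rintro t τ ⟨υ, hR, rfl, -⟩
  refine ⟨t, by omega, υ, hR, rfl, fun q hq => ?_, fun q hq => ?_⟩ <;>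
  · have : q ≠ 16 ∧ q ≠ 17 := by omega
    simp [State.embed, hq, this]

theorem TimedTransform.wp_forward (h : TimedTransform D dom κ τ T P Q) {n p : ℕ} {ω : D}
    (hd : dom n p) (hroot : IsPrincipalRoot ω (2 ^ p))
    (hn : σ.ptr pl = n) (hp : σ.ptr po = 2 ^ p) (hω : σ.alg xr = ω)
    (hpo : po < 16) (hA : n ≤ len A) (hW : κ * n ≤ W) (hnW : n ≤ W) (hpW : 2 ^ p ≤ W) :
    WP W len (callProg P A pl po xr) (fun t σ' => (τ → t ≤ T n + 3) ∧
      σ'.arr = Function.update σ.arr A (tftArr ω p n (σ.arr A)) ∧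
      EqBelow 16 σ'.ptr σ.ptr ∧ EqBelow 16 σ'.alg σ.alg) σ := by
  refine (wp_callProg (fun υ hυ hυ' => h.forward n p ω hd hroot υ hυ |>.mono
    fun t υ' ⟨h1, h2⟩ => (⟨h1, hυ' ▸ h2⟩ : (τ → t ≤ T n) ∧ υ'.arr () = tftArr ω p n (σ.arr A)))
    hn hp hω hpo hA hW hnW hpW).mono ?_
  rintro t σ' ⟨t', υ, rfl, ⟨h1, h2⟩, h3, h4, h5⟩
  exact ⟨fun hτ => Nat.add_le_add_right (h1 hτ) 3, h2 ▸ h3, h4, h5⟩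

theorem TimedTransform.wp_backward (h : TimedTransform D dom κ τ T P Q) {n p : ℕ} {ω : D}
    {f : ℕ → D} (hf : σ.arr A = tftArr ω p n f)
    (hd : dom n p) (hroot : IsPrincipalRoot ω (2 ^ p))
    (hn : σ.ptr pl = n) (hp : σ.ptr po = 2 ^ p) (hω : σ.alg xr = ω)
    (hpo : po < 16) (hA : n ≤ len A) (hW : κ * n ≤ W) (hnW : n ≤ W) (hpW : 2 ^ p ≤ W) :
    WP W len (callProg Q A pl po xr) (fun t σ' => (τ → t ≤ T n + 3) ∧
      σ'.arr = Function.update σ.arr A f ∧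
      EqBelow 16 σ'.ptr σ.ptr ∧ EqBelow 16 σ'.alg σ.alg) σ := by
  refine (wp_callProg (fun υ hυ hυ' => h.backward n p ω hd hroot υ f hυ (hυ'.trans hf))
    hn hp hω hpo hA hW hnW hpW).mono ?_
  rintro t σ' ⟨t', υ, rfl, ⟨h1, h2⟩, h3, h4, h5⟩
  exact ⟨fun hτ => Nat.add_le_add_right (h1 hτ) 3, h2 ▸ h3, h4, h5⟩

end

/-! ### The partial transform and its inverse as programs -/

section

variable {D : Type*} [CommRing D] {W : ℕ} {len : Arr → ℕ} {σ : State D Arr} {A : Arr}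
  {pl ps pL : ℕ}

theorem wp_fold (hpL : pL < 12) (hOne : σ.ptr pOne = 1)
    (hL : 0 < σ.ptr pL) (hLn : σ.ptr pL ≤ σ.ptr pl) (hlen : σ.ptr pl ≤ len A)
    (hW : σ.ptr pl ≤ W) :
    WP W len (fold A pl pL) (fun t σ' => t ≤ 7 * σ.ptr pl + 2 ∧
      σ'.arr = Function.update σ.arr A
        (foldArr (σ.ptr pL) (σ.ptr pl - σ.ptr pL) (σ.arr A)) ∧
      EqBelow 12 σ'.ptr σ.ptr ∧ EqOff [xX, xY] σ'.alg σ.alg) σ := by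
  simp [fold, hW]
  -- `foldArr` recurses from the top index, so the invariant says that the remaining `k` additions
  -- lead to the final result. The clause on `τ.arr` says that the other arrays are unchanged.
  refine wp_loop (fun k t τ => t + 7 * k ≤ 7 * σ.ptr pl ∧ σ.ptr pL + k ≤ σ.ptr pl ∧
    τ.arr = Function.update σ.arr A (τ.arr A) ∧
    foldArr (σ.ptr pL) k (τ.arr A) = foldArr (σ.ptr pL) (σ.ptr pl - σ.ptr pL) (σ.arr A) ∧
    EqBelow 12 τ.ptr σ.ptr ∧ EqOff [xX, xY] τ.alg σ.alg ∧ τ.ptr pI = σ.ptr pL + k)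
    ?_ ?_ (k := σ.ptr pl - σ.ptr pL) ?_
  · rintro k t τ ⟨ht, hk, harr, hval, hptr, halg, hI⟩ hc
    have h11 := hptr 11 (by norm_num)
    have hpL' := hptr pL hpL
    simp [hI, hpL'] at hc
    obtain ⟨k, rfl⟩ : ∃ k', k = k' + 1 := ⟨k - 1, by omega⟩
    have e1 : σ.ptr pL + (k + 1) - 1 = σ.ptr pL + k := by omega
    have e2 : pL ≠ 12 := by omega
    have e3 : k < len A := by omega
    have e4 : σ.ptr pL + k ≤ W := by omega
    have e5 : σ.ptr pL + k ≤ W + σ.ptr pL := by omega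
    have e6 : σ.ptr pL + k < len A := by omega
    simp [hI, hpL', h11, hOne, e1, e2, e3, e4, e5, e6, hptr, halg]
    refine ⟨by omega, by omega, ?_, ?_⟩
    · nth_rw 1 [harr]; simp
    · rw [← hval, foldArr]
  · rintro k t τ ⟨ht, hk, harr, hval, hptr, halg, hI⟩ hc
    have hpL' := hptr pL hpL
    simp [hI, hpL'] at hc
    subst hc
    refine ⟨by omega, ?_, hptr, halg⟩
    rw [harr, ← hval, foldArr]
  · simp
    omega

theorem wp_unfold (hpl : pl < 12) (hpL : pL < 12) (hOne : σ.ptr pOne = 1)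
    (hLn : σ.ptr pL ≤ σ.ptr pl) (hlen : σ.ptr pl ≤ len A) (hW : σ.ptr pl ≤ W) :
    WP W len (unfold A pl pL) (fun t σ' => t ≤ 7 * σ.ptr pl + 2 ∧
      σ'.arr = Function.update σ.arr A
        (unfoldArr (σ.ptr pL) (σ.ptr pl - σ.ptr pL) (σ.arr A)) ∧
      EqBelow 12 σ'.ptr σ.ptr ∧ EqOff [xX, xY] σ'.alg σ.alg) σ := by
  simp [unfold, hLn.trans hW]
  refine wp_for (σ.ptr pl - σ.ptr pL) (fun k t τ => t = 7 * k ∧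
    τ.arr = Function.update σ.arr A (unfoldArr (σ.ptr pL) k (σ.arr A)) ∧
    EqBelow 12 τ.ptr σ.ptr ∧ EqOff [xX, xY] τ.alg σ.alg ∧ τ.ptr pI = σ.ptr pL + k)
    ?_ ?_ ?_
  · rintro k t τ hk ⟨ht, harr, hptr, halg, hI⟩
    have h11 := hptr 11 (by norm_num)
    have hpL' := hptr pL hpL
    have hpl' := hptr pl hpl
    have e3 : k < len A := by omega
    have e4 : σ.ptr pL + k + 1 ≤ W := by omega
    have e5 : k ≤ W := by omega
    have e6 : σ.ptr pL + k < len A := by omega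
    have e7 : σ.ptr pL + k < σ.ptr pl := by omega
    simp [hI, hpL', hpl', h11, hOne, e3, e4, e5, e6, e7, hptr, halg, harr, unfoldArr]
    omega
  · rintro t τ ⟨ht, harr, hptr, halg, hI⟩
    have hpl' := hptr pl hpl
    simp [hI, hpl', harr, hptr, halg]
    omega
  · simp [unfoldArr]

variable {κ : ℕ} {τ : Prop} {T : ℕ → ℕ} {P Q : Stmt Unit}

/-- The effect of the partial TFT on an array. -/
noncomputable def partArr (ω : D) (p ℓ n s : ℕ) (f : ℕ → D) : ℕ → D :=
  tftArr (ω ^ 2 ^ (p - ℓ)) ℓ (2 ^ ℓ)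
    (foldArr (2 ^ ℓ) (n - 2 ^ ℓ) (scaleArr n (ω ^ bitRev p s) f))

theorem partArr_of_lt {ω : D} {p ℓ n s i : ℕ} (h : IsPrincipalRoot ω (2 ^ p)) (hℓ : ℓ ≤ p)
    (hn : 2 ^ ℓ ≤ n) (hs : 2 ^ ℓ ∣ s) (hi : i < 2 ^ ℓ) (f : ℕ → D) :
    partArr ω p ℓ n s f i = brTFT ω p n f (s + i) := by
  rw [partArr, tftArr, if_pos hi, brTFT_partial h hℓ hn hs hi]

theorem wp_partTFT (h : TimedTransform D DFTSize κ τ T P Q) {p ℓ n : ℕ}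
    (hω : IsPrincipalRoot (σ.alg xW) (2 ^ p)) (hℓ : ℓ ≤ p) (hpl : pl < 12)
    (hpL : pL < 12) (hOne : σ.ptr pOne = 1) (hOrd : σ.ptr pOrd = 2 ^ p)
    (hs : σ.ptr ps < 2 ^ p) (hL : σ.ptr pL = 2 ^ ℓ) (hn : σ.ptr pl = n) (hLn : 2 ^ ℓ ≤ n)
    (hlen : n ≤ len A) (hκ : κ * n ≤ W) (hW : 2 ^ p ≤ W) (hnW : n ≤ W) :
    WP W len (partTFT P A pl ps pL)
      (fun t σ' => (τ → t ≤ 9 * p + 13 * n + 16 + T (2 ^ ℓ)) ∧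
        σ'.arr = Function.update σ.arr A (partArr (σ.alg xW) p ℓ n (σ.ptr ps) (σ.arr A)) ∧
        EqBelow 12 σ'.ptr σ.ptr ∧ σ'.alg xW = σ.alg xW) σ := by
  simp only [partTFT, wp_block_cons, wp_block_nil]
  -- `loadTwist` unfolds to the same program as `twistProg`; the same holds below for `scale`,
  -- `loadRoot` and `callTransform`.
  refine (wp_twistProg hOne hOrd hs hW).mono ?_
  rintro t₁ σ₁ ⟨ht₁, harr₁, hptr₁, halg₁, hx₁⟩
  have hpl₁ : σ₁.ptr pl = n := (hptr₁ pl hpl).trans hn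
  refine (wp_scaleProg (A := A) hpl ((hptr₁ pOne (by decide)).trans hOne) (hpl₁ ▸ hlen)
    (hpl₁ ▸ hnW)).mono ?_
  rintro t₂ σ₂ ⟨ht₂, harr₂, hptr₂, halg₂⟩
  replace hptr₂ := hptr₂.trans hptr₁
  have hpl₂ : σ₂.ptr pl = n := (hptr₂ pl hpl).trans hn
  have hpL₂ : σ₂.ptr pL = 2 ^ ℓ := (hptr₂ pL hpL).trans hL
  refine (wp_fold (A := A) hpL ((hptr₂ pOne (by decide)).trans hOne)
    (hpL₂ ▸ by positivity) (by rwa [hpl₂, hpL₂]) (hpl₂ ▸ hlen) (hpl₂ ▸ hnW)).mono ?_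
  rintro t₃ σ₃ ⟨ht₃, harr₃, hptr₃, halg₃⟩
  replace hptr₃ := hptr₃.trans hptr₂
  have hpL₃ : σ₃.ptr pL = 2 ^ ℓ := (hptr₃ pL hpL).trans hL
  have hxW₁ : σ₁.alg xW = σ.alg xW := halg₁ _ (by simp)
  have hxW₃ : σ₃.alg xW = σ.alg xW :=
    ((halg₃ _ (by simp)).trans (halg₂ _ (by simp))).trans hxW₁
  refine (wp_rootProg hℓ hpL₃ ((hptr₃ pOrd (by decide)).trans hOrd) hW).mono ?_
  rintro t₄ σ₄ ⟨ht₄, harr₄, hptr₄, halg₄, hx₄⟩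
  replace hptr₄ := hptr₄.trans hptr₃
  have hpL₄ : σ₄.ptr pL = 2 ^ ℓ := (hptr₄ pL hpL).trans hL
  have hpow : 2 ^ ℓ ≤ 2 ^ p := Nat.pow_le_pow_right (by norm_num) hℓ
  refine (h.wp_forward (A := A) (ω := σ.alg xW ^ 2 ^ (p - ℓ)) rfl (hω.pow_two_pow hℓ) hpL₄ hpL₄
    (hxW₃ ▸ hx₄) (by omega) (hLn.trans hlen) ((Nat.mul_le_mul_left κ hLn).trans hκ)
    (hpow.trans hW) (hpow.trans hW)).mono ?_
  rintro t₅ σ₅ ⟨ht₅, harr₅, hptr₅, halg₅⟩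
  refine ⟨fun hτ => ?_, ?_, ?_, ?_⟩
  · have := ht₅ hτ
    rw [hpl₁] at ht₂
    rw [hpl₂] at ht₃
    omega
  · simp [harr₅, harr₄, harr₃, harr₂, harr₁, hx₁, hpl₂, hpL₂, hpl₁, partArr]
  · exact fun q hq => (hptr₅ q (by omega)).trans (hptr₄ q hq)
  · exact (halg₅ _ (by decide)).trans ((halg₄ _ (by simp)).trans hxW₃)

/-- The array to be recovered is named in `hf`, so each step is undone explicitly and no injectivity
of the transform is needed. -/
theorem wp_partTFTInv (h : TimedTransform D DFTSize κ τ T P Q) {p ℓ n : ℕ} {f : ℕ → D}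
    (hω : IsPrincipalRoot (σ.alg xW) (2 ^ p)) (hℓ : ℓ ≤ p) (hpl : pl < 12)
    (hps : ps < 12) (hpL : pL < 12) (hOne : σ.ptr pOne = 1) (hOrd : σ.ptr pOrd = 2 ^ p)
    (hs : σ.ptr ps < 2 ^ p) (hL : σ.ptr pL = 2 ^ ℓ) (hn : σ.ptr pl = n) (hLn : 2 ^ ℓ ≤ n)
    (hlen : n ≤ len A) (hκ : κ * n ≤ W) (hW : 2 ^ p ≤ W) (hnW : n ≤ W)
    (hf : σ.arr A = partArr (σ.alg xW) p ℓ n (σ.ptr ps) f) :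
    WP W len (partTFTInv Q A pl ps pL)
      (fun t σ' => (τ → t ≤ 9 * p + 13 * n + 17 + T (2 ^ ℓ)) ∧
        σ'.arr = Function.update σ.arr A f ∧
        EqBelow 12 σ'.ptr σ.ptr ∧ σ'.alg xW = σ.alg xW) σ := by
  simp only [partTFTInv, wp_block_cons, wp_block_nil]
  have hpow : 2 ^ ℓ ≤ 2 ^ p := Nat.pow_le_pow_right (by norm_num) hℓ
  refine (wp_rootProg hℓ hL hOrd hW).mono ?_
  rintro t₁ σ₁ ⟨ht₁, harr₁, hptr₁, halg₁, hx₁⟩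
  have hpL₁ : σ₁.ptr pL = 2 ^ ℓ := (hptr₁ pL hpL).trans hL
  refine (h.wp_backward (A := A) (ω := σ.alg xW ^ 2 ^ (p - ℓ)) (harr₁ ▸ hf) rfl
    (hω.pow_two_pow hℓ) hpL₁ hpL₁
    hx₁ (by omega) (hLn.trans hlen) ((Nat.mul_le_mul_left κ hLn).trans hκ)
    (hpow.trans hW) (hpow.trans hW)).mono ?_
  rintro t₂ σ₂ ⟨ht₂, harr₂, hptr₂, halg₂⟩
  have hptr₂' : EqBelow 12 σ₂.ptr σ.ptr :=
    fun q hq => (hptr₂ q (by omega)).trans (hptr₁ q hq)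
  have hpl₂ : σ₂.ptr pl = n := (hptr₂' pl hpl).trans hn
  have hpL₂ : σ₂.ptr pL = 2 ^ ℓ := (hptr₂' pL hpL).trans hL
  have hxW₂ : σ₂.alg xW = σ.alg xW := (halg₂ _ (by decide)).trans (halg₁ _ (by simp))
  refine (wp_unfold (A := A) hpl hpL ((hptr₂' pOne (by decide)).trans hOne)
    (by rwa [hpl₂, hpL₂]) (hpl₂ ▸ hlen) (hpl₂ ▸ hnW)).mono ?_
  rintro t₃ σ₃ ⟨ht₃, harr₃, hptr₃, halg₃⟩
  replace hptr₃ := hptr₃.trans hptr₂'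
  have hps₃ := hptr₃ ps hps
  have hxW₃ : σ₃.alg xW = σ.alg xW := (halg₃ _ (by simp)).trans hxW₂
  refine (wp_twistProg ((hptr₃ pOne (by decide)).trans hOne)
    ((hptr₃ pOrd (by decide)).trans hOrd) (hps₃ ▸ hs) hW).mono ?_
  rintro t₄ σ₄ ⟨ht₄, harr₄, hptr₄, halg₄, hx₄⟩
  replace hptr₄ := hptr₄.trans hptr₃
  have hpl₄ : σ₄.ptr pl = n := (hptr₄ pl hpl).trans hn
  rw [hps₃, hxW₃] at hx₄
  have hu : IsUnit (σ₄.alg xTwist) := hx₄ ▸ hω.isUnit_root.pow _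
  simp only [wp_inv]
  refine ⟨hu, ?_⟩
  refine (wp_scaleProg (A := A)
    (σ := ⟨σ₄.arr, Function.update σ₄.alg xTwist (Ring.inverse (σ₄.alg xTwist)), σ₄.ptr⟩)
    hpl ((hptr₄ pOne (by decide)).trans hOne) (hpl₄ ▸ hlen)
    (hpl₄ ▸ hnW)).mono ?_
  rintro t₅ σ₅ ⟨ht₅, harr₅, hptr₅, halg₅⟩
  refine ⟨fun hτ => ?_, ?_, ?_, ?_⟩
  · have := ht₂ hτ
    dsimp only at ht₅
    rw [hpl₄] at ht₅
    rw [hpl₂] at ht₃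
    omega
  · simp only [harr₅, harr₄, harr₃, harr₂, harr₁, hpl₂, hpL₂, hpl₄, Function.update_self,
      Function.update_idem]
    rw [unfoldArr_foldArr (by positivity), hx₄, scaleArr_scaleArr]
    rw [Ring.mul_inverse_cancel]
    exact hω.isUnit_root.pow _
  · exact hptr₅.trans hptr₄
  · refine (halg₅ _ (by simp)).trans ?_
    simp only [ne_eq, Function.update_of_ne, show xW ≠ xTwist by decide, not_false_eq_true]
    exact (halg₄ _ (by simp)).trans hxW₃

end

/-! ### Block sizes and pointwise products -/

section

variable {D : Type*} [CommRing D] {W : ℕ} {len : Arr → ℕ} {σ : State D Arr}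

/-- The search stops when `pK` holds the first power of two above `k`; this is at most `2 * k`,
whence `hW`. -/
theorem wp_loadPow2 {pL pl k : ℕ} (hpL : pL < 12)
    (hk : min (σ.ptr pR) (σ.ptr pl) = k) (h0 : 0 < k) (hW : 2 * k ≤ W) :
    WP W len (loadPow2 pL pl) (fun t σ' => t ≤ 3 * Nat.log 2 k + 5 ∧
      σ'.arr = σ.arr ∧ (∀ q < 12, q ≠ pL → σ'.ptr q = σ.ptr q) ∧ σ'.alg = σ.alg ∧
      σ'.ptr pL = 2 ^ Nat.log 2 k) σ := by
  have e1 : pL ≠ 13 ∧ pL ≠ 15 := by omega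
  -- Both branches of the minimum continue in the same way, with `k` in `pJ`.
  have key : ∀ σ₁ : State D Arr, σ₁.arr = σ.arr → EqBelow 12 σ₁.ptr σ.ptr →
      σ₁.alg = σ.alg → σ₁.ptr pJ = k → WP W len (block [
        .op (.pset pL 1), .op (.pset pK 2),
        .loop (.le pK pJ) (block [.op (.pmov pL pK), .op (.padd pK pK pK)])])
      (fun t σ' => t ≤ 3 * Nat.log 2 k + 3 ∧
        σ'.arr = σ.arr ∧ (∀ q < 12, q ≠ pL → σ'.ptr q = σ.ptr q) ∧ σ'.alg = σ.alg ∧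
        σ'.ptr pL = 2 ^ Nat.log 2 k) σ₁ := by
    intro σ₁ harr hptr halg hJ
    have e2 : 1 ≤ W := by omega
    have e3 : 2 ≤ W := by omega
    simp [e2, e3]
    refine wp_for (Nat.log 2 k) (fun i t τ => t = 3 * i ∧ τ.arr = σ.arr ∧
      (∀ q < 12, q ≠ pL → τ.ptr q = σ.ptr q) ∧ τ.alg = σ.alg ∧ τ.ptr pJ = k ∧
      τ.ptr pL = 2 ^ i ∧ τ.ptr pK = 2 ^ (i + 1)) ?_ ?_ ?_
    · rintro i t τ hi ⟨ht, harr, hptr, halg, hJ, hL, hK⟩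
      have h1 : 2 ^ (i + 1) ≤ k := (Nat.le_log_iff_pow_le (by norm_num) h0.ne').1 hi
      have h2 : 2 ^ (i + 1) ≤ W := by omega
      have h3 : 2 ^ (i + 1) + 2 ^ (i + 1) ≤ W := by omega
      have h4 : 15 ≠ pL := by omega
      have h5 : 13 ≠ pL := by omega
      simp [hK, hJ, h1, h2, h3, h4, h5, harr, halg, e1]
      refine ⟨by omega, fun q hq hq' => ?_, by ring⟩
      have h6 : q ≠ 15 := by omega
      simp [h6, hq', hptr q hq hq']
    · rintro t τ ⟨ht, harr, hptr, halg, hJ, hL, hK⟩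
      have h1 : k < 2 ^ (Nat.log 2 k + 1) := Nat.lt_pow_succ_log_self (by norm_num) k
      simp [hK, hJ, h1, harr, halg, hL]
      exact ⟨by omega, hptr⟩
    · have h5 : 13 ≠ pL := by omega
      simp [harr, halg, hJ, h5, e1]
      intro q hq hq'
      have h6 : q ≠ 15 := by omega
      simp [h6, hq', hptr q hq]
  rw [loadPow2, wp_block_cons]
  simp only [wp_ite, wp_pmov, Test.holds]
  refine ⟨fun hc => ⟨by omega, (key ⟨σ.arr, σ.alg, Function.update σ.ptr pJ _⟩ rfl (by simp) rfl ?_).mono ?_⟩,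
    fun hc => ⟨by omega, (key ⟨σ.arr, σ.alg, Function.update σ.ptr pJ _⟩ rfl (by simp) rfl ?_).mono ?_⟩⟩
  · simp; omega
  · rintro t σ' ⟨h1, h2⟩
    exact ⟨by omega, h2⟩
  · simp; omega
  · rintro t σ' ⟨h1, h2⟩
    exact ⟨by omega, h2⟩

/-- Add `g j` to entry `j`, for `u ≤ j < v`. -/
def accArr (u v : ℕ) (g : ℕ → D) (f : ℕ → D) (j : ℕ) : D :=
  if u ≤ j ∧ j < v then f j + g j else f j

theorem accArr_self (u : ℕ) (g f : ℕ → D) : accArr u u g f = f := by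
  funext j
  exact if_neg (by omega)

theorem accArr_accArr {u v w : ℕ} (huv : u ≤ v) (hvw : v ≤ w) (g f : ℕ → D) :
    accArr v w g (accArr u v g f) = accArr u w g f := by
  funext j
  unfold accArr
  split_ifs <;> first | rfl | omega

theorem accArr_succ {u v : ℕ} (huv : u ≤ v) (g f : ℕ → D) :
    accArr u (v + 1) g f = Function.update (accArr u v g f) v (f v + g v) := by
  funext j
  rcases lt_trichotomy j v with h | rfl | h
  · have : j < v + 1 := by omega
    simp [accArr, h, h.ne, this]
  · simp [accArr, huv]
  · have : ¬ j < v + 1 := by omega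
    simp [accArr, h.ne', h.not_gt, this]

theorem accArr_congr {u v : ℕ} {g g' : ℕ → D} (h : ∀ j, u ≤ j → j < v → g j = g' j)
    (f : ℕ → D) : accArr u v g f = accArr u v g' f := by
  funext j
  unfold accArr
  split_ifs with hj
  · rw [h j hj.1 hj.2]
  · rfl

theorem wp_mulAcc {u v L : ℕ} (hOne : σ.ptr pOne = 1) (hu : σ.ptr pOffA = u)
    (hv : σ.ptr pOff = v) (hL : σ.ptr pLa = L) (hvu : v ≤ u) (ha : L ≤ len .a)
    (hb : u - v + L ≤ len .b) (hc : u + L ≤ len .c) (hW : u + L ≤ W) :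
    WP W len mulAcc (fun t σ' => t ≤ 11 * L + 2 ∧
      σ'.arr = Function.update σ.arr .c
        (accArr u (u + L) (fun j => σ.arr .a (j - u) * σ.arr .b (j - v)) (σ.arr .c)) ∧
      EqBelow 12 σ'.ptr σ.ptr ∧ σ'.alg xW = σ.alg xW) σ := by
  simp [mulAcc]
  refine wp_for L (fun i t τ => t = 11 * i ∧ τ.arr = Function.update σ.arr .c
        (accArr u (u + i) (fun j => σ.arr .a (j - u) * σ.arr .b (j - v)) (σ.arr .c)) ∧
      EqBelow 12 τ.ptr σ.ptr ∧ τ.alg xW = σ.alg xW ∧ τ.ptr pI = i) ?_ ?_ ?_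
  · rintro i t τ hi ⟨ht, harr, hptr, halg, hI⟩
    have h5 := (hptr 5 (by norm_num)).trans hv
    have h7 := (hptr 7 (by norm_num)).trans hL
    have h8 := (hptr 8 (by norm_num)).trans hu
    have h11 := (hptr 11 (by norm_num)).trans hOne
    have e1 : u ≤ W + v := by omega
    have e2 : i < len .a := by omega
    have e3 : u - v + i ≤ W := by omega
    have e4 : u - v + i < len .b := by omega
    have e5 : u + i ≤ W := by omega
    have e6 : u + i < len .c := by omega
    have e7 : i + 1 ≤ W := by omega
    simp [h5, h7, h8, h11, hI, hi, e1, e2, e3, e4, e5, e6, e7, harr, hptr, halg]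
    refine ⟨by omega, ?_⟩
    rw [← add_assoc, accArr_succ (by omega)]
    congr 2
    rw [Nat.add_sub_cancel_left, accArr, if_neg (by omega), show u + i - v = u - v + i by omega]
  · rintro t τ ⟨ht, harr, hptr, halg, hI⟩
    have h7 := (hptr 7 (by norm_num)).trans hL
    simp [h7, hI, harr, hptr, halg]
    omega
  · simp [accArr_self]

end

/-! ### One iteration of the multiplication -/

section

variable {D : Type*} [CommRing D] {W : ℕ} {σ σ' : State D Arr} {m n p κ : ℕ} {ω : D}
  {τ : Prop} {T : ℕ → ℕ} {P Q : Stmt Unit}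

/-- What all parts of the algorithm rely on and leave unchanged. -/
structure Context (m n p κ W : ℕ) (ω : D) (σ : State D Arr) : Prop where
  one_le : 1 ≤ m
  le : m ≤ n
  le_pow : m + n - 1 ≤ 2 ^ p
  root : IsPrincipalRoot ω (2 ^ p)
  mul_le : κ * n ≤ W
  pow_le : 2 ^ p ≤ W
  two_mul_le : 2 * n ≤ W
  ptr_m : σ.ptr pM = m
  ptr_n : σ.ptr pN = n
  ptr_ord : σ.ptr pOrd = 2 ^ p
  ptr_len : σ.ptr pLen = m + n - 1
  ptr_zero : σ.ptr pZero = 0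
  ptr_one : σ.ptr pOne = 1
  alg_root : σ.alg xW = ω

theorem Context.of_eq (h : Context m n p κ W ω σ)
    (hptr : ∀ q ∈ [pM, pN, pOrd, pLen, pZero, pOne], σ'.ptr q = σ.ptr q)
    (halg : σ'.alg xW = σ.alg xW) : Context m n p κ W ω σ' :=
  { h with
    ptr_m := (hptr _ (by decide)).trans h.ptr_m
    ptr_n := (hptr _ (by decide)).trans h.ptr_n
    ptr_ord := (hptr _ (by decide)).trans h.ptr_ord
    ptr_len := (hptr _ (by decide)).trans h.ptr_len
    ptr_zero := (hptr _ (by decide)).trans h.ptr_zero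
    ptr_one := (hptr _ (by decide)).trans h.ptr_one
    alg_root := halg.trans h.alg_root }

theorem Context.of_eqBelow (h : Context m n p κ W ω σ) (hptr : EqBelow 12 σ'.ptr σ.ptr)
    (halg : σ'.alg xW = σ.alg xW) : Context m n p κ W ω σ' :=
  h.of_eq (fun q hq => hptr q (by fin_cases hq <;> decide)) halg

/-- The values of the product of two polynomials. -/
noncomputable def prodVal (ω : D) (p m n : ℕ) (f g : ℕ → D) (j : ℕ) : D :=
  brTFT ω p m f j * brTFT ω p n g j

/-- The values of the second factor on the whole block are already in `b`. The smaller array `a`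
passes through the sub-blocks, each time transformed, multiplied into `c` and restored before the
next one. -/
theorem wp_innerLoop (h : TimedTransform D DFTSize κ τ T P Q) (ctx : Context m n p κ W ω σ)
    {off ℓ k : ℕ} {b : ℕ → D} (hoff : σ.ptr pOff = off) (hoffA : σ.ptr pOffA = off)
    (hEnd : σ.ptr pEnd = off + 2 ^ (ℓ + k)) (hLa : σ.ptr pLa = 2 ^ ℓ) (hℓm : 2 ^ ℓ ≤ m)
    (hℓn : 2 ^ (ℓ + k) ≤ n) (hdvd : 2 ^ (ℓ + k) ∣ off) (hle : off + 2 ^ (ℓ + k) ≤ m + n - 1)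
    (hb : σ.arr .b = partArr ω p (ℓ + k) n off b) :
    WP W (lens m n) (.loop (.lt pOffA pEnd) (block [
      partTFT P .a pM pOffA pLa,
      mulAcc,
      partTFTInv Q .a pM pOffA pLa,
      .op (.padd pOffA pOffA pLa)]))
      (fun t σ' => (τ → t ≤ 2 ^ k * (18 * p + 26 * m + 11 * 2 ^ ℓ + 37 + 2 * T (2 ^ ℓ)) + 1) ∧
        σ'.arr .a = σ.arr .a ∧ σ'.arr .b = σ.arr .b ∧
        σ'.arr .c = accArr off (off + 2 ^ (ℓ + k)) (prodVal ω p m n (σ.arr .a) b) (σ.arr .c) ∧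
        (∀ q < 12, q ≠ pOffA → σ'.ptr q = σ.ptr q) ∧ σ'.alg xW = σ.alg xW) σ := by
  have hmp : m ≤ 2 ^ p := by have := ctx.le_pow; have := ctx.le; omega
  have hℓp : ℓ ≤ p := (Nat.pow_le_pow_iff_right (by norm_num : 1 < 2)).1 (hℓm.trans hmp)
  have hℓkp : ℓ + k ≤ p := (Nat.pow_le_pow_iff_right (by norm_num : 1 < 2)).1
    ((Nat.le_add_left _ off).trans (hle.trans ctx.le_pow))
  have hκm : κ * m ≤ W := (Nat.mul_le_mul_left κ ctx.le).trans ctx.mul_le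
  have hmW : m ≤ W := hmp.trans ctx.pow_le
  have hmn := ctx.le
  have hm1 := ctx.one_le
  have hW := ctx.pow_le
  have hlp := ctx.le_pow
  refine wp_for (2 ^ k) (fun i t υ =>
    (τ → t ≤ i * (18 * p + 26 * m + 11 * 2 ^ ℓ + 37 + 2 * T (2 ^ ℓ))) ∧
    υ.arr .a = σ.arr .a ∧ υ.arr .b = σ.arr .b ∧
    υ.arr .c = accArr off (off + i * 2 ^ ℓ) (prodVal ω p m n (σ.arr .a) b) (σ.arr .c) ∧
    (∀ q < 12, q ≠ pOffA → υ.ptr q = σ.ptr q) ∧ υ.alg xW = σ.alg xW ∧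
    υ.ptr pOffA = off + i * 2 ^ ℓ) ?_ ?_ ?_
  · rintro i t υ hi ⟨ht, hA, hB, hC, hptr, halg, hU⟩
    have hpow := Nat.two_pow_pos ℓ
    have hi' : i * 2 ^ ℓ + 2 ^ ℓ ≤ 2 ^ (ℓ + k) := by
      rw [pow_add, ← Nat.succ_mul, mul_comm]
      exact Nat.mul_le_mul_left _ hi
    have ctx' : Context m n p κ W ω υ :=
      ctx.of_eq (fun q hq => hptr q (by fin_cases hq <;> decide) (by fin_cases hq <;> decide)) halg
    have hLa' := (hptr pLa (by decide) (by decide)).trans hLa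
    have hoff' := (hptr pOff (by decide) (by decide)).trans hoff
    have hEnd' := (hptr pEnd (by decide) (by decide)).trans hEnd
    refine ⟨by simp only [Test.holds, hU, hEnd']; omega, ?_⟩
    generalize hu : off + i * 2 ^ ℓ = u at *
    have hdvd' : 2 ^ ℓ ∣ u :=
      hu ▸ (Nat.dvd_add ((pow_dvd_pow 2 (Nat.le_add_right ℓ k)).trans hdvd) (Dvd.intro_left _ rfl))
    have hroot : IsPrincipalRoot (υ.alg xW) (2 ^ p) := ctx'.alg_root.symm ▸ ctx.root
    simp only [wp_block_cons, wp_block_nil]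
    refine (wp_partTFT (A := .a) h hroot hℓp (by decide) (by decide) ctx'.ptr_one
      ctx'.ptr_ord (hU ▸ by omega) hLa' ctx'.ptr_m hℓm le_rfl hκm hW hmW).mono ?_
    rintro t₁ σ₁ ⟨ht₁, harr₁, hptr₁, halg₁⟩
    rw [ctx'.alg_root, hU, hA] at harr₁
    have ctx₁ := ctx'.of_eqBelow hptr₁ halg₁
    have hU₁ := (hptr₁ pOffA (by decide)).trans hU
    have hLa₁ := (hptr₁ pLa (by decide)).trans hLa'
    have hoff₁ := (hptr₁ pOff (by decide)).trans hoff'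
    refine (wp_mulAcc ctx₁.ptr_one hU₁ hoff₁ hLa₁ (by omega) (by simpa [lens] using hℓm)
      (by simp only [lens]; omega) (by simp only [lens]; omega) (by omega)).mono ?_
    rintro t₂ σ₂ ⟨ht₂, harr₂, hptr₂, halg₂⟩
    have ctx₂ := ctx₁.of_eqBelow hptr₂ halg₂
    have hU₂ := (hptr₂ pOffA (by decide)).trans hU₁
    have hLa₂ := (hptr₂ pLa (by decide)).trans hLa₁
    have hA₂ : σ₂.arr .a = partArr (σ₂.alg xW) p ℓ m (σ₂.ptr pOffA) (σ.arr .a) := by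
      rw [harr₂, harr₁, hU₂, ctx₂.alg_root]
      simp
    refine (wp_partTFTInv (A := .a) h (ctx₂.alg_root.symm ▸ ctx.root) hℓp (by decide) (by decide)
      (by decide) ctx₂.ptr_one ctx₂.ptr_ord (hU₂ ▸ by omega) hLa₂ ctx₂.ptr_m hℓm le_rfl hκm hW hmW
      hA₂).mono ?_
    rintro t₃ σ₃ ⟨ht₃, harr₃, hptr₃, halg₃⟩
    have hU₃ := (hptr₃ pOffA (by decide)).trans hU₂
    have hLa₃ := (hptr₃ pLa (by decide)).trans hLa₂
    have hu' : off + (i + 1) * 2 ^ ℓ = u + 2 ^ ℓ := by rw [← hu]; ring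
    simp only [wp_padd, hU₃, hLa₃]
    refine ⟨by omega, fun hτ => ?_, ?_, ?_, ?_, ?_, ?_, ?_⟩
    · have := ht hτ
      have := ht₁ hτ
      have := ht₃ hτ
      rw [Nat.succ_mul]
      omega
    · simp [harr₃]
    · simp [harr₃, harr₂, harr₁, hB]
    · simp only [harr₃, harr₂, harr₁, ne_eq, reduceCtorEq, not_false_eq_true,
        Function.update_of_ne, Function.update_self, hB, hC]
      rw [hu', ← accArr_accArr (by omega : off ≤ u) (by omega : u ≤ u + 2 ^ ℓ)]
      refine accArr_congr (fun j hj hj' => ?_) _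
      -- Entry j - u of `a` and entry j - off of `b` are values at the same point, number j.
      rw [partArr_of_lt ctx.root hℓp hℓm hdvd' (by omega), hb,
        partArr_of_lt ctx.root hℓkp hℓn hdvd (by omega), prodVal]
      congr 2 <;> omega
    · intro q hq hq'
      simp only [ne_eq, hq', not_false_eq_true, Function.update_of_ne]
      exact (hptr₃ q hq).trans ((hptr₂ q hq).trans ((hptr₁ q hq).trans (hptr q hq hq')))
    · exact halg₃.trans (halg₂.trans (halg₁.trans halg))
    · simp [hu']
  · rintro t υ ⟨ht, hA, hB, hC, hptr, halg, hU⟩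
    have e : 2 ^ k * 2 ^ ℓ = 2 ^ (ℓ + k) := by rw [← pow_add, add_comm]
    rw [e] at hC hU
    refine ⟨?_, fun hτ => by have := ht hτ; omega, hA, hB, hC, hptr, halg⟩
    have hEnd' := (hptr pEnd (by decide) (by decide)).trans hEnd
    simp [hU, hEnd']
  · simp [accArr_self, hoffA]

/-- The array `b` is transformed once and `a` once for each of the `2 ^ k` sub-blocks, which
explains the two parts of the time bound. -/
theorem wp_iteration (h : TimedTransform D DFTSize κ τ T P Q) (ctx : Context m n p κ W ω σ)
    {off r ℓ k : ℕ} (hr : σ.ptr pR = r) (hr0 : 0 < r) (hoff : m + n - 1 - r = off)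
    (hℓ : Nat.log 2 (min r m) = ℓ) (hk : Nat.log 2 (min r n) = ℓ + k)
    (hrN : r ≤ m + n - 1) (hdvd : 2 ^ (ℓ + k) ∣ off) :
    WP W (lens m n) (iteration P Q)
      (fun t σ' => (τ → t ≤ 24 * p + 26 * n + 50 + 2 * T (2 ^ (ℓ + k)) +
          2 ^ k * (18 * p + 26 * m + 11 * 2 ^ ℓ + 37 + 2 * T (2 ^ ℓ))) ∧
        σ'.arr .a = σ.arr .a ∧ σ'.arr .b = σ.arr .b ∧
        σ'.arr .c = accArr off (off + 2 ^ (ℓ + k)) (prodVal ω p m n (σ.arr .a) (σ.arr .b))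
          (σ.arr .c) ∧
        Context m n p κ W ω σ' ∧ σ'.ptr pR = r - 2 ^ (ℓ + k)) σ := by
  have hmn := ctx.le
  have hm1 := ctx.one_le
  have hW := ctx.pow_le
  have hlp := ctx.le_pow
  have hnW := ctx.two_mul_le
  have hℓ2 : 2 ^ ℓ ≤ min r m := hℓ ▸ Nat.pow_log_le_self 2 (by omega)
  have hk2 : 2 ^ (ℓ + k) ≤ min r n := hk ▸ Nat.pow_log_le_self 2 (by omega)
  have hkp : ℓ + k ≤ p := (Nat.pow_le_pow_iff_right (by norm_num : 1 < 2)).1 (by omega)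
  have hroot : IsPrincipalRoot (σ.alg xW) (2 ^ p) := ctx.alg_root.symm ▸ ctx.root
  simp only [iteration, wp_block_cons, wp_block_nil]
  refine (wp_loadPow2 (k := min r m) (by decide) (by rw [hr, ctx.ptr_m]) (by omega)
    (by omega)).mono ?_
  rintro t₁ σ₁ ⟨ht₁, harr₁, hptr₁, halg₁, hLa₁⟩
  rw [hℓ] at hLa₁ ht₁
  have hr₁ := (hptr₁ pR (by decide) (by decide)).trans hr
  have hn₁ := (hptr₁ pN (by decide) (by decide)).trans ctx.ptr_n
  refine (wp_loadPow2 (k := min r n) (by decide) (by rw [hr₁, hn₁]) (by omega)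
    (by omega)).mono ?_
  rintro t₂ σ₂ ⟨ht₂, harr₂, hptr₂, halg₂, hLb₂⟩
  rw [hk] at hLb₂ ht₂
  have hLa₂ := (hptr₂ pLa (by decide) (by decide)).trans hLa₁
  have hr₂ := (hptr₂ pR (by decide) (by decide)).trans hr₁
  have ctx₂ : Context m n p κ W ω σ₂ := (ctx.of_eq (σ' := σ₁) (fun q hq =>
    hptr₁ q (by fin_cases hq <;> decide) (by fin_cases hq <;> decide)) (by rw [halg₁])).of_eq
    (fun q hq => hptr₂ q (by fin_cases hq <;> decide) (by fin_cases hq <;> decide)) (by rw [halg₂])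
  simp only [wp_psub, ctx₂.ptr_len, hr₂, hoff]
  refine ⟨by omega, ?_⟩
  have ctx₃ := ctx₂.of_eq (σ' := ⟨σ₂.arr, σ₂.alg, Function.update σ₂.ptr pOff off⟩)
    (fun q hq => by fin_cases hq <;> simp) rfl
  have hLa₃ : (Function.update σ₂.ptr pOff off) pLa = 2 ^ ℓ := by simpa using hLa₂
  have hLb₃ : (Function.update σ₂.ptr pOff off) pLb = 2 ^ (ℓ + k) := by simpa using hLb₂
  have hr₃ : (Function.update σ₂.ptr pOff off) pR = r := by simpa using hr₂
  have hoff₃ : (Function.update σ₂.ptr pOff off) pOff = off := by simp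
  generalize hσ₃ : (⟨σ₂.arr, σ₂.alg, Function.update σ₂.ptr pOff off⟩ : State D Arr) = σ₃ at *
  have harr₃ : σ₃.arr = σ.arr := by rw [← hσ₃, ← harr₁, ← harr₂]
  have hptr₃ : σ₃.ptr = Function.update σ₂.ptr pOff off := by rw [← hσ₃]
  rw [← hptr₃] at hLa₃ hLb₃ hr₃ hoff₃
  refine (wp_partTFT (A := .b) h (ctx₃.alg_root.symm ▸ ctx.root) hkp (by decide) (by decide)
    ctx₃.ptr_one ctx₃.ptr_ord (by rw [hoff₃]; omega) hLb₃ ctx₃.ptr_n (by omega) le_rfl ctx.mul_le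
    hW (by omega)).mono ?_
  rintro t₄ σ₄ ⟨ht₄, harr₄, hptr₄, halg₄⟩
  have ctx₄ := ctx₃.of_eqBelow hptr₄ halg₄
  have hLa₄ := (hptr₄ pLa (by decide)).trans hLa₃
  have hLb₄ := (hptr₄ pLb (by decide)).trans hLb₃
  have hr₄ := (hptr₄ pR (by decide)).trans hr₃
  have hoff₄ := (hptr₄ pOff (by decide)).trans hoff₃
  rw [ctx₃.alg_root, hoff₃, harr₃] at harr₄
  have hoffW : off ≤ W := by omega
  have hsumW : off + 2 ^ (ℓ + k) ≤ W := by omega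
  simp only [wp_pmov, wp_padd, hoff₄, hoffW, true_and, ne_eq, show pOff ≠ pOffA by decide,
    show pLb ≠ pOffA by decide, not_false_eq_true, Function.update_of_ne, hLb₄, hsumW]
  have ctx₅ := ctx₄.of_eq (σ' := ⟨σ₄.arr, σ₄.alg,
    Function.update (Function.update σ₄.ptr pOffA off) pEnd (off + 2 ^ (ℓ + k))⟩)
    (fun q hq => by fin_cases hq <;> simp) rfl
  refine (wp_innerLoop (b := σ.arr .b) h ctx₅ (by simpa using hoff₄) (by simp) (by simp)
    (by simpa using hLa₄) (by omega) (by omega) hdvd (by omega) (by simp [harr₄])).mono ?_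
  rintro t₆ σ₆ ⟨ht₆, hA₆, hB₆, hC₆, hptr₆, halg₆⟩
  have ctx₆ := ctx₅.of_eq (σ' := σ₆)
    (fun q hq => hptr₆ q (by fin_cases hq <;> decide) (by fin_cases hq <;> decide)) halg₆
  have hLb₆ : σ₆.ptr pLb = 2 ^ (ℓ + k) :=
    (hptr₆ pLb (by decide) (by decide)).trans (by simpa using hLb₄)
  have hr₆ : σ₆.ptr pR = r := (hptr₆ pR (by decide) (by decide)).trans (by simpa using hr₄)
  have hoff₆ : σ₆.ptr pOff = off :=
    (hptr₆ pOff (by decide) (by decide)).trans (by simpa using hoff₄)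
  refine (wp_partTFTInv (A := .b) (f := σ.arr .b) h (ctx₆.alg_root.symm ▸ ctx.root) hkp (by decide)
    (by decide) (by decide) ctx₆.ptr_one ctx₆.ptr_ord (by rw [hoff₆]; omega) hLb₆ ctx₆.ptr_n
    (by omega) le_rfl ctx.mul_le hW (by omega)
    (by rw [hB₆, harr₄, hoff₆, ctx₆.alg_root]; simp)).mono ?_
  rintro t₇ σ₇ ⟨ht₇, harr₇, hptr₇, halg₇⟩
  have ctx₇ := ctx₆.of_eqBelow hptr₇ halg₇
  have hr₇ := (hptr₇ pR (by decide)).trans hr₆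
  have hLb₇ := (hptr₇ pLb (by decide)).trans hLb₆
  simp only [hr₇, hLb₇]
  refine ⟨by omega, fun hτ => ?_, ?_, ?_, ?_, ?_, ?_⟩
  · have := ht₄ hτ
    have := ht₆ hτ
    have := ht₇ hτ
    omega
  · simp [harr₇, hA₆, harr₄]
  · simp [harr₇]
  · simp [harr₇, hC₆, harr₄]
  · exact ctx₇.of_eq (fun q hq => by fin_cases hq <;> simp) rfl
  · simp

end

/-! ### Explicit bounds for O(n log n) -/

section QuasiLinear

theorem IsQuasiLinear.exists_le {T : ℕ → ℕ} (h : IsQuasiLinear T) :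
    ∃ K : ℕ, ∀ n, 1 ≤ n → T n ≤ K * (n * (Nat.log 2 n + 1)) := by
  obtain ⟨C, hC⟩ := h.bound
  obtain ⟨n₀, hn₀⟩ := Filter.eventually_atTop.1 hC
  -- The sum covers the finitely many lengths for which the asymptotic bound says nothing. The
  -- summand 1 beside the logarithm keeps the bound positive at `n = 1`.
  refine ⟨⌈C⌉₊ + ∑ i ∈ Finset.range n₀, T i, fun n hn => ?_⟩
  rcases lt_or_ge n n₀ with hlt | hge
  · have h1 : T n ≤ ∑ i ∈ Finset.range n₀, T i :=
      Finset.single_le_sum (f := T) (fun _ _ => Nat.zero_le _) (Finset.mem_range.2 hlt)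
    calc T n ≤ (⌈C⌉₊ + ∑ i ∈ Finset.range n₀, T i) * 1 := by omega
      _ ≤ _ := Nat.mul_le_mul_left _ (Nat.mul_pos hn (Nat.succ_pos _))
  · have hn' : (1 : ℝ) ≤ n := by exact_mod_cast hn
    have h2 : Real.log n ≤ Nat.log 2 n + 1 := by
      have h3 : (n : ℝ) ≤ 2 ^ (Nat.log 2 n + 1) := by
        exact_mod_cast (Nat.lt_pow_succ_log_self (by norm_num) n).le
      calc Real.log n ≤ Real.log (2 ^ (Nat.log 2 n + 1)) := Real.log_le_log (by linarith) h3
        _ = (Nat.log 2 n + 1 : ℕ) * Real.log 2 := by rw [Real.log_pow]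
        _ ≤ (Nat.log 2 n + 1 : ℕ) * 1 := by
            gcongr
            linarith [Real.log_two_lt_d9]
        _ = _ := by push_cast; ring
    have h4 := hn₀ n hge
    rw [Real.norm_of_nonneg (by positivity), Real.norm_of_nonneg
      (mul_nonneg (by linarith) (Real.log_nonneg hn'))] at h4
    have h5 : (T n : ℝ) ≤ (⌈C⌉₊ : ℝ) * (n * (Nat.log 2 n + 1)) := by
      refine h4.trans ?_
      have := Real.log_nonneg hn'
      gcongr
      exact Nat.le_ceil C
    have h6 : T n ≤ ⌈C⌉₊ * (n * (Nat.log 2 n + 1)) := by exact_mod_cast h5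
    exact h6.trans (Nat.mul_le_mul_right _ (Nat.le_add_right _ _))

theorem isQuasiLinear_mul_log (K : ℕ) :
    IsQuasiLinear fun n => K * (n * (Nat.log 2 n + 1)) := by
  -- For `n ≥ 2`, both `Nat.log 2 n` and 1 are at most log n / log 2.
  refine Asymptotics.IsBigO.of_bound (K * (2 / Real.log 2)) ?_
  filter_upwards [Filter.eventually_ge_atTop 2] with n hn
  have hn' : (2 : ℝ) ≤ n := by exact_mod_cast hn
  have h2 : 0 < Real.log 2 := Real.log_pos (by norm_num)
  have h3 : Real.log 2 ≤ Real.log n := Real.log_le_log (by norm_num) hn'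
  have h4 : (Nat.log 2 n : ℝ) * Real.log 2 ≤ Real.log n := by
    rw [← Real.log_pow]
    refine Real.log_le_log (by positivity) ?_
    exact_mod_cast Nat.pow_log_le_self 2 (by omega)
  have h5 : (Nat.log 2 n : ℝ) + 1 ≤ 2 / Real.log 2 * Real.log n := by
    rw [div_mul_eq_mul_div, le_div_iff₀ h2]
    linarith
  rw [Real.norm_of_nonneg (by positivity), Real.norm_of_nonneg (by positivity)]
  push_cast
  calc (K : ℝ) * (n * (Nat.log 2 n + 1)) ≤ K * (n * (2 / Real.log 2 * Real.log n)) := by gcongr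
    _ = _ := by ring

end QuasiLinear

/-! ### Number and cost of the iterations -/

section Counting

/-- A bound for the number of iterations that are left when `r` entries are left. -/
def rounds (n r : ℕ) : ℕ :=
  if r < 2 ^ Nat.log 2 n then Nat.size r else Nat.log 2 n + r / 2 ^ Nat.log 2 n

/-- While r is at least the largest power of two below n, that power is subtracted and the quotient
drops by one. Afterwards each round removes the leading binary digit of r, and the number of digits
drops. -/
theorem rounds_sub {n r : ℕ} (hr : 0 < r) (hn : 0 < n) :
    rounds n (r - 2 ^ Nat.log 2 (min r n)) + 1 ≤ rounds n r := by
  have hn2 : n < 2 ^ (Nat.log 2 n + 1) := Nat.lt_pow_succ_log_self (by norm_num) n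
  have hn1 : 2 ^ Nat.log 2 n ≤ n := Nat.pow_log_le_self 2 hn.ne'
  have hpos := Nat.two_pow_pos (Nat.log 2 n)
  rcases lt_or_ge r (2 ^ Nat.log 2 n) with h | h
  · have h1 : r < 2 ^ (Nat.log 2 r + 1) := Nat.lt_pow_succ_log_self (by norm_num) r
    have h2 : 2 ^ Nat.log 2 r ≤ r := Nat.pow_log_le_self 2 hr.ne'
    have h3 := pow_succ 2 (Nat.log 2 r)
    rw [min_eq_left (by omega), rounds, rounds, if_pos (by omega), if_pos h]
    have h4 : Nat.size (r - 2 ^ Nat.log 2 r) ≤ Nat.log 2 r := Nat.size_le.2 (by omega)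
    have h5 : Nat.log 2 r < Nat.size r := Nat.lt_size.2 h2
    omega
  · have h1 : Nat.log 2 (min r n) = Nat.log 2 n := by
      refine Nat.log_eq_of_pow_le_of_lt_pow (by omega) (by omega)
    rw [h1, rounds, rounds, if_neg (by omega : ¬ r < 2 ^ Nat.log 2 n)]
    have h2 : 1 ≤ r / 2 ^ Nat.log 2 n := (Nat.one_le_div_iff hpos).2 h
    split_ifs with h3
    · have := Nat.size_le.2 h3
      omega
    · rw [Nat.div_eq_sub_div hpos h, add_assoc]

theorem rounds_le {n r : ℕ} (hr : r ≤ 2 * n) : rounds n r ≤ Nat.log 2 n + 3 := by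
  have hn2 : n < 2 ^ (Nat.log 2 n + 1) := Nat.lt_pow_succ_log_self (by norm_num) n
  rw [rounds]
  split_ifs with h
  · have := Nat.size_le.2 h
    omega
  · have : r / 2 ^ Nat.log 2 n < 4 := by
      rw [Nat.div_lt_iff_lt_mul (by positivity)]
      rw [pow_succ] at hn2
      omega
    omega

/-- This is what makes the bound uniform in `m ≤ n`. If `m ≤ r`, then `2 ^ ℓ` is more than half of
`m`, and `2 ^ (ℓ + k) ≤ n`. If `r < m`, both block sizes are determined by `r`, and `k = 0`. -/
theorem two_pow_mul_le {m n r ℓ k : ℕ} (hm : 1 ≤ m) (hmn : m ≤ n) (hr : 0 < r)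
    (hℓ : Nat.log 2 (min r m) = ℓ) (hk : Nat.log 2 (min r n) = ℓ + k) : 2 ^ k * m ≤ 2 * n := by
  rcases le_or_gt m r with h | h
  · rw [min_eq_right h] at hℓ
    have h1 : m < 2 ^ (ℓ + 1) := hℓ ▸ Nat.lt_pow_succ_log_self (by norm_num) m
    have h2 : 2 ^ (ℓ + k) ≤ min r n := hk ▸ Nat.pow_log_le_self 2 (by omega)
    calc 2 ^ k * m ≤ 2 ^ k * 2 ^ (ℓ + 1) := Nat.mul_le_mul_left _ h1.le
      _ = 2 * 2 ^ (ℓ + k) := by ring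
      _ ≤ 2 * n := by omega
  · rw [min_eq_left h.le] at hℓ
    rw [min_eq_left (by omega)] at hk
    obtain rfl : k = 0 := by omega
    omega

/-- With g for the logarithm and B for the large block: 24 (g + 2) + 26 n + 52 n + 51 is at most 201
n, and 18 · 2 (g + 1) + 11 + 37 is at most 84 (g + 1). The DFTs of both arrays contribute 4 K B (g +
1). -/
theorem iteration_time_le {m n p ℓ k K : ℕ} {T : ℕ → ℕ}
    (hT : ∀ i, 1 ≤ i → T i ≤ K * (i * (Nat.log 2 i + 1))) (hn : 1 ≤ n)
    (hp : p ≤ Nat.log 2 n + 2) (hm : 2 ^ k * m ≤ 2 * n) (hk : 2 ^ (ℓ + k) ≤ n) :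
    24 * p + 26 * n + 50 + 2 * T (2 ^ (ℓ + k)) +
      2 ^ k * (18 * p + 26 * m + 11 * 2 ^ ℓ + 37 + 2 * T (2 ^ ℓ)) + 1 ≤
    201 * n + (84 + 4 * K) * (Nat.log 2 n + 1) * 2 ^ (ℓ + k) := by
  have h1 := hT (2 ^ (ℓ + k)) Nat.one_le_two_pow
  have h2 := hT (2 ^ ℓ) Nat.one_le_two_pow
  rw [Nat.log_pow (by norm_num)] at h1 h2
  have h3 : ℓ + k ≤ Nat.log 2 n := (Nat.le_log_iff_pow_le (by norm_num) (by omega)).2 hk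
  have h4 : Nat.log 2 n ≤ n := Nat.log_le_self 2 n
  have h5 : 2 ^ k ≤ 2 ^ (ℓ + k) := Nat.pow_le_pow_right (by norm_num) (Nat.le_add_left _ _)
  have h6 : 2 ^ k * 2 ^ ℓ = 2 ^ (ℓ + k) := by rw [← pow_add, add_comm]
  generalize Nat.log 2 n = g at *
  generalize 2 ^ (ℓ + k) = B at *
  have h7 : T B ≤ K * (B * (g + 1)) := h1.trans (by gcongr)
  have h8 : 2 ^ k * T (2 ^ ℓ) ≤ K * (B * (g + 1)) :=
    calc 2 ^ k * T (2 ^ ℓ) ≤ 2 ^ k * (K * (2 ^ ℓ * (ℓ + 1))) := Nat.mul_le_mul_left _ h2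
      _ = K * ((2 ^ k * 2 ^ ℓ) * (ℓ + 1)) := by ring
      _ ≤ K * (B * (g + 1)) := by rw [h6]; gcongr; omega
  have h9 : 2 ^ k * p ≤ B * (g + 2) := Nat.mul_le_mul h5 hp
  nlinarith

end Counting

/-! ### Correctness and time of the multiplication -/

section

variable {D : Type*} [CommRing D] {W : ℕ} {σ σ' : State D Arr} {m n p κ : ℕ} {ω : D}
  {τ : Prop} {T : ℕ → ℕ} {P Q : Stmt Unit}

/-- Amortization: an iteration pays 201 n out of the number of rounds left, and a multiple of its
block size out of the number of entries left. -/
theorem wp_mulLoop (h : TimedTransform D DFTSize κ τ T P Q) (ctx : Context m n p κ W ω σ)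
    (hr : σ.ptr pR = m + n - 1) {K : ℕ} (hp : p ≤ Nat.log 2 n + 2)
    (hT : ∀ i, 1 ≤ i → T i ≤ K * (i * (Nat.log 2 i + 1))) :
    WP W (lens m n) (.loop (.lt pZero pR) (iteration P Q))
      (fun t σ' => (τ → t ≤ (771 + 8 * K) * (n * (Nat.log 2 n + 1)) + 1) ∧
        σ'.arr .a = σ.arr .a ∧ σ'.arr .b = σ.arr .b ∧
        σ'.arr .c = accArr 0 (m + n - 1) (prodVal ω p m n (σ.arr .a) (σ.arr .b)) (σ.arr .c) ∧
        Context m n p κ W ω σ') σ := by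
  have hmn := ctx.le
  have hm1 := ctx.one_le
  generalize hN : m + n - 1 = N at *
  refine wp_loop (fun r t υ => r ≤ N ∧ υ.ptr pR = r ∧
    (τ → t + 201 * n * rounds n r + (84 + 4 * K) * (Nat.log 2 n + 1) * r ≤
      201 * n * rounds n N + (84 + 4 * K) * (Nat.log 2 n + 1) * N) ∧
    (0 < r → 2 ^ Nat.log 2 (min r n) ∣ N - r) ∧
    υ.arr .a = σ.arr .a ∧ υ.arr .b = σ.arr .b ∧
    υ.arr .c = accArr 0 (N - r) (prodVal ω p m n (σ.arr .a) (σ.arr .b)) (σ.arr .c) ∧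
    Context m n p κ W ω υ) ?_ ?_ (k := N) ?_
  · rintro r t υ ⟨hrN, hr, ht, hdvd, hA, hB, hC, ctx'⟩ hc
    simp only [Test.holds, ctx'.ptr_zero, hr] at hc
    obtain ⟨k, hk⟩ : ∃ k, Nat.log 2 (min r n) = Nat.log 2 (min r m) + k :=
      Nat.exists_eq_add_of_le (Nat.log_mono_right (by omega))
    have hle : 2 ^ Nat.log 2 (min r n) ≤ min r n := Nat.pow_log_le_self 2 (by omega)
    have hpos := Nat.two_pow_pos (Nat.log 2 (min r n))
    have hround := rounds_sub hc (by omega : 0 < n)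
    have hdvd' := hdvd hc
    rw [hk] at hle hpos hround hdvd'
    have htime := iteration_time_le hT (by omega) hp
      (two_pow_mul_le hm1 hmn hc rfl hk) (hle.trans (min_le_right _ _))
    refine (wp_iteration h ctx' hr hc rfl rfl hk (by omega) (by rwa [hN])).mono ?_
    rintro t' υ' ⟨ht', hA', hB', hC', ctx'', hr'⟩
    refine ⟨r - 2 ^ (Nat.log 2 (min r m) + k), by omega, by omega, hr', fun hτ => ?_, fun h0 => ?_,
      hA'.trans hA, hB'.trans hB, ?_, ctx''⟩
    · have h1 := ht hτ
      have h2 := ht' hτ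
      have h3 : r = r - 2 ^ (Nat.log 2 (min r m) + k) + 2 ^ (Nat.log 2 (min r m) + k) := by omega
      have h4 : (84 + 4 * K) * (Nat.log 2 n + 1) * r =
          (84 + 4 * K) * (Nat.log 2 n + 1) * (r - 2 ^ (Nat.log 2 (min r m) + k)) +
          (84 + 4 * K) * (Nat.log 2 n + 1) * 2 ^ (Nat.log 2 (min r m) + k) := by
        rw [← mul_add, ← h3]
      have h5 := Nat.mul_le_mul_left (201 * n) hround
      rw [mul_add, mul_one] at h5
      omega
    · have h1 : N - (r - 2 ^ (Nat.log 2 (min r m) + k)) =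
          N - r + 2 ^ (Nat.log 2 (min r m) + k) := by omega
      -- Block sizes never grow, and a smaller power of two divides a larger one, so the next offset
      -- is aligned as well.
      have h2 : Nat.log 2 (min (r - 2 ^ (Nat.log 2 (min r m) + k)) n) ≤
          Nat.log 2 (min r m) + k := hk ▸ Nat.log_mono_right (by omega)
      rw [h1]
      exact (pow_dvd_pow 2 h2).trans (Nat.dvd_add hdvd' (dvd_refl _))
    · rw [hC', hA, hB, hC, hN, accArr_accArr (Nat.zero_le _) (by omega)]
      congr 1
      omega
  · rintro r t υ ⟨hrN, hr, ht, hdvd, hA, hB, hC, ctx'⟩ hc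
    simp only [Test.holds, ctx'.ptr_zero, hr, not_lt, Nat.le_zero] at hc
    subst hc
    refine ⟨fun hτ => ?_, hA, hB, by simpa using hC, ctx'⟩
    have h1 := ht hτ
    -- The constant 771 is 3 · 201 + 2 · 84, and 8 K is 2 · 4 K.
    have h2 : rounds n N ≤ Nat.log 2 n + 3 := rounds_le (by omega)
    have h3 : 201 * n * rounds n N ≤ 201 * n * (Nat.log 2 n + 3) := Nat.mul_le_mul_left _ h2
    have h4 : (84 + 4 * K) * (Nat.log 2 n + 1) * N ≤
        (84 + 4 * K) * (Nat.log 2 n + 1) * (2 * n) := Nat.mul_le_mul_left _ (by omega)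
    have h5 : n ≤ n * (Nat.log 2 n + 1) := Nat.le_mul_of_pos_right _ (Nat.succ_pos _)
    nlinarith
  · simp [hr, accArr_self, ctx]

theorem degree_toPoly_lt (n : ℕ) (f : ℕ → D) : (toPoly n f).degree < n := by
  refine (Polynomial.degree_lt_iff_coeff_zero _ _).2 fun k hk => ?_
  rw [toPoly, Polynomial.finsetSum_coeff]
  refine Finset.sum_eq_zero fun i hi => ?_
  rw [Polynomial.coeff_C_mul_X_pow, if_neg]
  have := Finset.mem_range.1 hi
  omega

/-- The coefficients of `C + A * B`, and beyond them the entries of `c`. -/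
noncomputable def mulArr (m n : ℕ) (a b c : ℕ → D) (i : ℕ) : D :=
  if i < m + n - 1 then (toPoly (m + n - 1) c + toPoly m a * toPoly n b).coeff i else c i

/-- No coefficient is lost: if i + j ≥ m + n - 1, then i ≥ m or j ≥ n. -/
theorem toPoly_mulArr (hm : 1 ≤ m) (hn : 1 ≤ n) (a b c : ℕ → D) :
    toPoly (m + n - 1) (mulArr m n a b c) =
      toPoly (m + n - 1) c + toPoly m a * toPoly n b := by
  ext k
  rw [toPoly, Polynomial.finsetSum_coeff]
  simp only [Polynomial.coeff_C_mul_X_pow, Finset.sum_ite_eq, Finset.mem_range]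
  split_ifs with h
  · rw [mulArr, if_pos h]
  · symm
    rw [Polynomial.coeff_add, Polynomial.coeff_eq_zero_of_degree_lt, zero_add,
      Polynomial.coeff_mul]
    · refine Finset.sum_eq_zero fun x hx => ?_
      have := Finset.HasAntidiagonal.mem_antidiagonal.1 hx
      rcases lt_or_ge x.1 m with h1 | h1
      · rw [(Polynomial.degree_lt_iff_coeff_zero _ _).1 (degree_toPoly_lt n b) x.2 (by omega),
          mul_zero]
      · rw [(Polynomial.degree_lt_iff_coeff_zero _ _).1 (degree_toPoly_lt m a) x.1 h1, zero_mul]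
    · refine (degree_toPoly_lt _ _).trans_le ?_
      exact_mod_cast not_lt.1 h

/-- Evaluation at a point is a ring homomorphism. This presents the final contents of `c` as a
transform, as the inverse program requires. -/
theorem accArr_tftArr (hm : 1 ≤ m) (hn : 1 ≤ n) (a b c : ℕ → D) :
    accArr 0 (m + n - 1) (prodVal ω p m n a b) (tftArr ω p (m + n - 1) c) =
      tftArr ω p (m + n - 1) (mulArr m n a b c) := by
  funext i
  by_cases hi : i < m + n - 1
  · simp only [accArr, tftArr, hi, Nat.zero_le, and_self, if_true, prodVal]
    simp only [brTFT]
    rw [toPoly_mulArr hm hn, Polynomial.eval_add, Polynomial.eval_mul]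
  · simp [accArr, tftArr, mulArr, hi]

theorem wp_fftAccu {κ₁ : ℕ} {T₁ : ℕ → ℕ} {P₁ Q₁ : Stmt Unit}
    (h : TimedTransform D DFTSize κ τ T P Q)
    (h₁ : TimedTransform D TFTSize κ₁ τ T₁ P₁ Q₁) {K K₁ : ℕ}
    (hT : ∀ i, 1 ≤ i → T i ≤ K * (i * (Nat.log 2 i + 1)))
    (hT₁ : ∀ i, 1 ≤ i → T₁ i ≤ K₁ * (i * (Nat.log 2 i + 1))) (hσ : MulInput m n σ) :
    WP ((κ + 2 * κ₁ + 4) * n) (lens m n) (fftAccu P Q P₁ Q₁)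
      (fun t σ' => (τ → t ≤ (800 + 8 * K + 8 * K₁) * (n * (Nat.log 2 n + 1))) ∧
        σ'.arr .a = σ.arr .a ∧ σ'.arr .b = σ.arr .b ∧
        σ'.arr .c = mulArr m n (σ.arr .a) (σ.arr .b) (σ.arr .c)) σ := by
  obtain ⟨p, hp, hroot⟩ := hσ.root
  have hm1 := hσ.one_le
  have hmn := hσ.le
  obtain ⟨hp1, hp2⟩ := hp
  have hn2 : n < 2 ^ (Nat.log 2 n + 1) := Nat.lt_pow_succ_log_self (by norm_num) n
  have hpn : p ≤ Nat.log 2 n + 2 := by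
    refine Nat.lt_succ_iff.1 ((Nat.pow_lt_pow_iff_right (by norm_num : 1 < 2)).1 ?_)
    have h3 : 2 ^ (Nat.log 2 n + 2).succ = 4 * 2 ^ (Nat.log 2 n + 1) := by
      rw [pow_succ, pow_succ _ (Nat.log 2 n + 1)]
      ring
    omega
  -- The array `c` has length below 2 n, and the order of the root is below twice that length.
  have hW : (κ + 2 * κ₁ + 4) * n = κ * n + κ₁ * (2 * n) + 4 * n := by ring
  generalize (κ + 2 * κ₁ + 4) * n = W at *
  have hκ₁ : κ₁ * (m + n - 1) ≤ W := by
    have := Nat.mul_le_mul_left κ₁ (by omega : m + n - 1 ≤ 2 * n)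
    omega
  have e1 : 1 ≤ W := by omega
  have e2 : m + n ≤ W := by omega
  have e3 : m + n - 1 ≤ W := by omega
  simp only [fftAccu, wp_block_cons, wp_block_nil, wp_pset, wp_padd, wp_psub]
  refine ⟨Nat.zero_le _, e1, ?_, ?_, e1, ?_⟩
  · simpa [hσ.ptr_m, hσ.ptr_n] using e2
  · simpa [hσ.ptr_m, hσ.ptr_n] using e2.trans (Nat.le_succ _)
  refine wp_for p (fun i t υ => t = 2 * i ∧ υ.arr = σ.arr ∧ υ.alg = σ.alg ∧ υ.ptr pM = m ∧
    υ.ptr pN = n ∧ υ.ptr pOrd = 2 ^ i ∧ υ.ptr pLen = m + n - 1 ∧ υ.ptr pZero = 0 ∧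
    υ.ptr pOne = 1) ?_ ?_ ?_
  · rintro i t υ hi ⟨ht, harr, halg, hM, hN, hO, hL, hz, ho⟩
    have h1 : 2 ^ (i + 1) ≤ 2 ^ p := Nat.pow_le_pow_right (by norm_num) hi
    have h2 := pow_succ 2 i
    have h3 : 2 ^ i < m + n - 1 := by omega
    have h4 : 2 ^ i + 2 ^ i ≤ W := by omega
    simp [hO, hL, hM, hN, hz, ho, h3, h4, harr, halg]
    omega
  · rintro t υ ⟨ht, harr, halg, hM, hN, hO, hL, hz, ho⟩
    have ctx : Context m n p κ W (σ.alg xW) υ := ⟨hm1, hmn, hp1, hroot, by omega, by omega,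
      by omega, hM, hN, hO, hL, hz, ho, by rw [halg]⟩
    refine ⟨by simpa [hO, hL] using hp1, ?_⟩
    refine (h₁.wp_forward (len := lens m n) (A := .c) ⟨hp1, hp2⟩ hroot hL hO ctx.alg_root (by decide) le_rfl
      hκ₁ e3 ctx.pow_le).mono ?_
    rintro t₁ σ₁ ⟨ht₁, harr₁, hptr₁, halg₁⟩
    have ctx₁ := ctx.of_eqBelow (fun q hq => hptr₁ q (by omega)) (halg₁ _ (by decide))
    have ctx₂ := ctx₁.of_eq (σ' := ⟨σ₁.arr, σ₁.alg, Function.update σ₁.ptr pR (σ₁.ptr pLen)⟩)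
      (fun q hq => by fin_cases hq <;> simp) rfl
    simp only [wp_pmov]
    refine ⟨by rw [ctx₁.ptr_len]; exact e3, ?_⟩
    refine (wp_mulLoop h ctx₂ (by simpa using ctx₁.ptr_len) hpn hT).mono ?_
    rintro t₃ σ₃ ⟨ht₃, hA₃, hB₃, hC₃, ctx₃⟩
    refine (h₁.wp_backward (len := lens m n) (A := .c) (f := mulArr m n (σ.arr .a) (σ.arr .b) (σ.arr .c))
      ?_ ⟨hp1, hp2⟩ hroot ctx₃.ptr_len ctx₃.ptr_ord ctx₃.alg_root (by decide) le_rfl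
      hκ₁ e3 ctx.pow_le).mono ?_
    · rw [hC₃, ← accArr_tftArr hm1 (by omega)]
      simp [harr₁, harr]
    rintro t₄ σ₄ ⟨ht₄, harr₄, -, -⟩
    refine ⟨fun hτ => ?_, ?_, ?_, ?_⟩
    · have h1 := ht₁ hτ
      have h3 := ht₃ hτ
      have h4 := ht₄ hτ
      -- The two calls on `c` account for 8 K₁; the difference of 29 between 800 and 771 pays for
      -- the preparations.
      have h5 : T₁ (m + n - 1) ≤ K₁ * (2 * n * (Nat.log 2 n + 2)) := by
        refine (hT₁ _ (by omega)).trans ?_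
        have h6 : Nat.log 2 (m + n - 1) ≤ Nat.log 2 n + 1 := by
          refine Nat.lt_succ_iff.1 (Nat.log_lt_of_lt_pow (by omega) ?_)
          have := pow_succ 2 (Nat.log 2 n + 1)
          show _ < 2 ^ (Nat.log 2 n + 1 + 1)
          omega
        exact Nat.mul_le_mul_left _ (Nat.mul_le_mul (by omega) (by omega))
      have h7 : n ≤ n * (Nat.log 2 n + 1) := Nat.le_mul_of_pos_right _ (Nat.succ_pos _)
      have h8 : Nat.log 2 n ≤ n := Nat.log_le_self 2 n
      have h9 : K₁ * (2 * n * (Nat.log 2 n + 2)) ≤ 4 * K₁ * (n * (Nat.log 2 n + 1)) := by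
        nlinarith [Nat.zero_le (K₁ * n * Nat.log 2 n)]
      have h10 : (800 + 8 * K + 8 * K₁) * (n * (Nat.log 2 n + 1)) =
        (771 + 8 * K) * (n * (Nat.log 2 n + 1)) + 2 * (4 * K₁ * (n * (Nat.log 2 n + 1))) +
          29 * (n * (Nat.log 2 n + 1)) := by ring
      omega
    · simp [harr₄, hA₃, harr₁, harr]
    · simp [harr₄, hB₃, harr₁, harr]
    · simp [harr₄]
  · simp [hσ.ptr_m, hσ.ptr_n]

end

/-! ### Submasks and the annihilating polynomial -/

section BitMasks

/-- All binary digits of `u` occur in `s`. -/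
def SubMask (u s : ℕ) : Prop := ∀ i, u.testBit i = true → s.testBit i = true

theorem subMask_self (s : ℕ) : SubMask s s := fun _ h => h

theorem subMask_zero_left (s : ℕ) : SubMask 0 s := by simp [SubMask]

theorem subMask_iff (u s : ℕ) :
    SubMask u s ↔ u % 2 ≤ s % 2 ∧ SubMask (u / 2) (s / 2) := by
  unfold SubMask
  constructor
  · refine fun h => ⟨?_, fun i => by simpa [Nat.testBit_succ] using h (i + 1)⟩
    have := h 0
    simp only [Nat.testBit_zero, decide_eq_true_eq] at this
    omega
  · rintro ⟨h0, h⟩ (_ | i)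
    · simp only [Nat.testBit_zero, decide_eq_true_eq]
      omega
    · simpa [Nat.testBit_succ] using h i

/-- Because of this, block numbers can be compared through the offsets of the blocks, without a
division. -/
theorem subMask_two_pow_mul (ℓ u s : ℕ) : SubMask (u * 2 ^ ℓ) (s * 2 ^ ℓ) ↔ SubMask u s := by
  induction ℓ with
  | zero => simp
  | succ ℓ ih =>
    rw [subMask_iff, pow_succ, ← mul_assoc, ← mul_assoc, ← ih]
    simp

variable (D : Type*) [CommRing D]

noncomputable instance (u s : ℕ) : Decidable (SubMask u s) := Classical.propDecidable _

/-- The indicator function of `SubMask`. -/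
noncomputable def mask (u s : ℕ) : D := if SubMask u s then 1 else 0

theorem mask_self (s : ℕ) : mask D s s = 1 := if_pos (subMask_self s)

theorem mask_zero_left (s : ℕ) : mask D 0 s = 1 := if_pos (subMask_zero_left s)

theorem mask_eq (u s : ℕ) :
    mask D u s = if s % 2 < u % 2 then 0 else mask D (u / 2) (s / 2) := by
  unfold mask
  by_cases h : s % 2 < u % 2
  · rw [if_pos h, if_neg fun h' => h.not_ge ((subMask_iff u s).1 h').1]
  · rw [if_neg h]
    exact if_congr ((subMask_iff u s).trans (and_iff_right (not_lt.1 h))) rfl rfl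

theorem mask_two_pow_mul (ℓ u s : ℕ) : mask D (u * 2 ^ ℓ) (s * 2 ^ ℓ) = mask D u s :=
  if_congr (subMask_two_pow_mul ℓ u s) rfl rfl

variable {D}

/-- The generating function of the submasks of `s`. -/
noncomputable def maskSum (s : ℕ) (y : D) : D := ∑ u ∈ Finset.range (s + 1), mask D u s * y ^ u

theorem sum_range_two_mul {M : Type*} [AddCommMonoid M] (n : ℕ) (f : ℕ → M) :
    ∑ i ∈ Finset.range (2 * n), f i = ∑ i ∈ Finset.range n, (f (2 * i) + f (2 * i + 1)) := by
  induction n with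
  | zero => rfl
  | succ n ih => rw [mul_add, Finset.sum_range_succ, Finset.sum_range_succ, ih,
      Finset.sum_range_succ, add_assoc]

/-- An even number has even submasks only. Together with the odd case below this amounts to the
factorization into 1 + y^(2^j) over the binary digits j of `s`. -/
theorem maskSum_two_mul (s : ℕ) (y : D) : maskSum (2 * s) y = maskSum s (y ^ 2) := by
  have h0 : ∀ u, mask D (2 * u + 1) (2 * s) = 0 := fun u => by
    rw [mask_eq, if_pos (by omega)]
  have h1 : maskSum (2 * s) y =
      ∑ u ∈ Finset.range (2 * (s + 1)), mask D u (2 * s) * y ^ u := by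
    rw [show 2 * (s + 1) = 2 * s + 1 + 1 by ring, Finset.sum_range_succ, h0, zero_mul, add_zero,
      maskSum]
  rw [h1, sum_range_two_mul, maskSum]
  refine Finset.sum_congr rfl fun u _ => ?_
  rw [h0, mask_eq, if_neg (by omega), Nat.mul_div_cancel_left _ two_pos,
    Nat.mul_div_cancel_left _ two_pos, pow_mul]
  ring

/-- Each submask u of s yields two submasks here, 2u and 2u + 1. -/
theorem maskSum_two_mul_add_one (s : ℕ) (y : D) :
    maskSum (2 * s + 1) y = (1 + y) * maskSum s (y ^ 2) := by
  rw [maskSum, show 2 * s + 1 + 1 = 2 * (s + 1) by ring, sum_range_two_mul, maskSum,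
    Finset.mul_sum]
  refine Finset.sum_congr rfl fun u _ => ?_
  rw [mask_eq, if_neg (by omega), mask_eq D (2 * u + 1), if_neg (by omega),
    show 2 * u / 2 = u by omega, show (2 * u + 1) / 2 = u by omega,
    show (2 * s + 1) / 2 = s by omega, pow_succ, pow_mul]
  ring

theorem maskSum_zero (y : D) : maskSum 0 y = 1 := by simp [maskSum, mask_self]

/-- The value is 2 to the number of binary digits 1 of `s`. -/
theorem isUnit_maskSum_one (h2 : IsUnit (2 : D)) (s : ℕ) : IsUnit (maskSum s (1 : D)) := by
  induction s using Nat.strong_induction_on with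
  | _ s ih =>
    obtain ⟨k, rfl | rfl⟩ := Nat.even_or_odd' s
    · rcases Nat.eq_zero_or_pos k with rfl | hk
      · simp [maskSum_zero]
      · rw [maskSum_two_mul, one_pow]
        exact ih k (by omega)
    · rw [maskSum_two_mul_add_one, one_pow, one_add_one_eq_two]
      exact h2.mul (ih k (by omega))

variable {ω : D} {p : ℕ}

/-- For `p = 0` the number 2 need not be a unit, but then `s = 0`. -/
theorem IsPrincipalRoot.isUnit_maskSum (h : IsPrincipalRoot ω (2 ^ p)) {s : ℕ} (hs : s < 2 ^ p) :
    IsUnit (maskSum s (1 : D)) := by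
  cases p with
  | zero =>
    obtain rfl : s = 0 := by simpa using hs
    simp [maskSum_zero]
  | succ p => exact isUnit_maskSum_one h.isUnit_two s

/-- At the highest digit j where i and s differ, s has the digit 1. The digits above j cancel in [i]
- [s], and those below vanish in the power 2^j, so y^(2^j) = -1 and the factor of digit j is zero.
The induction strips lowest digits, replacing y and ω by their squares. -/
theorem maskSum_eq_zero (h : IsPrincipalRoot ω (2 ^ p)) {s i : ℕ} (hi : i < s) (hs : s < 2 ^ p)
    {y : D} (hy : y * ω ^ bitRev p s = ω ^ bitRev p i) : maskSum s y = 0 := by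
  induction p generalizing ω s i y with
  | zero => simp only [pow_zero] at hs; omega
  | succ p ih =>
    have h' : IsPrincipalRoot (ω ^ 2) (2 ^ p) := by
      simpa using h.pow_two_pow (Nat.le_succ p)
    have hodd : ω ^ 2 ^ p = -1 := h.pow_half
    rw [pow_succ] at hs
    rw [bitRev_succ, bitRev_succ, pow_add, pow_add, pow_mul, pow_mul, hodd] at hy
    rcases lt_or_ge (i / 2) (s / 2) with hlt | hge
    · have hz : maskSum (s / 2) (y ^ 2) = 0 := by
        refine ih h' hlt (by omega) ?_
        have h1 : ∀ k : ℕ, (((-1 : D) ^ k) ^ 2) = 1 := fun k => by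
          rw [← pow_mul, mul_comm, pow_mul]; simp
        have h2 := congrArg (· ^ 2) hy
        simp only [mul_pow, h1, one_mul] at h2
        rw [← pow_mul, ← pow_mul, mul_comm 2, mul_comm 2, pow_mul, pow_mul]
        exact h2
      obtain ⟨k, rfl | rfl⟩ := Nat.even_or_odd' s
      · rw [maskSum_two_mul]
        rwa [Nat.mul_div_cancel_left _ two_pos] at hz
      · rw [maskSum_two_mul_add_one]
        rw [show (2 * k + 1) / 2 = k by omega] at hz
        rw [hz, mul_zero]
    -- The two indices differ in the lowest digit only, so y = -1 and the factor 1 + y vanishes.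
    · obtain ⟨k, rfl⟩ : ∃ k, s = 2 * k + 1 := ⟨s / 2, by omega⟩
      obtain rfl : i = 2 * k := by omega
      rw [show (2 * k + 1) % 2 = 1 by omega, show (2 * k + 1) / 2 = k by omega,
        show 2 * k % 2 = 0 by omega, Nat.mul_div_cancel_left _ two_pos] at hy
      have hu : IsUnit (ω ^ bitRev p k) := h.isUnit_root.pow _
      have : (1 + y) * ω ^ bitRev p k = 0 := by linear_combination -hy
      rw [maskSum_two_mul_add_one, hu.mul_left_eq_zero.1 this, zero_mul]

end BitMasks

/-! ### Splitting off the last block -/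

section Blocks

variable {D : Type*} [CommRing D]

theorem sum_range_mul_eq (S L : ℕ) (f : ℕ → D) :
    ∑ q ∈ Finset.range (S * L), f q =
      ∑ u ∈ Finset.range S, ∑ j ∈ Finset.range L, f (u * L + j) := by
  induction S with
  | zero => simp
  | succ S ih => rw [Nat.succ_mul, Finset.sum_range_add, ih, Finset.sum_range_succ]

/-- Add `w` times the block of length `L` at `e` to the block at `d`. -/
def axpyArr (d e L : ℕ) (w : D) (f : ℕ → D) (q : ℕ) : D :=
  if d ≤ q ∧ q < d + L then f q + w * f (e + (q - d)) else f q

/-- To the first `k` blocks of length `L`, add `c` times the block number `S`, where the block number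
`u` is skipped unless it is a submask of `S`. -/
noncomputable def reduceArr (c : D) (S L k : ℕ) (f : ℕ → D) (q : ℕ) : D :=
  if q < k * L then f q + c * mask D (q / L) S * f (S * L + q % L) else f q

/-- Add `c` times the first `k` blocks of length `L` to the block number `S`. -/
def collectArr (c : D) (S L k : ℕ) (f : ℕ → D) (q : ℕ) : D :=
  if S * L ≤ q ∧ q < S * L + L then
    f q + c * ∑ u ∈ Finset.range k, f (u * L + (q - S * L)) else f q

variable {c : D} {S L k : ℕ} {f : ℕ → D}

theorem reduceArr_zero : reduceArr c S L 0 f = f := by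
  funext q
  simp [reduceArr]

theorem reduceArr_succ (hk : k < S) : reduceArr c S L (k + 1) f =
    axpyArr (k * L) (S * L) L (c * mask D k S) (reduceArr c S L k f) := by
  funext q
  have hS : k * L + L ≤ S * L := by rw [← Nat.succ_mul]; exact Nat.mul_le_mul_right _ hk
  by_cases h : k * L ≤ q ∧ q < k * L + L
  · obtain ⟨j, rfl⟩ := Nat.exists_eq_add_of_le h.1
    have hj : j < L := by omega
    rw [axpyArr, if_pos h, reduceArr, if_pos (by rw [Nat.succ_mul]; omega), reduceArr,
      if_neg (by omega), reduceArr, if_neg (by omega), Nat.add_sub_cancel_left,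
      Nat.add_comm (k * L), Nat.add_mul_mod_self_right, Nat.mod_eq_of_lt hj,
      Nat.add_mul_div_right _ _ (by omega), Nat.div_eq_of_lt hj, zero_add]
  · rw [axpyArr, if_neg h, reduceArr, reduceArr, Nat.succ_mul]
    by_cases h' : q < k * L
    · rw [if_pos h', if_pos (by omega)]
    · rw [if_neg h', if_neg (by omega)]

/-- The block that is added lies outside the blocks that are changed. -/
theorem reduceArr_reduceArr : reduceArr (-c) S L S (reduceArr c S L S f) = f := by
  funext q
  by_cases h : q < S * L
  · rw [reduceArr, if_pos h, reduceArr, if_pos h, reduceArr, if_neg (by omega)]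
    ring
  · rw [reduceArr, if_neg h, reduceArr, if_neg h]

theorem collectArr_zero : collectArr c S L 0 f = f := by
  funext q
  simp [collectArr]

theorem collectArr_succ (hk : k < S) : collectArr c S L (k + 1) f =
    axpyArr (S * L) (k * L) L c (collectArr c S L k f) := by
  funext q
  have hS : k * L + L ≤ S * L := by rw [← Nat.succ_mul]; exact Nat.mul_le_mul_right _ hk
  by_cases h : S * L ≤ q ∧ q < S * L + L
  · rw [axpyArr, if_pos h, collectArr, if_pos h, collectArr, if_pos h, collectArr,
      if_neg (by omega), Finset.sum_range_succ]
    ring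
  · rw [axpyArr, if_neg h, collectArr, if_neg h, collectArr, if_neg h]

theorem collectArr_collectArr : collectArr (-c) S L S (collectArr c S L S f) = f := by
  funext q
  by_cases h : S * L ≤ q ∧ q < S * L + L
  · have : ∀ u ∈ Finset.range S, collectArr c S L S f (u * L + (q - S * L)) =
        f (u * L + (q - S * L)) := fun u hu => by
      have hS : u * L + L ≤ S * L := by
        rw [← Nat.succ_mul]; exact Nat.mul_le_mul_right _ (Finset.mem_range.1 hu)
      rw [collectArr, if_neg (by omega)]
    rw [collectArr, if_pos h, Finset.sum_congr rfl this, collectArr, if_pos h]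
    ring
  · rw [collectArr, if_neg h, collectArr, if_neg h]

/-- Adding a multiple of a block to itself multiplies it by 1 + v. -/
theorem axpyArr_axpyArr_self {d : ℕ} {v w : D} (h : (1 + v) * (1 + w) = 1) :
    axpyArr d d L w (axpyArr d d L v f) = f := by
  funext q
  by_cases hq : d ≤ q ∧ q < d + L
  · simp only [axpyArr, if_pos hq, Nat.add_sub_cancel' hq.1]
    linear_combination f q * h
  · simp only [axpyArr, if_neg hq]

/-- Reduce `S + 1` blocks of length `L` modulo the annihilator of the points of the first `S` blocks,
and modulo the annihilator of the points of the last block. -/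
noncomputable def splitArr (S L : ℕ) (f : ℕ → D) : ℕ → D :=
  collectArr 1 S L S (axpyArr (S * L) (S * L) L (∑ u ∈ Finset.range S, mask D u S)
    (reduceArr (-1) S L S f))

theorem splitArr_of_lt {u j : ℕ} (hu : u < S) (hj : j < L) :
    splitArr S L f (u * L + j) = f (u * L + j) - mask D u S * f (S * L + j) := by
  have hS : u * L + L ≤ S * L := by rw [← Nat.succ_mul]; exact Nat.mul_le_mul_right _ hu
  rw [splitArr, collectArr, if_neg (by omega), axpyArr, if_neg (by omega), reduceArr,
    if_pos (by omega), Nat.add_comm (u * L), Nat.add_mul_mod_self_right, Nat.mod_eq_of_lt hj,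
    Nat.add_mul_div_right _ _ (by omega), Nat.div_eq_of_lt hj, zero_add]
  ring

theorem splitArr_of_ge {q : ℕ} (hq : S * L + L ≤ q) : splitArr S L f q = f q := by
  rw [splitArr, collectArr, if_neg (by omega), axpyArr, if_neg (by omega), reduceArr,
    if_neg (by omega)]

/-- The lower blocks have already lost their multiples of the last one. Multiplying the last block
by M(1) makes up for the loss, and then the reduced blocks can be added. -/
theorem splitArr_top {j : ℕ} (hj : j < L) :
    splitArr S L f (S * L + j) = ∑ u ∈ Finset.range (S + 1), f (u * L + j) := by
  have h : ∀ u ∈ Finset.range S, axpyArr (S * L) (S * L) L (∑ u ∈ Finset.range S, mask D u S)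
      (reduceArr (-1) S L S f) (u * L + j) = f (u * L + j) - mask D u S * f (S * L + j) := by
    intro u hu
    have hS : u * L + L ≤ S * L := by
      rw [← Nat.succ_mul]; exact Nat.mul_le_mul_right _ (Finset.mem_range.1 hu)
    rw [axpyArr, if_neg (by omega), reduceArr,
      if_pos (by omega), Nat.add_comm (u * L), Nat.add_mul_mod_self_right, Nat.mod_eq_of_lt hj,
      Nat.add_mul_div_right _ _ (by omega), Nat.div_eq_of_lt hj, zero_add]
    ring
  rw [splitArr, collectArr, if_pos (by omega), Nat.add_sub_cancel_left, Finset.sum_congr rfl h,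
    axpyArr, if_pos (by omega), Nat.add_sub_cancel_left, reduceArr, if_neg (by omega),
    Finset.sum_sub_distrib, ← Finset.sum_mul, Finset.sum_range_succ]
  ring

/-- The new lower blocks are the remainder modulo the monic polynomial M(X^L), with the old last
block as quotient. -/
theorem sum_splitArr {y : D} (hy : maskSum S (y ^ L) = 0) :
    ∑ q ∈ Finset.range (S * L), splitArr S L f q * y ^ q =
      ∑ q ∈ Finset.range ((S + 1) * L), f q * y ^ q := by
  rw [sum_range_mul_eq, sum_range_mul_eq, Finset.sum_range_succ]
  rw [maskSum, Finset.sum_range_succ, mask_self, one_mul] at hy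
  have h1 : ∀ u ∈ Finset.range S, ∑ j ∈ Finset.range L,
      splitArr S L f (u * L + j) * y ^ (u * L + j) =
      ∑ j ∈ Finset.range L, f (u * L + j) * y ^ (u * L + j) -
        mask D u S * (y ^ L) ^ u * ∑ j ∈ Finset.range L, f (S * L + j) * y ^ j := by
    intro u hu
    rw [Finset.mul_sum, ← Finset.sum_sub_distrib]
    refine Finset.sum_congr rfl fun j hj => ?_
    rw [splitArr_of_lt (Finset.mem_range.1 hu) (Finset.mem_range.1 hj), pow_add, mul_comm u,
      pow_mul]
    ring
  have h2 : ∑ j ∈ Finset.range L, f (S * L + j) * y ^ (S * L + j) =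
      (y ^ L) ^ S * ∑ j ∈ Finset.range L, f (S * L + j) * y ^ j := by
    rw [Finset.mul_sum]
    refine Finset.sum_congr rfl fun j _ => ?_
    rw [pow_add, mul_comm S, pow_mul]
    ring
  rw [Finset.sum_congr rfl h1, Finset.sum_sub_distrib, ← Finset.sum_mul, h2]
  linear_combination (-∑ j ∈ Finset.range L, f (S * L + j) * y ^ j) * hy

theorem sum_splitArr_top {y : D} (hy : y ^ L = 1) :
    ∑ j ∈ Finset.range L, splitArr S L f (S * L + j) * y ^ j =
      ∑ q ∈ Finset.range ((S + 1) * L), f q * y ^ q := by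
  rw [sum_range_mul_eq, Finset.sum_comm]
  refine Finset.sum_congr rfl fun j hj => ?_
  rw [splitArr_top (Finset.mem_range.1 hj), Finset.sum_mul]
  refine Finset.sum_congr rfl fun u _ => ?_
  rw [pow_add, mul_comm u, pow_mul, hy, one_pow, one_mul]

end Blocks

/-! ### Moving a block to the front -/

section Swap

variable {D : Type*}

/-- Exchange the block of length `L` at `s` with the first block. -/
def swapArr (s L : ℕ) (f : ℕ → D) (q : ℕ) : D :=
  if q < L then f (s + q) else if s ≤ q ∧ q < s + L then f (q - s) else f q

theorem swapArr_swapArr {s L : ℕ} (hs : s = 0 ∨ L ≤ s) (f : ℕ → D) :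
    swapArr s L (swapArr s L f) = f := by
  funext q
  unfold swapArr
  split_ifs <;> first | omega | (congr 1 <;> omega)

end Swap

/-! ### The truncated transform, level by level -/

section

variable {D : Type*} [CommRing D] {ω : D} {p ℓ S n : ℕ} {f : ℕ → D}

theorem mul_eq_zero_or_le (S L : ℕ) : S * L = 0 ∨ L ≤ S * L := by
  rcases Nat.eq_zero_or_pos S with rfl | h
  · exact .inl (zero_mul L)
  · exact .inr (Nat.le_mul_of_pos_left L h)

/-- A transform program acts on a prefix of its array, so a later block is exchanged with the first
one before and after the call. -/
theorem swapArr_tftArr_swapArr {s L : ℕ} (hs : s = 0 ∨ L ≤ s) (h : ℕ → D) (q : ℕ) :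
    swapArr s L (tftArr ω ℓ L (swapArr s L h)) q =
      if s ≤ q ∧ q < s + L then brTFT ω ℓ L (fun j => h (s + j)) (q - s) else h q := by
  have hb : ∀ i, brTFT ω ℓ L (swapArr s L h) i = brTFT ω ℓ L (fun j => h (s + j)) i :=
    fun i => brTFT_congr (fun j hj => by rw [swapArr, if_pos hj]) i
  rw [swapArr]
  split_ifs with h1 h2 h3
  · obtain rfl : s = 0 := by omega
    rw [tftArr, if_pos (by omega), Nat.zero_add, Nat.sub_zero]
    exact hb q
  · rw [tftArr, if_neg (by omega), swapArr, if_neg (by omega), if_pos (by omega),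
      Nat.add_sub_cancel_left]
  · rw [tftArr, if_pos (by omega)]
    exact hb _
  · rw [tftArr, if_neg (by omega), swapArr, if_neg (by omega), if_neg (by omega)]

/-- Split off and transform the last one of `S + 1` blocks of length `2 ^ ℓ`. -/
noncomputable def stepArr (ω : D) (p ℓ S : ℕ) (f : ℕ → D) : ℕ → D :=
  scaleArr (S * 2 ^ ℓ) (Ring.inverse (ω ^ bitRev p (S * 2 ^ ℓ)))
    (swapArr (S * 2 ^ ℓ) (2 ^ ℓ) (tftArr (ω ^ 2 ^ (p - ℓ)) ℓ (2 ^ ℓ)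
      (swapArr (S * 2 ^ ℓ) (2 ^ ℓ) (splitArr S (2 ^ ℓ)
        (scaleArr ((S + 1) * 2 ^ ℓ) (ω ^ bitRev p (S * 2 ^ ℓ)) f)))))

theorem stepArr_of_ge {i : ℕ} (hi : (S + 1) * 2 ^ ℓ ≤ i) : stepArr ω p ℓ S f i = f i := by
  have := Nat.two_pow_pos ℓ
  rw [Nat.succ_mul] at hi
  rw [stepArr, scaleArr, if_neg (by omega), swapArr_tftArr_swapArr (mul_eq_zero_or_le _ _),
    if_neg (by omega), splitArr_of_ge hi, scaleArr, if_neg (by rw [Nat.succ_mul]; omega)]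

/-- The last block undergoes a partial transform: scaling, reduction modulo X^L - 1, DFT. The final
scaling back concerns the other blocks only. -/
theorem stepArr_top (h : IsPrincipalRoot ω (2 ^ p)) (hℓ : ℓ ≤ p) {j : ℕ} (hj : j < 2 ^ ℓ) :
    stepArr ω p ℓ S f (S * 2 ^ ℓ + j) =
      ∑ q ∈ Finset.range ((S + 1) * 2 ^ ℓ), f q * (ω ^ bitRev p (S * 2 ^ ℓ + j)) ^ q := by
  rw [stepArr, scaleArr, if_neg (by omega), swapArr_tftArr_swapArr (mul_eq_zero_or_le _ _),
    if_pos (by omega), Nat.add_sub_cancel_left, brTFT_eq_sum,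
    sum_splitArr_top (bitRev_pow_pow h hℓ j), sum_scaleArr,
    pow_bitRev_add hℓ (Dvd.intro_left _ rfl) hj]

theorem sum_stepArr (h : IsPrincipalRoot ω (2 ^ p)) (hS : (S + 1) * 2 ^ ℓ ≤ 2 ^ p) {i : ℕ}
    (hi : i < S * 2 ^ ℓ) :
    ∑ q ∈ Finset.range (S * 2 ^ ℓ), stepArr ω p ℓ S f q * (ω ^ bitRev p i) ^ q =
      ∑ q ∈ Finset.range ((S + 1) * 2 ^ ℓ), f q * (ω ^ bitRev p i) ^ q := by
  have hL := Nat.two_pow_pos ℓ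
  have hℓ : ℓ ≤ p := (Nat.pow_le_pow_iff_right (by norm_num : 1 < 2)).1
    ((Nat.le_mul_of_pos_left _ (Nat.succ_pos S)).trans hS)
  have hu : IsUnit (ω ^ bitRev p (S * 2 ^ ℓ)) := h.isUnit_root.pow _
  have hcancel := Ring.mul_inverse_cancel _ hu
  -- In the power 2^ℓ, the digits of i below ℓ disappear. What remains concerns the block numbers i
  -- / 2^ℓ < S and the root ω^(2^ℓ), of order 2^(p-ℓ).
  have hy : maskSum S ((Ring.inverse (ω ^ bitRev p (S * 2 ^ ℓ)) * ω ^ bitRev p i) ^ 2 ^ ℓ) = 0 := by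
    have hdiv : 2 ^ ℓ * (i / 2 ^ ℓ) + i % 2 ^ ℓ = i := Nat.div_add_mod i (2 ^ ℓ)
    have hroot : IsPrincipalRoot (ω ^ 2 ^ ℓ) (2 ^ (p - ℓ)) := by
      have := h.pow_two_pow (Nat.sub_le p ℓ)
      rwa [Nat.sub_sub_self hℓ] at this
    have hSp : S < 2 ^ (p - ℓ) := by
      refine lt_of_mul_lt_mul_right (a := 2 ^ ℓ) ?_ (Nat.zero_le _)
      rw [← pow_add, Nat.sub_add_cancel hℓ]
      exact lt_of_lt_of_le (by rw [Nat.succ_mul]; omega) hS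
    have hiS : i / 2 ^ ℓ < S := (Nat.div_lt_iff_lt_mul hL).2 hi
    refine maskSum_eq_zero hroot hiS hSp ?_
    have h1 : ω ^ bitRev p i = ω ^ bitRev (p - ℓ) (i / 2 ^ ℓ) *
        (ω ^ 2 ^ (p - ℓ)) ^ bitRev ℓ (i % 2 ^ ℓ) := by
      conv_lhs => rw [← hdiv]
      rw [bitRev_two_pow_mul_add hℓ _ (Nat.mod_lt _ hL), pow_add, pow_mul]
    have h2 : bitRev p (S * 2 ^ ℓ) = bitRev (p - ℓ) S := by rw [mul_comm, bitRev_two_pow_mul hℓ]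
    rw [h2] at hcancel ⊢
    rw [mul_pow, h1, mul_pow, bitRev_pow_pow h hℓ, mul_one, pow_right_comm ω (2 ^ ℓ),
      pow_right_comm ω (2 ^ ℓ), mul_right_comm, ← mul_pow, mul_comm (Ring.inverse _), hcancel,
      one_pow, one_mul]
  have h3 : ∀ q ∈ Finset.range (S * 2 ^ ℓ),
      swapArr (S * 2 ^ ℓ) (2 ^ ℓ) (tftArr (ω ^ 2 ^ (p - ℓ)) ℓ (2 ^ ℓ)
      (swapArr (S * 2 ^ ℓ) (2 ^ ℓ) (splitArr S (2 ^ ℓ)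
        (scaleArr ((S + 1) * 2 ^ ℓ) (ω ^ bitRev p (S * 2 ^ ℓ)) f)))) q *
        (Ring.inverse (ω ^ bitRev p (S * 2 ^ ℓ)) * ω ^ bitRev p i) ^ q =
      splitArr S (2 ^ ℓ)
        (scaleArr ((S + 1) * 2 ^ ℓ) (ω ^ bitRev p (S * 2 ^ ℓ)) f) q *
        (Ring.inverse (ω ^ bitRev p (S * 2 ^ ℓ)) * ω ^ bitRev p i) ^ q := fun q hq => by
    have := Finset.mem_range.1 hq
    rw [swapArr_tftArr_swapArr (mul_eq_zero_or_le _ _), if_neg (by omega)]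
  rw [stepArr, sum_scaleArr, Finset.sum_congr rfl h3, sum_splitArr hy, sum_scaleArr, ← mul_assoc,
    hcancel, one_mul]

/-- The contents of the array after the binary digits of `n` below `k` have been processed. -/
noncomputable def levelArr (ω : D) (p n : ℕ) (f : ℕ → D) : ℕ → ℕ → D
  | 0 => f
  | k + 1 =>
    if n.testBit k then stepArr ω p k (2 * (n / 2 ^ (k + 1))) (levelArr ω p n f k)
    else levelArr ω p n f k

theorem div_two_pow_eq (n k : ℕ) :
    n / 2 ^ k = 2 * (n / 2 ^ (k + 1)) + if n.testBit k then 1 else 0 := by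
  have h1 : n / 2 ^ (k + 1) = n / 2 ^ k / 2 := by rw [pow_succ, Nat.div_div_eq_div_mul]
  have h2 : n.testBit k = decide (n / 2 ^ k % 2 = 1) := by
    rw [Nat.testBit_eq_decide_div_mod_eq]
  rw [h1, h2]
  by_cases h : n / 2 ^ k % 2 = 1 <;> simp [h] <;> omega

/-- Beyond the prefix of full blocks the array is final; the prefix holds a polynomial with the
right values at the points of the prefix. If digit k of n is 1, the number of blocks is odd, and
splitting off the last one leaves an even number, to be paired into blocks of twice the length. -/
theorem levelArr_spec (h : IsPrincipalRoot ω (2 ^ p)) (hn : n ≤ 2 ^ p) (f : ℕ → D) (k : ℕ) :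
    (∀ i < n / 2 ^ k * 2 ^ k, ∑ q ∈ Finset.range (n / 2 ^ k * 2 ^ k),
      levelArr ω p n f k q * (ω ^ bitRev p i) ^ q = brTFT ω p n f i) ∧
    (∀ i, n / 2 ^ k * 2 ^ k ≤ i → levelArr ω p n f k i = tftArr ω p n f i) := by
  induction k with
  | zero =>
    refine ⟨fun i _ => ?_, fun i hi => ?_⟩
    · rw [brTFT_eq_sum]
      simp [levelArr]
    · simp only [pow_zero, Nat.div_one, mul_one] at hi
      rw [levelArr, tftArr, if_neg (by omega)]
  | succ k ih =>
    have h1 := div_two_pow_eq n k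
    have h2 : n / 2 ^ (k + 1) * 2 ^ (k + 1) = 2 * (n / 2 ^ (k + 1)) * 2 ^ k := by ring
    rw [h2, levelArr]
    split_ifs at h1 ⊢ with hb
    · have hle : n / 2 ^ k * 2 ^ k ≤ n := Nat.div_mul_le_self n _
      rw [h1] at ih hle
      generalize 2 * (n / 2 ^ (k + 1)) = S at *
      have hk : k ≤ p := (Nat.pow_le_pow_iff_right (by norm_num : 1 < 2)).1
        ((Nat.le_mul_of_pos_left _ (Nat.succ_pos S)).trans (hle.trans hn))
      refine ⟨fun i hi => ?_, fun i hi => ?_⟩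
      · rw [sum_stepArr h (hle.trans hn) hi]
        exact ih.1 i (hi.trans_le (Nat.mul_le_mul_right _ (Nat.le_succ S)))
      · rcases lt_or_ge i ((S + 1) * 2 ^ k) with hi' | hi'
        · obtain ⟨j, rfl⟩ := Nat.exists_eq_add_of_le hi
          have hj : j < 2 ^ k := by rw [Nat.succ_mul] at hi'; omega
          rw [stepArr_top h hk hj, ih.1 _ hi', tftArr, if_pos (by omega)]
        · rw [stepArr_of_ge hi']
          exact ih.2 i hi'
    · rw [add_zero] at h1
      rwa [h1] at ih

theorem levelArr_eq_tftArr (h : IsPrincipalRoot ω (2 ^ p)) (hn : n ≤ 2 ^ p) (f : ℕ → D) {k : ℕ}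
    (hk : n < 2 ^ k) : levelArr ω p n f k = tftArr ω p n f := by
  funext i
  refine (levelArr_spec h hn f k).2 i ?_
  rw [Nat.div_eq_of_lt hk, zero_mul]
  exact Nat.zero_le i

end

/-! ### Programs for the truncated transform -/

/-- Weight of a block operation. -/
abbrev xWt : ℕ := 6
/-- Number of blocks that are counted by `countProg`. -/
abbrev xCnt : ℕ := 7
/-- Coefficient of `reduceProg` and `collectProg`. -/
abbrev xCoef : ℕ := 8

/-- `f_{d+j} ← f_{d+j} + xWt * f_{e+j}` for `j < L`, with `d`, `e`, `L` in `pd`, `pe`, `pLa`. -/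
def axpyProg (pd pe : ℕ) : Stmt Unit :=
  block [
    .op (.pset pI 0),
    .loop (.lt pI pLa) (block [
      .op (.padd pJ pe pI),
      .op (.load xY () pJ),
      .op (.mul xY xWt xY),
      .op (.padd pJ pd pI),
      .op (.load xX () pJ),
      .op (.add xX xX xY),
      .op (.store () pJ xX),
      .op (.padd pI pI pOne)])]

/-- `xWt ← 1` if the binary digits of `pOffA` occur in `pOff`, and `xWt ← 0` otherwise. -/
def maskProg : Stmt Unit :=
  block [
    .op (.one xWt),
    .op (.pmov pI pOffA),
    .op (.pmov pJ pOff),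
    .loop (.le pOne pI) (block [
      .op (.phalf pH pI),
      .op (.phalf pK pJ),
      .op (.psub pI pI pH),
      .op (.psub pI pI pH),
      .op (.psub pJ pJ pK),
      .op (.psub pJ pJ pK),
      .ite (.lt pJ pI) (.op (.zero xWt)) .skip,
      .op (.pmov pI pH),
      .op (.pmov pJ pK)])]

/-- `reduceArr`, with the coefficient in `xCoef`. -/
def reduceProg : Stmt Unit :=
  block [
    .op (.pset pOffA 0),
    .loop (.lt pOffA pOff) (block [
      maskProg,
      .op (.mul xWt xCoef xWt),
      axpyProg pOffA pOff,
      .op (.padd pOffA pOffA pLa)])]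

/-- `xCnt ←` the number of blocks before `pOff` that `reduceProg` changes. -/
def countProg : Stmt Unit :=
  block [
    .op (.zero xCnt),
    .op (.pset pOffA 0),
    .loop (.lt pOffA pOff) (block [
      maskProg,
      .op (.add xCnt xCnt xWt),
      .op (.padd pOffA pOffA pLa)])]

/-- `collectArr`, with the coefficient in `xCoef`. -/
def collectProg : Stmt Unit :=
  block [
    .op (.mov xWt xCoef),
    .op (.pset pOffA 0),
    .loop (.lt pOffA pOff) (block [
      axpyProg pOff pOffA,
      .op (.padd pOffA pOffA pLa)])]

/-- Exchange the block at `pOff` with the first block. -/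
def swapProg : Stmt Unit :=
  block [
    .op (.pset pI 0),
    .loop (.lt pI pLa) (block [
      .op (.padd pJ pOff pI),
      .op (.load xX () pI),
      .op (.load xY () pJ),
      .op (.store () pI xY),
      .op (.store () pJ xX),
      .op (.padd pI pI pOne)])]

/-! ### Block operations on the machine -/

section

variable {D : Type*}

theorem swapArr_zero (s : ℕ) (f : ℕ → D) : swapArr s 0 f = f := by
  funext q
  rw [swapArr, if_neg (by omega), if_neg (by omega)]

theorem swapArr_succ {s i : ℕ} (hs : s = 0 ∨ i + 1 ≤ s) (f : ℕ → D) :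
    swapArr s (i + 1) f = Function.update (Function.update (swapArr s i f) i (f (s + i)))
      (s + i) (f i) := by
  funext q
  rcases eq_or_ne q (s + i) with rfl | h
  · rw [Function.update_self, swapArr]
    split_ifs <;> first | omega | (congr 1; omega)
  · rw [Function.update_of_ne h]
    rcases eq_or_ne q i with rfl | h'
    · rw [Function.update_self, swapArr, if_pos (by omega)]
    · rw [Function.update_of_ne h', swapArr, swapArr]
      split_ifs <;> first | rfl | omega

end

section

variable {D : Type*} [CommRing D] {W n : ℕ} {σ : State D Unit}

theorem axpyArr_zero (d e : ℕ) (w : D) (f : ℕ → D) : axpyArr d e 0 w f = f := by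
  funext q
  exact if_neg (by omega)

theorem axpyArr_succ (d e i : ℕ) (w : D) (f : ℕ → D) :
    axpyArr d e (i + 1) w f =
      Function.update (axpyArr d e i w f) (d + i) (f (d + i) + w * f (e + i)) := by
  funext q
  rcases eq_or_ne q (d + i) with rfl | h
  · rw [axpyArr, if_pos (by omega), Function.update_self, Nat.add_sub_cancel_left]
  · rw [Function.update_of_ne h, axpyArr, axpyArr]
    exact if_congr (by omega) rfl rfl

/-- As the blocks are equal or disjoint (`hde`), no store disturbs a later load. -/
theorem wp_axpyProg {pd pe d e L : ℕ} (hpd : pd < 12) (hpe : pe < 12) (hOne : σ.ptr pOne = 1)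
    (hd : σ.ptr pd = d) (he : σ.ptr pe = e) (hL : σ.ptr pLa = L)
    (hde : d = e ∨ d + L ≤ e ∨ e + L ≤ d) (hdn : d + L ≤ n) (hen : e + L ≤ n) (hW : n ≤ W) :
    WP W (fun _ => n) (axpyProg pd pe) (fun t σ' => t ≤ 9 * L + 2 ∧
      σ'.arr () = axpyArr d e L (σ.alg xWt) (σ.arr ()) ∧ EqBelow 12 σ'.ptr σ.ptr ∧
      EqOff [xX, xY] σ'.alg σ.alg) σ := by
  simp [axpyProg]
  refine wp_for L (fun i t τ => t = 9 * i ∧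
      τ.arr () = axpyArr d e i (σ.alg xWt) (σ.arr ()) ∧ EqBelow 12 τ.ptr σ.ptr ∧
      EqOff [xX, xY] τ.alg σ.alg ∧ τ.ptr pI = i) ?_ ?_ ?_
  · rintro i t τ hi ⟨ht, harr, hptr, halg, hI⟩
    have h11 := (hptr 11 (by norm_num)).trans hOne
    have hd' := (hptr pd hpd).trans hd
    have he' := (hptr pe hpe).trans he
    have hL' := (hptr 7 (by norm_num)).trans hL
    have hw := halg 6 (by simp)
    have e1 : pd ≠ 13 := by omega
    have e2 : d + i < n := by omega
    have e3 : e + i < n := by omega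
    have e4 : d + i ≤ W := by omega
    have e5 : e + i ≤ W := by omega
    have e6 : i + 1 ≤ W := by omega
    simp [h11, hd', he', hL', hI, hi, e1, e2, e3, e4, e5, e6, hw, harr, hptr, halg]
    refine ⟨by omega, ?_⟩
    rw [axpyArr_succ, axpyArr, if_neg (by omega), axpyArr, if_neg (by omega)]
  · rintro t τ ⟨ht, harr, hptr, halg, hI⟩
    have hL' := (hptr 7 (by norm_num)).trans hL
    simp [hL', hI, harr, hptr, halg]
    omega
  · simp [axpyArr_zero]

theorem wp_maskProg {k : ℕ} (hOne : σ.ptr pOne = 1) (hk : σ.ptr pOffA < 2 ^ k)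
    (hA : σ.ptr pOffA ≤ W) (hO : σ.ptr pOff ≤ W) :
    WP W (fun _ => n) maskProg (fun t σ' => t ≤ 11 * k + 4 ∧ σ'.arr () = σ.arr () ∧
      EqBelow 12 σ'.ptr σ.ptr ∧ EqOff [xWt] σ'.alg σ.alg ∧
      σ'.alg xWt = mask D (σ.ptr pOffA) (σ.ptr pOff)) σ := by
  simp [maskProg, hA, hO]
  refine wp_loop (fun e t τ => t + 11 * e ≤ 11 * k ∧ τ.arr () = σ.arr () ∧
      EqBelow 12 τ.ptr σ.ptr ∧ EqOff [xWt] τ.alg σ.alg ∧ τ.ptr pI < 2 ^ e ∧ τ.ptr pI ≤ W ∧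
      τ.ptr pJ ≤ W ∧ τ.alg xWt * mask D (τ.ptr pI) (τ.ptr pJ) =
        mask D (σ.ptr pOffA) (σ.ptr pOff)) ?_ ?_ (k := k) ?_
  · rintro e t τ ⟨ht, harr, hptr, halg, hlt, hI, hJ, hV⟩ hc
    have h11 := (hptr 11 (by norm_num)).trans hOne
    simp [h11] at hc
    obtain ⟨e, rfl⟩ : ∃ e', e = e' + 1 := by
      refine ⟨e - 1, ?_⟩
      rcases e with _ | e
      · simp_all
      · omega
    rw [pow_succ] at hlt
    have e1 : τ.ptr pI / 2 ≤ W := by omega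
    have e2 : τ.ptr pJ / 2 ≤ W := by omega
    have e3 : τ.ptr pI ≤ W + τ.ptr pI / 2 := by omega
    have e4 : τ.ptr pJ ≤ W + τ.ptr pJ / 2 := by omega
    -- Parity is obtained by subtracting the half twice.
    have e5 : τ.ptr pI - τ.ptr pI / 2 - τ.ptr pI / 2 = τ.ptr pI % 2 := by omega
    have e6 : τ.ptr pJ - τ.ptr pJ / 2 - τ.ptr pJ / 2 = τ.ptr pJ % 2 := by omega
    have e7 : τ.ptr pI ≤ W + τ.ptr pI / 2 + τ.ptr pI / 2 := by omega
    have e8 : τ.ptr pJ ≤ W + τ.ptr pJ / 2 + τ.ptr pJ / 2 := by omega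
    rw [mask_eq] at hV
    simp [e1, e2, e3, e4, e5, e6, e7, e8, harr, hptr, halg]
    refine ⟨fun hlt' => ⟨e, le_rfl, by omega, by omega, ?_⟩,
      fun hle => ⟨e, le_rfl, by omega, by omega, ?_⟩⟩
    · rw [if_pos hlt', mul_zero] at hV
      exact hV
    · rw [if_neg (by omega)] at hV
      exact hV
  · rintro e t τ ⟨ht, harr, hptr, halg, hlt, hI, hJ, hV⟩ hc
    have h11 := (hptr 11 (by norm_num)).trans hOne
    simp [h11] at hc
    rw [hc, mask_zero_left, mul_one] at hV
    exact ⟨by omega, harr, hptr, halg, hV⟩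
  · simp [hk, hA, hO]

variable {S ℓ p : ℕ}

theorem wp_reduceProg (hOne : σ.ptr pOne = 1) (hs : σ.ptr pOff = S * 2 ^ ℓ)
    (hL : σ.ptr pLa = 2 ^ ℓ) (hSn : (S + 1) * 2 ^ ℓ ≤ n) (hn : n ≤ 2 ^ p) (hW : n ≤ W) :
    WP W (fun _ => n) reduceProg (fun t σ' => t ≤ S * (11 * p + 9 * 2 ^ ℓ + 9) + 2 ∧
      σ'.arr () = reduceArr (σ.alg xCoef) S (2 ^ ℓ) S (σ.arr ()) ∧
      (∀ q < 12, q ≠ pOffA → σ'.ptr q = σ.ptr q) ∧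
      EqOff [xX, xY, xWt] σ'.alg σ.alg) σ := by
  rw [Nat.succ_mul] at hSn
  have hpos := Nat.two_pow_pos ℓ
  simp [reduceProg]
  refine wp_for S (fun i t τ => t ≤ i * (11 * p + 9 * 2 ^ ℓ + 9) ∧
      τ.arr () = reduceArr (σ.alg xCoef) S (2 ^ ℓ) i (σ.arr ()) ∧
      (∀ q < 12, q ≠ pOffA → τ.ptr q = σ.ptr q) ∧ τ.ptr pOffA = i * 2 ^ ℓ ∧
      EqOff [xX, xY, xWt] τ.alg σ.alg) ?_ ?_ ?_
  · rintro i t τ hi ⟨ht, harr, hptr, hA, halg⟩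
    have hiS : i * 2 ^ ℓ + 2 ^ ℓ ≤ S * 2 ^ ℓ := by
      rw [← Nat.succ_mul]; exact Nat.mul_le_mul_right _ hi
    have h5 := (hptr pOff (by decide) (by decide)).trans hs
    have h7 := (hptr pLa (by decide) (by decide)).trans hL
    have h11 := (hptr pOne (by decide) (by decide)).trans hOne
    refine ⟨by simp only [Test.holds, hA, h5]; omega, ?_⟩
    simp only [wp_block_cons, wp_block_nil]
    refine (wp_maskProg (k := p) h11 (by omega) (by omega) (by omega)).mono ?_
    rintro t₁ σ₁ ⟨ht₁, harr₁, hptr₁, halg₁, hw₁⟩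
    -- The registers hold offsets, whose mask is that of the block numbers.
    rw [hA, h5, mask_two_pow_mul] at hw₁
    have hA₁ := (hptr₁ pOffA (by decide)).trans hA
    have h5₁ := (hptr₁ pOff (by decide)).trans h5
    have h7₁ := (hptr₁ pLa (by decide)).trans h7
    have h11₁ := (hptr₁ pOne (by decide)).trans h11
    have hc₁ : σ₁.alg xCoef = σ.alg xCoef := (halg₁ _ (by simp)).trans (halg _ (by simp))
    simp only [wp_mul]
    refine (wp_axpyProg (σ := ⟨σ₁.arr, Function.update σ₁.alg xWt (σ₁.alg xCoef * σ₁.alg xWt),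
      σ₁.ptr⟩) (by decide) (by decide) h11₁ hA₁ h5₁ h7₁ (by omega) (by omega) (by omega)
      hW).mono ?_
    rintro t₂ σ₂ ⟨ht₂, harr₂, hptr₂, halg₂⟩
    have hA₂ := (hptr₂ pOffA (by decide)).trans hA₁
    have h7₂ := (hptr₂ pLa (by decide)).trans h7₁
    simp only [wp_padd, hA₂, h7₂]
    refine ⟨by omega, by rw [Nat.succ_mul]; omega, ?_, fun q hq hq' => ?_, ?_, ?_⟩
    · rw [harr₂]
      simp only [Function.update_self, hw₁, hc₁, harr₁, harr]
      rw [reduceArr_succ hi]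
    · simp only [ne_eq, hq', not_false_eq_true, Function.update_of_ne]
      exact (hptr₂ q hq).trans ((hptr₁ q hq).trans (hptr q hq hq'))
    · simp [Nat.succ_mul]
    · refine (halg₂.mono (by simp)).trans ?_
      simp only [eqOff_update (show xWt ∈ [xX, xY, xWt] by simp)]
      exact (halg₁.mono (by simp)).trans halg
  · rintro t τ ⟨ht, harr, hptr, hA, halg⟩
    have h5 := (hptr pOff (by decide) (by decide)).trans hs
    refine ⟨by simp only [Test.holds, hA, h5]; omega, by omega, harr, hptr, halg⟩
  · simp [reduceArr_zero]
    intro q _ hq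
    simp [hq]

theorem wp_countProg (hOne : σ.ptr pOne = 1) (hs : σ.ptr pOff = S * 2 ^ ℓ)
    (hL : σ.ptr pLa = 2 ^ ℓ) (hSn : (S + 1) * 2 ^ ℓ ≤ n) (hn : n ≤ 2 ^ p) (hW : n ≤ W) :
    WP W (fun _ => n) countProg (fun t σ' => t ≤ S * (11 * p + 7) + 3 ∧
      σ'.arr () = σ.arr () ∧ (∀ q < 12, q ≠ pOffA → σ'.ptr q = σ.ptr q) ∧
      EqOff [xCnt, xWt] σ'.alg σ.alg ∧
      σ'.alg xCnt = ∑ u ∈ Finset.range S, mask D u S) σ := by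
  rw [Nat.succ_mul] at hSn
  have hpos := Nat.two_pow_pos ℓ
  simp [countProg]
  refine wp_for S (fun i t τ => t ≤ i * (11 * p + 7) ∧ τ.arr () = σ.arr () ∧
      (∀ q < 12, q ≠ pOffA → τ.ptr q = σ.ptr q) ∧ τ.ptr pOffA = i * 2 ^ ℓ ∧
      EqOff [xCnt, xWt] τ.alg σ.alg ∧ τ.alg xCnt = ∑ u ∈ Finset.range i, mask D u S) ?_ ?_ ?_
  · rintro i t τ hi ⟨ht, harr, hptr, hA, halg, hcnt⟩
    have hiS : i * 2 ^ ℓ + 2 ^ ℓ ≤ S * 2 ^ ℓ := by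
      rw [← Nat.succ_mul]; exact Nat.mul_le_mul_right _ hi
    have h5 := (hptr pOff (by decide) (by decide)).trans hs
    have h7 := (hptr pLa (by decide) (by decide)).trans hL
    have h11 := (hptr pOne (by decide) (by decide)).trans hOne
    refine ⟨by simp only [Test.holds, hA, h5]; omega, ?_⟩
    simp only [wp_block_cons, wp_block_nil]
    refine (wp_maskProg (k := p) h11 (by omega) (by omega) (by omega)).mono ?_
    rintro t₁ σ₁ ⟨ht₁, harr₁, hptr₁, halg₁, hw₁⟩
    rw [hA, h5, mask_two_pow_mul] at hw₁
    have hA₁ := (hptr₁ pOffA (by decide)).trans hA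
    have h7₁ := (hptr₁ pLa (by decide)).trans h7
    simp only [wp_add, wp_padd, hA₁, h7₁]
    refine ⟨by omega, by rw [Nat.succ_mul]; omega, harr₁.trans harr, fun q hq hq' => ?_, ?_, ?_, ?_⟩
    · simp only [ne_eq, hq', not_false_eq_true, Function.update_of_ne]
      exact (hptr₁ q hq).trans (hptr q hq hq')
    · simp [Nat.succ_mul]
    · simp only [eqOff_update (show xCnt ∈ [xCnt, xWt] by simp)]
      exact (halg₁.mono (by simp)).trans halg
    · rw [Function.update_self, Finset.sum_range_succ, hw₁, halg₁ xCnt (by simp), hcnt]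
  · rintro t τ ⟨ht, harr, hptr, hA, halg, hcnt⟩
    have h5 := (hptr pOff (by decide) (by decide)).trans hs
    refine ⟨by simp only [Test.holds, hA, h5]; omega, by omega, harr, hptr, halg, hcnt⟩
  · simp
    intro q _ hq
    simp [hq]

theorem wp_collectProg {L : ℕ} (hpos : 0 < L) (hOne : σ.ptr pOne = 1) (hs : σ.ptr pOff = S * L)
    (hL : σ.ptr pLa = L) (hSn : (S + 1) * L ≤ n) (hW : n ≤ W) :
    WP W (fun _ => n) collectProg (fun t σ' => t ≤ S * (9 * L + 4) + 3 ∧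
      σ'.arr () = collectArr (σ.alg xCoef) S L S (σ.arr ()) ∧
      (∀ q < 12, q ≠ pOffA → σ'.ptr q = σ.ptr q) ∧
      EqOff [xX, xY, xWt] σ'.alg σ.alg) σ := by
  rw [Nat.succ_mul] at hSn
  simp [collectProg]
  refine wp_for S (fun i t τ => t ≤ i * (9 * L + 4) ∧
      τ.arr () = collectArr (σ.alg xCoef) S L i (σ.arr ()) ∧
      (∀ q < 12, q ≠ pOffA → τ.ptr q = σ.ptr q) ∧ τ.ptr pOffA = i * L ∧
      EqOff [xX, xY, xWt] τ.alg σ.alg ∧ τ.alg xWt = σ.alg xCoef) ?_ ?_ ?_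
  · rintro i t τ hi ⟨ht, harr, hptr, hA, halg, hw⟩
    have hiS : i * L + L ≤ S * L := by
      rw [← Nat.succ_mul]; exact Nat.mul_le_mul_right _ hi
    have h5 := (hptr pOff (by decide) (by decide)).trans hs
    have h7 := (hptr pLa (by decide) (by decide)).trans hL
    have h11 := (hptr pOne (by decide) (by decide)).trans hOne
    refine ⟨by simp only [Test.holds, hA, h5]; omega, ?_⟩
    simp only [wp_block_cons, wp_block_nil]
    refine (wp_axpyProg (by decide) (by decide) h11 h5 hA h7 (by omega) (by omega) (by omega)
      hW).mono ?_
    rintro t₂ σ₂ ⟨ht₂, harr₂, hptr₂, halg₂⟩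
    have hA₂ := (hptr₂ pOffA (by decide)).trans hA
    have h7₂ := (hptr₂ pLa (by decide)).trans h7
    simp only [wp_padd, hA₂, h7₂]
    refine ⟨by omega, by rw [Nat.succ_mul]; omega, ?_, fun q hq hq' => ?_, ?_, ?_, ?_⟩
    · rw [harr₂, hw, harr, collectArr_succ hi]
    · simp only [ne_eq, hq', not_false_eq_true, Function.update_of_ne]
      exact (hptr₂ q hq).trans (hptr q hq hq')
    · simp [Nat.succ_mul]
    · exact (halg₂.mono (by simp)).trans halg
    · exact (halg₂ xWt (by simp)).trans hw
  · rintro t τ ⟨ht, harr, hptr, hA, halg, hw⟩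
    have h5 := (hptr pOff (by decide) (by decide)).trans hs
    refine ⟨by simp only [Test.holds, hA, h5]; omega, by omega, harr, hptr, halg⟩
  · simp [collectArr_zero]
    intro q _ hq
    simp [hq]

theorem wp_swapProg {s L : ℕ} (hOne : σ.ptr pOne = 1) (hs : σ.ptr pOff = s)
    (hL : σ.ptr pLa = L) (hsL : s = 0 ∨ L ≤ s) (hn : s + L ≤ n) (hW : n ≤ W) :
    WP W (fun _ => n) swapProg (fun t σ' => t ≤ 7 * L + 2 ∧
      σ'.arr () = swapArr s L (σ.arr ()) ∧ EqBelow 12 σ'.ptr σ.ptr ∧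
      EqOff [xX, xY] σ'.alg σ.alg) σ := by
  simp [swapProg]
  refine wp_for L (fun i t τ => t = 7 * i ∧
      τ.arr () = swapArr s i (σ.arr ()) ∧ EqBelow 12 τ.ptr σ.ptr ∧
      EqOff [xX, xY] τ.alg σ.alg ∧ τ.ptr pI = i) ?_ ?_ ?_
  · rintro i t τ hi ⟨ht, harr, hptr, halg, hI⟩
    have h11 := (hptr 11 (by norm_num)).trans hOne
    have hs' := (hptr 5 (by norm_num)).trans hs
    have hL' := (hptr 7 (by norm_num)).trans hL
    have e2 : s + i < n := by omega
    have e3 : i < n := by omega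
    have e4 : s + i ≤ W := by omega
    have e6 : i + 1 ≤ W := by omega
    simp [h11, hs', hL', hI, hi, e2, e3, e4, e6, harr, hptr, halg]
    refine ⟨by omega, ?_⟩
    rw [swapArr_succ (by omega)]
    congr 2
    · rw [swapArr]
      split_ifs <;> first | rfl | omega
    · rw [swapArr]
      split_ifs <;> first | rfl | omega
  · rintro t τ ⟨ht, harr, hptr, halg, hI⟩
    have hL' := (hptr 7 (by norm_num)).trans hL
    simp [hL', hI, harr, hptr, halg]
    omega
  · simp [swapArr_zero]

end

/-- `splitArr`. -/
def splitProg : Stmt Unit :=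
  block [
    countProg,
    .op (.zero xCoef),
    .op (.one xX),
    .op (.sub xCoef xCoef xX),
    reduceProg,
    .op (.mov xWt xCnt),
    axpyProg pOff pOff,
    .op (.one xCoef),
    collectProg]

/-- The inverse of `splitArr`. -/
def unsplitProg : Stmt Unit :=
  block [
    .op (.zero xCoef),
    .op (.one xX),
    .op (.sub xCoef xCoef xX),
    collectProg,
    countProg,
    .op (.one xX),
    .op (.add xCnt xX xCnt),
    .op (.inv xCnt xCnt),
    .op (.sub xCnt xCnt xX),
    .op (.mov xWt xCnt),
    axpyProg pOff pOff,
    .op (.one xCoef),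
    reduceProg]

/-- Run a transform on the block of length `pLa` at `pOff`. -/
def blockCallProg (P : Stmt Unit) : Stmt Unit :=
  block [swapProg, rootProg pLa, callProg P () pLa pLa xG, swapProg]

/-- Scale the first entries, the number of which is in `pl`, by the powers of `ω ^ [pOff]_p`. -/
def twistScaleProg (pl : ℕ) : Stmt Unit := block [twistProg pOff, scaleProg () pl]

/-- The inverse of `twistScaleProg`. -/
def untwistScaleProg (pl : ℕ) : Stmt Unit :=
  block [twistProg pOff, .op (.inv xTwist xTwist), scaleProg () pl]

/-- `stepArr`. -/
def stepProg (dft : Stmt Unit) : Stmt Unit :=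
  block [twistScaleProg pLb, splitProg, blockCallProg dft, untwistScaleProg pOff]

/-- The inverse of `stepArr`. -/
def unstepProg (idft : Stmt Unit) : Stmt Unit :=
  block [twistScaleProg pOff, blockCallProg idft, unsplitProg, untwistScaleProg pLb]

/-! ### One block step and its inverse -/

section

variable {D : Type*} {σ σ' σ'' : State D Unit}

/-- Two states agree in the registers that control the transform. -/
structure Agree (σ' σ : State D Unit) : Prop where
  ptr : ∀ q < 12, q ≠ pOffA → σ'.ptr q = σ.ptr q
  root : σ'.alg xW = σ.alg xW

theorem Agree.trans (h' : Agree σ'' σ') (h : Agree σ' σ) : Agree σ'' σ :=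
  ⟨fun q hq hq' => (h'.ptr q hq hq').trans (h.ptr q hq hq'), h'.root.trans h.root⟩

theorem Agree.of_eqBelow (hptr : EqBelow 12 σ'.ptr σ.ptr) (halg : σ'.alg xW = σ.alg xW) :
    Agree σ' σ := ⟨fun q hq _ => hptr q hq, halg⟩

end

section

variable {D : Type*} [CommRing D] {W n p κ ℓ S : ℕ} {ω : D} {σ σ' : State D Unit}
  {τ : Prop} {T : ℕ → ℕ} {P Q : Stmt Unit}

/-- What the programs for a block rely on. -/
structure BlockContext (n p W ℓ S : ℕ) (ω : D) (σ : State D Unit) : Prop where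
  root : IsPrincipalRoot ω (2 ^ p)
  le_pow : n ≤ 2 ^ p
  pow_le : 2 ^ p ≤ W
  le : (S + 1) * 2 ^ ℓ ≤ n
  ptr_one : σ.ptr pOne = 1
  ptr_ord : σ.ptr pOrd = 2 ^ p
  ptr_off : σ.ptr pOff = S * 2 ^ ℓ
  ptr_end : σ.ptr pLb = (S + 1) * 2 ^ ℓ
  ptr_la : σ.ptr pLa = 2 ^ ℓ
  alg_root : σ.alg xW = ω

theorem BlockContext.of_agree (ctx : BlockContext n p W ℓ S ω σ) (h : Agree σ' σ) :
    BlockContext n p W ℓ S ω σ' :=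
  { ctx with
    ptr_one := (h.ptr _ (by decide) (by decide)).trans ctx.ptr_one
    ptr_ord := (h.ptr _ (by decide) (by decide)).trans ctx.ptr_ord
    ptr_off := (h.ptr _ (by decide) (by decide)).trans ctx.ptr_off
    ptr_end := (h.ptr _ (by decide) (by decide)).trans ctx.ptr_end
    ptr_la := (h.ptr _ (by decide) (by decide)).trans ctx.ptr_la
    alg_root := h.root.trans ctx.alg_root }

theorem BlockContext.off_add_le (ctx : BlockContext n p W ℓ S ω σ) :
    S * 2 ^ ℓ + 2 ^ ℓ ≤ n := by
  rw [← Nat.succ_mul]; exact ctx.le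

theorem wp_twistScaleProg {pl : ℕ} (ctx : BlockContext n p W ℓ S ω σ) (hpl : pl < 12)
    (hn : σ.ptr pl ≤ n) :
    WP W (fun _ => n) (twistScaleProg pl) (fun t σ' => t ≤ 6 * p + 6 * n + 8 ∧
      σ'.arr () = scaleArr (σ.ptr pl) (ω ^ bitRev p (S * 2 ^ ℓ)) (σ.arr ()) ∧ Agree σ' σ) σ := by
  have hle := ctx.off_add_le
  have hlp := ctx.le_pow
  have hpos := Nat.two_pow_pos ℓ
  have hW := ctx.pow_le
  simp only [twistScaleProg, wp_block_cons, wp_block_nil]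
  refine (wp_twistProg ctx.ptr_one ctx.ptr_ord (by rw [ctx.ptr_off]; omega) ctx.pow_le).mono ?_
  rintro t₁ σ₁ ⟨ht₁, harr₁, hptr₁, halg₁, hx₁⟩
  have hpl₁ := hptr₁ pl hpl
  refine (wp_scaleProg (A := ()) hpl ((hptr₁ pOne (by decide)).trans ctx.ptr_one)
    (hpl₁ ▸ hn) (by omega)).mono ?_
  rintro t₂ σ₂ ⟨ht₂, harr₂, hptr₂, halg₂⟩
  refine ⟨by omega, ?_, .of_eqBelow (hptr₂.trans hptr₁)
    ((halg₂ _ (by simp)).trans (halg₁ _ (by simp)))⟩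
  rw [harr₂, Function.update_self, hpl₁, hx₁, harr₁, ctx.ptr_off, ctx.alg_root]

theorem wp_untwistScaleProg {pl : ℕ} (ctx : BlockContext n p W ℓ S ω σ) (hpl : pl < 12)
    (hn : σ.ptr pl ≤ n) :
    WP W (fun _ => n) (untwistScaleProg pl) (fun t σ' => t ≤ 6 * p + 6 * n + 9 ∧
      σ'.arr () = scaleArr (σ.ptr pl) (Ring.inverse (ω ^ bitRev p (S * 2 ^ ℓ))) (σ.arr ()) ∧
      Agree σ' σ) σ := by
  have hle := ctx.off_add_le
  have hlp := ctx.le_pow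
  have hpos := Nat.two_pow_pos ℓ
  have hW := ctx.pow_le
  simp only [untwistScaleProg, wp_block_cons, wp_block_nil]
  refine (wp_twistProg ctx.ptr_one ctx.ptr_ord (by rw [ctx.ptr_off]; omega) ctx.pow_le).mono ?_
  rintro t₁ σ₁ ⟨ht₁, harr₁, hptr₁, halg₁, hx₁⟩
  have hpl₁ := hptr₁ pl hpl
  rw [ctx.ptr_off, ctx.alg_root] at hx₁
  simp only [wp_inv]
  refine ⟨hx₁ ▸ ctx.root.isUnit_root.pow _, ?_⟩
  refine (wp_scaleProg (A := ())
    (σ := ⟨σ₁.arr, Function.update σ₁.alg xTwist (Ring.inverse (σ₁.alg xTwist)), σ₁.ptr⟩)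
    hpl ((hptr₁ pOne (by decide)).trans ctx.ptr_one) (hpl₁ ▸ hn) (by simp only; omega)).mono ?_
  rintro t₂ σ₂ ⟨ht₂, harr₂, hptr₂, halg₂⟩
  dsimp only at ht₂
  refine ⟨by omega, ?_, .of_eqBelow (hptr₂.trans hptr₁) ((halg₂ _ (by simp)).trans ?_)⟩
  · simp only [harr₂, Function.update_self, hpl₁, hx₁, harr₁]
  · simp only [ne_eq, Function.update_of_ne, show xW ≠ xTwist by decide, not_false_eq_true]
    exact halg₁ _ (by simp)

theorem wp_splitProg (ctx : BlockContext n p W ℓ S ω σ) :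
    WP W (fun _ => n) splitProg (fun t σ' => t ≤ S * (22 * p + 20) + 18 * n + 15 ∧
      σ'.arr () = splitArr S (2 ^ ℓ) (σ.arr ()) ∧ Agree σ' σ) σ := by
  have hle := ctx.off_add_le
  have hnW := ctx.le_pow.trans ctx.pow_le
  simp only [splitProg, wp_block_cons, wp_block_nil]
  refine (wp_countProg ctx.ptr_one ctx.ptr_off ctx.ptr_la ctx.le ctx.le_pow hnW).mono ?_
  rintro t₁ σ₁ ⟨ht₁, harr₁, hptr₁, halg₁, hc₁⟩
  have ctx₁ := ctx.of_agree ⟨hptr₁, halg₁ _ (by simp)⟩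
  simp only [wp_zero, wp_one, wp_sub]
  refine (wp_reduceProg (σ := ⟨σ₁.arr, _, σ₁.ptr⟩) (by exact ctx₁.ptr_one) (by exact
    ctx₁.ptr_off) (by exact ctx₁.ptr_la) ctx.le ctx.le_pow hnW).mono ?_
  rintro t₂ σ₂ ⟨ht₂, harr₂, hptr₂, halg₂⟩
  have ctx₂ := ctx₁.of_agree (σ' := σ₂) ⟨hptr₂, (halg₂ _ (by simp)).trans (by simp)⟩
  have hc₂ := (halg₂ xCnt (by simp)).trans (by simpa using hc₁)
  simp only [wp_mov]
  refine (wp_axpyProg (σ := ⟨σ₂.arr, _, σ₂.ptr⟩) (by decide) (by decide) (by exact ctx₂.ptr_one)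
    (by exact ctx₂.ptr_off) (by exact ctx₂.ptr_off) (by exact ctx₂.ptr_la) (.inl rfl) hle hle
    hnW).mono ?_
  rintro t₃ σ₃ ⟨ht₃, harr₃, hptr₃, halg₃⟩
  have ctx₃ := ctx₂.of_agree (σ' := σ₃) (.of_eqBelow hptr₃ ((halg₃ _ (by simp)).trans (by simp)))
  refine (wp_collectProg (σ := ⟨σ₃.arr, _, σ₃.ptr⟩) (Nat.two_pow_pos ℓ) (by exact ctx₃.ptr_one)
    (by exact ctx₃.ptr_off) (by exact ctx₃.ptr_la) ctx.le hnW).mono ?_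
  rintro t₄ σ₄ ⟨ht₄, harr₄, hptr₄, halg₄⟩
  refine ⟨?_, ?_, ⟨fun q hq hq' => ?_, ?_⟩⟩
  -- The expansions isolate `S * 2 ^ ℓ`, which together with the last block is bounded by `n`.
  · have e1 : S * (11 * p + 9 * 2 ^ ℓ + 9) = S * (11 * p) + 9 * (S * 2 ^ ℓ) + S * 9 := by ring
    have e2 : S * (9 * 2 ^ ℓ + 4) = 9 * (S * 2 ^ ℓ) + S * 4 := by ring
    have e3 : S * (11 * p + 7) = S * (11 * p) + S * 7 := by ring
    have e4 : S * (22 * p + 20) = 2 * (S * (11 * p)) + S * 20 := by ring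
    omega
  · simp only [harr₄, harr₃, harr₂, harr₁, Function.update_self, hc₂, splitArr]
    simp
  · exact (hptr₄ q hq hq').trans ((hptr₃ q hq).trans ((hptr₂ q hq hq').trans (hptr₁ q hq hq')))
  · refine (halg₄ _ (by simp)).trans ?_
    simp only [ne_eq, Function.update_of_ne, show xW ≠ xCoef by decide, not_false_eq_true]
    rw [ctx₃.alg_root, ctx.alg_root]

theorem wp_unsplitProg {f : ℕ → D} (ctx : BlockContext n p W ℓ S ω σ)
    (hf : σ.arr () = splitArr S (2 ^ ℓ) f) :
    WP W (fun _ => n) unsplitProg (fun t σ' => t ≤ S * (22 * p + 20) + 18 * n + 19 ∧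
      σ'.arr () = f ∧ Agree σ' σ) σ := by
  have hle := ctx.off_add_le
  have hpos := Nat.two_pow_pos ℓ
  have hlp := ctx.le_pow
  have hnW := ctx.le_pow.trans ctx.pow_le
  simp only [unsplitProg, wp_block_cons, wp_block_nil, wp_zero, wp_one, wp_sub]
  refine (wp_collectProg (σ := ⟨σ.arr, _, σ.ptr⟩) (Nat.two_pow_pos ℓ) (by exact ctx.ptr_one) (by
    exact ctx.ptr_off) (by exact ctx.ptr_la) ctx.le hnW).mono ?_
  rintro t₁ σ₁ ⟨ht₁, harr₁, hptr₁, halg₁⟩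
  have ctx₁ := ctx.of_agree (σ' := σ₁) ⟨hptr₁, (halg₁ _ (by simp)).trans (by simp)⟩
  refine (wp_countProg ctx₁.ptr_one ctx₁.ptr_off ctx₁.ptr_la ctx.le ctx.le_pow hnW).mono ?_
  rintro t₂ σ₂ ⟨ht₂, harr₂, hptr₂, halg₂, hc₂⟩
  have ctx₂ := ctx₁.of_agree (σ' := σ₂) ⟨hptr₂, halg₂ _ (by simp)⟩
  -- The factor of the last block is M(1), so it can be inverted. The program recomputes it, since
  -- nothing is stored between the transform and its inverse.
  have hsum : 1 + ∑ u ∈ Finset.range S, mask D u S = maskSum S 1 := by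
    simp [maskSum, Finset.sum_range_succ, mask_self, add_comm]
  have hS : S < 2 ^ p := by
    have : S ≤ S * 2 ^ ℓ := Nat.le_mul_of_pos_right _ hpos
    omega
  have hu : IsUnit (1 + ∑ u ∈ Finset.range S, mask D u S) := hsum ▸ ctx.root.isUnit_maskSum hS
  simp only [wp_add, wp_inv, wp_mov]
  refine ⟨by simpa [hc₂] using hu, ?_⟩
  refine (wp_axpyProg (σ := ⟨σ₂.arr, _, σ₂.ptr⟩) (by decide) (by decide) (by exact ctx₂.ptr_one)
    (by exact ctx₂.ptr_off) (by exact ctx₂.ptr_off) (by exact ctx₂.ptr_la) (.inl rfl) hle hle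
    hnW).mono ?_
  rintro t₃ σ₃ ⟨ht₃, harr₃, hptr₃, halg₃⟩
  have ctx₃ := ctx₂.of_agree (σ' := σ₃) (.of_eqBelow hptr₃ ((halg₃ _ (by simp)).trans (by simp)))
  refine (wp_reduceProg (σ := ⟨σ₃.arr, _, σ₃.ptr⟩) (by exact ctx₃.ptr_one) (by exact
    ctx₃.ptr_off) (by exact ctx₃.ptr_la) ctx.le ctx.le_pow hnW).mono ?_
  rintro t₄ σ₄ ⟨ht₄, harr₄, hptr₄, halg₄⟩
  refine ⟨?_, ?_, ⟨fun q hq hq' => ?_, ?_⟩⟩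
  · have e1 : S * (11 * p + 9 * 2 ^ ℓ + 9) = S * (11 * p) + 9 * (S * 2 ^ ℓ) + S * 9 := by ring
    have e2 : S * (9 * 2 ^ ℓ + 4) = 9 * (S * 2 ^ ℓ) + S * 4 := by ring
    have e3 : S * (11 * p + 7) = S * (11 * p) + S * 7 := by ring
    have e4 : S * (22 * p + 20) = 2 * (S * (11 * p)) + S * 20 := by ring
    omega
  · simp only [harr₄, harr₃, harr₂, harr₁, Function.update_self, hf, splitArr, ne_eq,
      Function.update_of_ne, show xX ≠ xCnt by decide, show xCoef ≠ xX by decide,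
      show xCnt ≠ xX by decide, not_false_eq_true, hc₂]
    rw [zero_sub, collectArr_collectArr, axpyArr_axpyArr_self]
    -- The coefficient 1 is the negative of the coefficient -1 that was used in the forward
    -- direction.
    · nth_rw 1 [← neg_neg (1 : D)]
      exact reduceArr_reduceArr ..
    · rw [add_sub_cancel, Ring.mul_inverse_cancel _ hu]
  · exact (hptr₄ q hq hq').trans ((hptr₃ q hq).trans ((hptr₂ q hq hq').trans (hptr₁ q hq hq')))
  · refine (halg₄ _ (by simp)).trans ?_
    simp only [ne_eq, Function.update_of_ne, show xW ≠ xCoef by decide, not_false_eq_true]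
    rw [ctx₃.alg_root, ctx.alg_root]

/-- The subroutine enters only through its specification `hP`, so the DFT and its inverse are
covered alike. -/
theorem wp_blockCallProg {f : ℕ → D} {c : ℕ}
    (ctx : BlockContext n p W ℓ S ω σ)
    (hP : ∀ υ : State D Unit, υ.ptr pLa = 2 ^ ℓ →
      υ.alg xG = ω ^ 2 ^ (p - ℓ) → υ.arr () = swapArr (S * 2 ^ ℓ) (2 ^ ℓ) (σ.arr ()) →
      WP W (fun _ => n) (callProg P () pLa pLa xG) (fun t υ' => (τ → t ≤ c + 3) ∧
        υ'.arr = Function.update υ.arr () f ∧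
        EqBelow 16 υ'.ptr υ.ptr ∧ EqBelow 16 υ'.alg υ.alg) υ) :
    WP W (fun _ => n) (blockCallProg P) (fun t σ' => (τ → t ≤ 3 * p + 14 * n + 10 + c) ∧
      σ'.arr () = swapArr (S * 2 ^ ℓ) (2 ^ ℓ) f ∧ Agree σ' σ) σ := by
  have hle := ctx.off_add_le
  have hlp := ctx.le_pow
  have hW := ctx.pow_le
  have hℓp : ℓ ≤ p := (Nat.pow_le_pow_iff_right (by norm_num : 1 < 2)).1 (by omega)
  simp only [blockCallProg, wp_block_cons, wp_block_nil]
  refine (wp_swapProg ctx.ptr_one ctx.ptr_off ctx.ptr_la (mul_eq_zero_or_le _ _) hle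
    (by omega)).mono ?_
  rintro t₁ σ₁ ⟨ht₁, harr₁, hptr₁, halg₁⟩
  have ctx₁ := ctx.of_agree (.of_eqBelow hptr₁ (halg₁ _ (by simp)))
  refine (wp_rootProg hℓp ctx₁.ptr_la ctx₁.ptr_ord ctx.pow_le).mono ?_
  rintro t₂ σ₂ ⟨ht₂, harr₂, hptr₂, halg₂, hx₂⟩
  have ctx₂ := ctx₁.of_agree (.of_eqBelow hptr₂ (halg₂ _ (by simp)))
  refine (hP σ₂ ctx₂.ptr_la (by rw [hx₂, ctx₁.alg_root]) (by rw [harr₂, harr₁])).mono ?_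
  rintro t₃ σ₃ ⟨ht₃, harr₃, hptr₃, halg₃⟩
  have ctx₃ := ctx₂.of_agree (σ' := σ₃) (.of_eqBelow (fun q hq => hptr₃ q (by omega))
    (halg₃ _ (by decide)))
  refine (wp_swapProg ctx₃.ptr_one ctx₃.ptr_off ctx₃.ptr_la (mul_eq_zero_or_le _ _) hle
    (by omega)).mono ?_
  rintro t₄ σ₄ ⟨ht₄, harr₄, hptr₄, halg₄⟩
  refine ⟨fun hτ => ?_, ?_, ⟨fun q hq _ => ?_, ?_⟩⟩
  · have := ht₃ hτ
    omega
  · rw [harr₄, harr₃, Function.update_self]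
  · exact (hptr₄ q hq).trans ((hptr₃ q (by omega)).trans ((hptr₂ q hq).trans (hptr₁ q hq)))
  · exact (halg₄ _ (by simp)).trans ((halg₃ _ (by decide)).trans
      ((halg₂ _ (by simp)).trans (halg₁ _ (by simp))))

theorem wp_stepProg (h : TimedTransform D DFTSize κ τ T P Q)
    (ctx : BlockContext n p W ℓ S ω σ) (hκ : κ * n ≤ W) :
    WP W (fun _ => n) (stepProg P)
      (fun t σ' => (τ → t ≤ S * (22 * p + 20) + 15 * p + 44 * n + 46 + T (2 ^ ℓ)) ∧
        σ'.arr () = stepArr ω p ℓ S (σ.arr ()) ∧ Agree σ' σ) σ := by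
  have hle := ctx.off_add_le
  have hlp := ctx.le_pow
  have hpos := Nat.two_pow_pos ℓ
  have hW := ctx.pow_le
  have hℓp : ℓ ≤ p := (Nat.pow_le_pow_iff_right (by norm_num : 1 < 2)).1 (by omega)
  simp only [stepProg, wp_block_cons, wp_block_nil]
  refine (wp_twistScaleProg ctx (by decide) (by rw [ctx.ptr_end]; exact ctx.le)).mono ?_
  rintro t₁ σ₁ ⟨ht₁, harr₁, hag₁⟩
  rw [ctx.ptr_end] at harr₁
  have ctx₁ := ctx.of_agree hag₁
  refine (wp_splitProg ctx₁).mono ?_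
  rintro t₂ σ₂ ⟨ht₂, harr₂, hag₂⟩
  have ctx₂ := ctx₁.of_agree hag₂
  refine (wp_blockCallProg (τ := τ) (c := T (2 ^ ℓ)) (f := tftArr (ω ^ 2 ^ (p - ℓ)) ℓ (2 ^ ℓ)
    (swapArr (S * 2 ^ ℓ) (2 ^ ℓ) (σ₂.arr ()))) ctx₂
    fun υ hL hG harr => ?_).mono ?_
  · have := h.wp_forward (σ := υ) (A := ()) (W := W) (len := fun _ => n) (xr := xG)
      (p := ℓ) (n := 2 ^ ℓ) rfl (ctx.root.pow_two_pow hℓp) hL hL hG (by decide) (by omega)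
      ((Nat.mul_le_mul_left κ (by omega)).trans hκ) (by omega) (by omega)
    rwa [harr] at this
  rintro t₃ σ₃ ⟨ht₃, harr₃, hag₃⟩
  have ctx₃ := ctx₂.of_agree hag₃
  refine (wp_untwistScaleProg ctx₃ (pl := pOff) (by decide)
    (by rw [ctx₃.ptr_off]; omega)).mono ?_
  rintro t₄ σ₄ ⟨ht₄, harr₄, hag₄⟩
  refine ⟨fun hτ => ?_, ?_, hag₄.trans (hag₃.trans (hag₂.trans hag₁))⟩
  · have := ht₃ hτ
    omega
  · rw [harr₄, ctx₃.ptr_off, harr₃, harr₂, harr₁, stepArr]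

theorem wp_unstepProg {f : ℕ → D} (h : TimedTransform D DFTSize κ τ T P Q)
    (ctx : BlockContext n p W ℓ S ω σ) (hκ : κ * n ≤ W)
    (hf : σ.arr () = stepArr ω p ℓ S f) :
    WP W (fun _ => n) (unstepProg Q)
      (fun t σ' => (τ → t ≤ S * (22 * p + 20) + 15 * p + 44 * n + 46 + T (2 ^ ℓ)) ∧
        σ'.arr () = f ∧ Agree σ' σ) σ := by
  have hle := ctx.off_add_le
  have hlp := ctx.le_pow
  have hpos := Nat.two_pow_pos ℓ
  have hW := ctx.pow_le
  have hℓp : ℓ ≤ p := (Nat.pow_le_pow_iff_right (by norm_num : 1 < 2)).1 (by omega)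
  have hu : IsUnit (ω ^ bitRev p (S * 2 ^ ℓ)) := ctx.root.isUnit_root.pow _
  simp only [unstepProg, wp_block_cons, wp_block_nil]
  refine (wp_twistScaleProg ctx (pl := pOff) (by decide) (by rw [ctx.ptr_off]; omega)).mono ?_
  rintro t₁ σ₁ ⟨ht₁, harr₁, hag₁⟩
  rw [ctx.ptr_off, hf, stepArr, scaleArr_scaleArr _ (Ring.inverse_mul_cancel _ hu)] at harr₁
  have ctx₁ := ctx.of_agree hag₁
  refine (wp_blockCallProg (τ := τ) (c := T (2 ^ ℓ)) (f := swapArr (S * 2 ^ ℓ) (2 ^ ℓ)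
    (splitArr S (2 ^ ℓ) (scaleArr ((S + 1) * 2 ^ ℓ) (ω ^ bitRev p (S * 2 ^ ℓ)) f)))
    ctx₁ fun υ hL hG harr => ?_).mono ?_
  · refine h.wp_backward (σ := υ) (A := ()) (W := W) (len := fun _ => n) (xr := xG)
      (p := ℓ) (n := 2 ^ ℓ) ?_ rfl (ctx.root.pow_two_pow hℓp) hL hL hG (by decide) (by omega)
      ((Nat.mul_le_mul_left κ (by omega)).trans hκ) (by omega) (by omega)
    rw [harr, harr₁, swapArr_swapArr (mul_eq_zero_or_le _ _)]
  rintro t₂ σ₂ ⟨ht₂, harr₂, hag₂⟩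
  have ctx₂ := ctx₁.of_agree hag₂
  rw [swapArr_swapArr (mul_eq_zero_or_le _ _)] at harr₂
  refine (wp_unsplitProg ctx₂ harr₂).mono ?_
  rintro t₃ σ₃ ⟨ht₃, harr₃, hag₃⟩
  have ctx₃ := ctx₂.of_agree hag₃
  refine (wp_untwistScaleProg ctx₃ (pl := pLb) (by decide)
    (by rw [ctx₃.ptr_end]; exact ctx.le)).mono ?_
  rintro t₄ σ₄ ⟨ht₄, harr₄, hag₄⟩
  refine ⟨fun hτ => ?_, ?_, hag₄.trans (hag₃.trans (hag₂.trans hag₁))⟩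
  · have := ht₂ hτ
    omega
  · rw [harr₄, ctx₃.ptr_end, harr₃, scaleArr_scaleArr _ (Ring.mul_inverse_cancel _ hu)]

end

/-- The truncated transform, as a product of `stepArr`, by increasing length of the blocks. -/
def tftProg (dft : Stmt Unit) : Stmt Unit :=
  block [
    .op (.pmov pOrd pN),
    .op (.pset pOne 1),
    .op (.pmov pR pM),
    .op (.pset pLa 1),
    .op (.pmov pLb pM),
    .loop (.le pOne pR) (block [
      .op (.phalf pH pR),
      .op (.padd pH pH pH),
      .ite (.lt pH pR)
        (block [
          .op (.psub pOff pLb pLa),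
          stepProg dft,
          .op (.pmov pLb pOff)])
        .skip,
      .op (.phalf pR pR),
      .op (.padd pLa pLa pLa)])]

/-- The inverse of the truncated transform, by decreasing length of the blocks. -/
def itftProg (idft : Stmt Unit) : Stmt Unit :=
  block [
    .op (.pmov pOrd pN),
    .op (.pset pOne 1),
    .op (.pmov pLa pN),
    .op (.pset pOff 0),
    .loop (.le pOne pLa) (block [
      .op (.psub pH pM pOff),
      .ite (.le pLa pH)
        (block [
          .op (.padd pLb pOff pLa),
          unstepProg idft,
          .op (.pmov pOff pLb)])
        .skip,
      .op (.phalf pLa pLa)])]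

/-- Bound for the time that the truncated transform spends on the blocks of length `2 ^ k`. -/
def levelTime (K n k : ℕ) : ℕ :=
  n / 2 ^ k * (42 * (Nat.log 2 n + 1)) + 130 * n + K * (2 ^ k * (Nat.log 2 n + 1))

/-- The stronger claim with the reserve `2 * (n / 2 ^ k)` passes through the induction, because
halving at most halves the quotient. -/
theorem sum_div_two_pow_le (n k : ℕ) : ∑ j ∈ Finset.range k, n / 2 ^ j ≤ 2 * n := by
  have : ∀ k, ∑ j ∈ Finset.range k, n / 2 ^ j + 2 * (n / 2 ^ k) ≤ 2 * n := by
    intro k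
    induction k with
    | zero => simp
    | succ k ih =>
      have := div_two_pow_eq n k
      rw [Finset.sum_range_succ]
      omega
  have := this k
  omega

theorem TFTSize.le_log {n p : ℕ} (h : TFTSize n p) : p ≤ Nat.log 2 n + 1 := by
  refine Nat.lt_succ_iff.1 ((Nat.pow_lt_pow_iff_right (by norm_num : 1 < 2)).1 (h.2.trans ?_))
  rw [pow_succ]
  have := Nat.lt_pow_succ_log_self (by norm_num : 1 < 2) n
  omega

/-- The mask tests give 2 · 42. The at most 2 (log n + 1) levels give 2 · 130, in all 344. The DFT
lengths form a geometric series below 4 n. -/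
theorem sum_levelTime_le {K n p : ℕ} (h : TFTSize n p) :
    ∑ k ∈ Finset.range (p + 1), levelTime K n k ≤ (344 + 4 * K) * (n * (Nat.log 2 n + 1)) := by
  have hp := h.le_log
  have h1 := sum_div_two_pow_le n (p + 1)
  have h2 : ∑ k ∈ Finset.range (p + 1), 2 ^ k ≤ 4 * n := by
    have := Nat.geomSum_eq le_rfl (p + 1)
    have := h.2
    rw [pow_succ] at *
    simp at *
    omega
  simp only [levelTime, Finset.sum_add_distrib, ← Finset.sum_mul, ← Finset.mul_sum,
    Finset.sum_const, Finset.card_range, smul_eq_mul]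
  generalize Nat.log 2 n = L at *
  calc _ ≤ 2 * n * (42 * (L + 1)) + (2 * (L + 1)) * (130 * n) + K * (4 * n * (L + 1)) := by
        refine Nat.add_le_add (Nat.add_le_add (Nat.mul_le_mul_right _ h1) ?_)
          (Nat.mul_le_mul_left _ (Nat.mul_le_mul_right _ h2))
        rw [mul_assoc]
        exact Nat.mul_le_mul_right _ (by omega)
    _ = _ := by ring

/-! ### The programs for the TFT and its inverse -/

section

variable {D : Type*} [CommRing D] {n p κ K : ℕ} {ω : D} {σ : State D Unit}
  {τ : Prop} {T : ℕ → ℕ} {P Q : Stmt Unit}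

/-- The summand 20 is a reserve for the loop control around the step. -/
theorem step_time_le (hT : ∀ i, 1 ≤ i → T i ≤ K * (i * (Nat.log 2 i + 1))) (h : TFTSize n p)
    {k S : ℕ} (hS : (S + 1) * 2 ^ k ≤ n) (hS' : S ≤ n / 2 ^ k) :
    S * (22 * p + 20) + 15 * p + 44 * n + 46 + T (2 ^ k) + 20 ≤ levelTime K n k := by
  have hp := h.le_log
  have hpos := Nat.two_pow_pos k
  have hkn : 2 ^ k ≤ n := (Nat.le_mul_of_pos_left _ (Nat.succ_pos S)).trans hS
  have hlog : Nat.log 2 n < n := Nat.log_lt_self 2 (by omega)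
  have h1 : T (2 ^ k) ≤ K * (2 ^ k * (Nat.log 2 n + 1)) := by
    refine (hT _ hpos).trans ?_
    gcongr
  have h2 : S * (22 * p + 20) ≤ n / 2 ^ k * (42 * (Nat.log 2 n + 1)) :=
    Nat.mul_le_mul hS' (by omega)
  unfold levelTime
  omega

theorem wp_tftProg (h : TimedTransform D DFTSize κ τ T P Q)
    (hT : ∀ i, 1 ≤ i → T i ≤ K * (i * (Nat.log 2 i + 1))) (hnp : TFTSize n p)
    (hω : IsPrincipalRoot ω (2 ^ p)) (hσ : TransformInput n p ω σ) :
    WP ((κ + 4) * n) (fun _ => n) (tftProg P)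
      (fun t σ' => (τ → t ≤ (350 + 4 * K) * (n * (Nat.log 2 n + 1))) ∧
        σ'.arr () = tftArr ω p n (σ.arr ())) σ := by
  obtain ⟨hn, hp⟩ := id hnp
  have hppos := Nat.two_pow_pos p
  have hW : 4 * n ≤ (κ + 4) * n := Nat.mul_le_mul_right n (by omega)
  have hκ : κ * n ≤ (κ + 4) * n := Nat.mul_le_mul_right n (by omega)
  generalize (κ + 4) * n = W at *
  have e1 : 2 ^ p ≤ W := by omega
  have e2 : n ≤ W := by omega
  have e3 : 1 ≤ W := by omega
  have hσ0 := hσ.ptr_zero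
  have hσ1 := hσ.ptr_one
  have hσx := hσ.alg_zero
  have hlt : n < 2 ^ (Nat.log 2 n + 1) := Nat.lt_pow_succ_log_self (by norm_num) n
  simp [tftProg, hσ0, hσ1, e1, e2, e3]
  refine wp_for (Nat.log 2 n + 1) (fun i t υ =>
    (τ → t ≤ ∑ j ∈ Finset.range i, levelTime K n j) ∧ υ.arr () = levelArr ω p n (σ.arr ()) i ∧
    υ.ptr pR = n / 2 ^ i ∧ υ.ptr pLa = 2 ^ i ∧ υ.ptr pLb = n / 2 ^ i * 2 ^ i ∧
    υ.ptr pOne = 1 ∧ υ.ptr pOrd = 2 ^ p ∧ υ.alg xW = ω) ?_ ?_ ?_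
  · rintro i t υ hi ⟨ht, harr, hR, hLa, hLb, hOne, hOrd, hxW⟩
    have hin : 2 ^ i ≤ n := Nat.pow_le_of_le_log (by omega) (by omega)
    have hdiv : 1 ≤ n / 2 ^ i := Nat.div_pos hin (Nat.two_pow_pos i)
    have hbit := div_two_pow_eq n i
    have hhalf : n / 2 ^ i / 2 = n / 2 ^ (i + 1) := by rw [pow_succ, Nat.div_div_eq_div_mul]
    have hmul : n / 2 ^ i * 2 ^ i ≤ n := Nat.div_mul_le_self n _
    have hdl : n / 2 ^ i ≤ n := Nat.div_le_self n _
    have hpow : n / 2 ^ (i + 1) * 2 ^ (i + 1) = 2 * (n / 2 ^ (i + 1)) * 2 ^ i := by ring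
    have e4 : n / 2 ^ (i + 1) ≤ W := by omega
    have e5 : n / 2 ^ (i + 1) + n / 2 ^ (i + 1) ≤ W := by omega
    refine ⟨by simpa [hOne, hR] using hdiv, ?_⟩
    have e6 : 2 ^ i + 2 ^ i ≤ W := by omega
    have e7 : levelTime K n i ≥ 130 * n := by unfold levelTime; omega
    simp only [wp_block_cons, wp_block_nil, wp_phalf, hR, hhalf, e4, true_and, wp_padd,
      Function.update_self, e5, wp_ite, Test.holds, ne_eq, show pR ≠ pH by decide,
      not_false_eq_true, Function.update_of_ne, wp_skip, wp_psub, wp_pmov]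
    -- `pH` holds `pR` rounded down to an even number, so the test reads digit `i` of `n`.
    refine ⟨fun hc => ?_, fun hc => ?_⟩
    · have hb : n.testBit i = true := by
        by_contra hb
        rw [if_neg hb] at hbit
        omega
      rw [if_pos hb] at hbit
      have hoff : n / 2 ^ i * 2 ^ i - 2 ^ i = 2 * (n / 2 ^ (i + 1)) * 2 ^ i := by
        rw [hbit, Nat.succ_mul, Nat.add_sub_cancel]
      have hle : (2 * (n / 2 ^ (i + 1)) + 1) * 2 ^ i ≤ n := hbit ▸ hmul
      have hle' : 2 * (n / 2 ^ (i + 1)) * 2 ^ i ≤ W := by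
        rw [Nat.succ_mul] at hle
        omega
      simp only [ne_eq, show pLb ≠ pH by decide, show pLa ≠ pH by decide, not_false_eq_true,
        Function.update_of_ne, hLb, hLa, hoff, hle', true_and]
      refine (wp_stepProg (n := n) (S := 2 * (n / 2 ^ (i + 1))) (ℓ := i) h
        ⟨hω, hn, e1, hle, ?_, ?_, ?_, ?_, ?_, by exact hxW⟩ hκ).mono ?_
      · simpa using hOne
      · simpa using hOrd
      · simp
      · simpa [← hbit] using hLb
      · simpa using hLa
      rintro t₁ σ₁ ⟨ht₁, harr₁, hag⟩
      have hOff₁ : σ₁.ptr pOff = 2 * (n / 2 ^ (i + 1)) * 2 ^ i :=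
        (hag.ptr _ (by decide) (by decide)).trans (by simp)
      have hR₁ : σ₁.ptr pR = n / 2 ^ i := (hag.ptr _ (by decide) (by decide)).trans (by simpa)
      have hLa₁ : σ₁.ptr pLa = 2 ^ i := (hag.ptr _ (by decide) (by decide)).trans (by simpa)
      have hOne₁ : σ₁.ptr pOne = 1 := (hag.ptr _ (by decide) (by decide)).trans (by simpa)
      have hOrd₁ : σ₁.ptr pOrd = 2 ^ p := (hag.ptr _ (by decide) (by decide)).trans (by simpa)
      have hxW₁ : σ₁.alg xW = ω := hag.root.trans hxW
      simp [hOff₁, hR₁, hLa₁, hOne₁, hOrd₁, hxW₁, hle', hhalf, e4, e6]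
      refine ⟨fun hτ => ?_, ?_, by ring, by rw [hpow]⟩
      · have := ht hτ
        have := ht₁ hτ
        have := step_time_le hT hnp hle (by omega)
        rw [Finset.sum_range_succ]
        omega
      · rw [harr₁, levelArr, if_pos hb, harr]
    · have hb : ¬ n.testBit i = true := by
        intro hb
        rw [if_pos hb] at hbit
        omega
      rw [if_neg hb, add_zero] at hbit
      simp [hLa, hLb, hOne, hOrd, hxW, e6]
      refine ⟨fun hτ => ?_, ?_, by ring, by rw [hpow, hbit]⟩
      · have := ht hτ
        rw [Finset.sum_range_succ]
        omega
      · rw [levelArr, if_neg hb, harr]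
  · rintro t υ ⟨ht, harr, hR, hLa, hLb, hOne, hOrd, hxW⟩
    refine ⟨by simp [hOne, hR, Nat.div_eq_of_lt hlt], fun hτ => ?_, ?_⟩
    · have h1 := ht hτ
      have h2 := sum_levelTime_le (K := K) hnp
      have h3 : ∑ j ∈ Finset.range (Nat.log 2 n + 1), levelTime K n j ≤
          ∑ j ∈ Finset.range (p + 1), levelTime K n j := by
        refine Finset.sum_le_sum_of_subset (Finset.range_subset_range.2 ?_)
        have := Nat.log_mono_right (b := 2) hn
        rw [Nat.log_pow (by norm_num)] at this
        omega
      have h4 : 1 ≤ n * (Nat.log 2 n + 1) := Nat.mul_pos (by omega) (by omega)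
      have h5 : (350 + 4 * K) * (n * (Nat.log 2 n + 1)) =
        (344 + 4 * K) * (n * (Nat.log 2 n + 1)) + 6 * (n * (Nat.log 2 n + 1)) := by ring
      omega
    · rw [harr, levelArr_eq_tftArr hω hn _ hlt]
  · simp [levelArr, hσx]

theorem wp_itftProg (h : TimedTransform D DFTSize κ τ T P Q)
    (hT : ∀ i, 1 ≤ i → T i ≤ K * (i * (Nat.log 2 i + 1))) (hnp : TFTSize n p)
    (hω : IsPrincipalRoot ω (2 ^ p)) (hσ : TransformInput n p ω σ) {f : ℕ → D}
    (hf : σ.arr () = tftArr ω p n f) :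
    WP ((κ + 4) * n) (fun _ => n) (itftProg Q)
      (fun t σ' => (τ → t ≤ (350 + 4 * K) * (n * (Nat.log 2 n + 1))) ∧ σ'.arr () = f) σ := by
  obtain ⟨hn, hp⟩ := id hnp
  have hppos := Nat.two_pow_pos p
  have hW : 4 * n ≤ (κ + 4) * n := Nat.mul_le_mul_right n (by omega)
  have hκ : κ * n ≤ (κ + 4) * n := Nat.mul_le_mul_right n (by omega)
  generalize (κ + 4) * n = W at *
  have e1 : 2 ^ p ≤ W := by omega
  have e3 : 1 ≤ W := by omega
  have hσ0 := hσ.ptr_zero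
  have hσ1 := hσ.ptr_one
  have hσx := hσ.alg_zero
  simp [itftProg, hσ1, e1, e3]
  -- The levels are undone from p down to 0, and those above the leading digit of `n` do nothing.
  -- After the last one `pLa` is 1 / 2 = 0, which ends the loop.
  refine wp_for (p + 1) (fun i t υ =>
    (τ → t + ∑ j ∈ Finset.range (p + 1 - i), levelTime K n j ≤
      ∑ j ∈ Finset.range (p + 1), levelTime K n j) ∧
    υ.arr () = levelArr ω p n f (p + 1 - i) ∧
    υ.ptr pLa = 2 ^ (p + 1 - i) / 2 ∧
    υ.ptr pOff = n / 2 ^ (p + 1 - i) * 2 ^ (p + 1 - i) ∧ υ.ptr pM = n ∧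
    υ.ptr pOne = 1 ∧ υ.ptr pOrd = 2 ^ p ∧ υ.alg xW = ω) ?_ ?_ ?_
  · rintro i t υ hi ⟨ht, harr, hLa, hOff, hM, hOne, hOrd, hxW⟩
    obtain ⟨k, hk, hk'⟩ : ∃ k, p + 1 - i = k + 1 ∧ p + 1 - (i + 1) = k :=
      ⟨p - i, by omega, by omega⟩
    rw [hk] at ht harr hLa hOff
    rw [hk']
    have hkp : k ≤ p := by omega
    rw [pow_succ, Nat.mul_div_cancel _ (by norm_num : 0 < 2)] at hLa
    have hkpos := Nat.two_pow_pos k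
    have hkle : 2 ^ k ≤ 2 ^ p := Nat.pow_le_pow_right (by norm_num) hkp
    have hbit := div_two_pow_eq n k
    have hmul : n / 2 ^ k * 2 ^ k ≤ n := Nat.div_mul_le_self n _
    have hmul' : n / 2 ^ (k + 1) * 2 ^ (k + 1) ≤ n := Nat.div_mul_le_self n _
    have hlt : n < n / 2 ^ k * 2 ^ k + 2 ^ k := by
      have := Nat.lt_div_mul_add (a := n) hkpos
      omega
    have hpow : n / 2 ^ (k + 1) * 2 ^ (k + 1) = 2 * (n / 2 ^ (k + 1)) * 2 ^ k := by ring
    rw [hpow] at hOff hmul'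
    refine ⟨by simp only [Test.holds, hOne, hLa]; exact hkpos, ?_⟩
    have e4 : n - 2 * (n / 2 ^ (k + 1)) * 2 ^ k ≤ W := by omega
    have e6 : 2 ^ k / 2 ≤ W := by omega
    have e7 : levelTime K n k ≥ 130 * n := by unfold levelTime; omega
    rw [Finset.sum_range_succ] at ht
    simp only [wp_block_cons, wp_block_nil, wp_psub, hM, hOff, e4, true_and,
      Function.update_self, wp_ite, Test.holds, ne_eq, show pLa ≠ pH by decide,
      not_false_eq_true, Function.update_of_ne, wp_skip, wp_padd, wp_pmov, hLa, wp_phalf,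
      show pOff ≠ pH by decide]
    -- `pOff` is `n` without its digits up to `k`, so at least `2 ^ k` entries remain exactly if
    -- digit `k` is 1.
    refine ⟨fun hc => ?_, fun hc => ?_⟩
    · have hb : n.testBit k = true := by
        by_contra hb
        rw [if_neg hb, add_zero] at hbit
        rw [hbit] at hlt
        omega
      rw [if_pos hb] at hbit
      have hle : (2 * (n / 2 ^ (k + 1)) + 1) * 2 ^ k ≤ n := hbit ▸ hmul
      have hsum : 2 * (n / 2 ^ (k + 1)) * 2 ^ k + 2 ^ k = n / 2 ^ k * 2 ^ k := by
        rw [hbit]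
        ring
      have hle' : n / 2 ^ k * 2 ^ k ≤ W := by omega
      simp only [hsum, hle', true_and]
      refine (wp_unstepProg (n := n) (S := 2 * (n / 2 ^ (k + 1))) (ℓ := k)
        (f := levelArr ω p n f k) h ⟨hω, hn, e1, hle, ?_, ?_, ?_, ?_, ?_, by exact hxW⟩ hκ ?_).mono ?_
      · simpa using hOne
      · simpa using hOrd
      · simpa using hOff
      · simp [← hbit]
      · simpa using hLa
      · simp only [harr, levelArr, if_pos hb]
      rintro t₁ σ₁ ⟨ht₁, harr₁, hag⟩
      have hLb₁ : σ₁.ptr pLb = n / 2 ^ k * 2 ^ k :=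
        (hag.ptr _ (by decide) (by decide)).trans (by simp)
      have hM₁ : σ₁.ptr pM = n := (hag.ptr _ (by decide) (by decide)).trans (by simpa)
      have hLa₁ : σ₁.ptr pLa = 2 ^ k := (hag.ptr _ (by decide) (by decide)).trans (by simpa)
      have hOne₁ : σ₁.ptr pOne = 1 := (hag.ptr _ (by decide) (by decide)).trans (by simpa)
      have hOrd₁ : σ₁.ptr pOrd = 2 ^ p := (hag.ptr _ (by decide) (by decide)).trans (by simpa)
      have hxW₁ : σ₁.alg xW = ω := hag.root.trans hxW
      simp [hLb₁, hM₁, hLa₁, hOne₁, hOrd₁, hxW₁, hle', e6, harr₁]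
      intro hτ
      have := ht hτ
      have := ht₁ hτ
      have := step_time_le hT hnp hle (by omega)
      omega
    · have hb : ¬ n.testBit k = true := by
        intro hb
        rw [if_pos hb] at hbit
        rw [hbit, Nat.succ_mul] at hmul
        omega
      rw [if_neg hb, add_zero] at hbit
      rw [levelArr, if_neg hb] at harr
      simp [hM, hOff, hOne, hOrd, hxW, e6, harr, hbit]
      intro hτ
      have := ht hτ
      omega
  · rintro t υ ⟨ht, harr, hLa, hOff, hM, hOne, hOrd, hxW⟩
    simp only [Nat.sub_self, pow_zero, Finset.range_zero, Finset.sum_empty] at ht harr hLa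
    refine ⟨by simp [hOne, hLa], fun hτ => ?_, harr⟩
    have h1 := ht hτ
    have h2 := sum_levelTime_le (K := K) hnp
    have h4 : 1 ≤ n * (Nat.log 2 n + 1) := Nat.mul_pos (by omega) (by omega)
    have h5 : (350 + 4 * K) * (n * (Nat.log 2 n + 1)) =
      (344 + 4 * K) * (n * (Nat.log 2 n + 1)) + 6 * (n * (Nat.log 2 n + 1)) := by ring
    omega
  · have hlt : n < 2 ^ (p + 1) := by rw [pow_succ]; omega
    simp only [pow_succ, Nat.sub_zero]
    simp [hσ0, hσx, hf, levelArr_eq_tftArr hω hn _ hlt]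
    rwa [pow_succ] at hlt

/-- Squaring drops the lowest digit, and x - y divides x² - y², so induction applies unless i and j
differ in the lowest digit only. In that case y = -x, and the difference is 2x. -/
theorem IsPrincipalRoot.isUnit_pow_bitRev_sub (h : IsPrincipalRoot ω (2 ^ p)) {i j : ℕ}
    (hi : i < 2 ^ p) (hj : j < 2 ^ p) (hij : i ≠ j) :
    IsUnit (ω ^ bitRev p i - ω ^ bitRev p j) := by
  induction p generalizing ω i j with
  | zero => omega
  | succ p ih =>
    rw [pow_succ] at hi hj
    have hsq : ∀ i, (ω ^ bitRev (p + 1) i) ^ 2 = (ω ^ 2) ^ bitRev p (i / 2) := fun i => by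
      rw [bitRev_succ, pow_add, pow_mul, h.pow_half, mul_pow, ← pow_mul, mul_comm _ 2, pow_mul,
        neg_one_sq, one_pow, one_mul, pow_right_comm]
    rcases eq_or_ne (i / 2) (j / 2) with h2 | h2
    · rw [bitRev_succ, bitRev_succ, h2, pow_add, pow_add, ← sub_mul]
      refine IsUnit.mul ?_ (h.isUnit_root.pow _)
      rcases Nat.mod_two_eq_zero_or_one i with h3 | h3
      · rw [h3, show j % 2 = 1 by omega, mul_zero, mul_one, h.pow_half, pow_zero, sub_neg_eq_add,
          one_add_one_eq_two]
        exact h.isUnit_two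
      · rw [h3, show j % 2 = 0 by omega, mul_zero, mul_one, h.pow_half, pow_zero, ← neg_add',
          one_add_one_eq_two]
        exact h.isUnit_two.neg
    · have hη : IsPrincipalRoot (ω ^ 2) (2 ^ p) := by
        simpa using h.pow_two_pow (Nat.le_succ p)
      refine isUnit_of_dvd_unit ?_ (ih hη (by omega) (by omega) h2)
      rw [← hsq, ← hsq]
      exact sub_dvd_pow_sub_pow _ _ 2

/-- The Vandermonde determinant is a product of unit differences. The time bound of the inverse
program concerns arbitrary arrays, and this shows that all of them are transforms. -/
theorem IsPrincipalRoot.exists_eq_tftArr (h : IsPrincipalRoot ω (2 ^ p)) (hn : n ≤ 2 ^ p)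
    (g : ℕ → D) : ∃ f, g = tftArr ω p n f := by
  have hu : IsUnit (Matrix.vandermonde fun i : Fin n => ω ^ bitRev p i) := by
    rw [Matrix.isUnit_iff_isUnit_det, Matrix.det_vandermonde]
    refine IsUnit.prod_iff.2 fun i _ => IsUnit.prod_iff.2 fun j hj => ?_
    have := Finset.mem_Ioi.1 hj
    exact h.isUnit_pow_bitRev_sub (by omega) (by omega) (by omega)
  obtain ⟨f, hf⟩ := Matrix.mulVec_surjective_iff_isUnit.2 hu fun i => g i
  refine ⟨fun i => if hi : i < n then f ⟨i, hi⟩ else g i, funext fun i => ?_⟩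
  rw [tftArr]
  split_ifs with hi
  · refine (congrFun hf ⟨i, hi⟩).symm.trans ?_
    simp [brTFT_eq_sum, Matrix.mulVec, dotProduct, Matrix.vandermonde_apply, Finset.sum_range,
      mul_comm]
  · rfl

theorem overPlaceTransform_tftProg (h : TimedTransform D DFTSize κ True T P Q)
    (hT : ∀ i, 1 ≤ i → T i ≤ K * (i * (Nat.log 2 i + 1))) :
    OverPlaceTransform D TFTSize (κ + 4) (tftProg P) (itftProg Q) where
  forward n p ω hd hω σ hσ := by
    refine (wp_tftProg h hT hd hω hσ).mono ?_
    rintro t σ' ⟨-, harr⟩ i hi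
    rw [harr, tftArr, if_pos hi]
  backward n p ω hd hω σ f hσ hf := by
    -- Only the first `n` entries of `f` are prescribed; beyond them the preimage must agree with
    -- the array.
    refine (wp_itftProg h hT hd hω hσ
      (f := fun i => if i < n then f i else σ.arr () i) (funext fun i => ?_)).mono ?_
    · rw [tftArr]
      split_ifs with hi
      · rw [hf i hi]
        exact brTFT_congr (fun j hj => (if_pos hj).symm) i
      · rfl
    · rintro t σ' ⟨-, harr⟩ i hi
      exact (congrFun harr i).trans (if_pos hi)

theorem transformTime_tftProg (h : TimedTransform D DFTSize κ True T P Q)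
    (hT : ∀ i, 1 ≤ i → T i ≤ K * (i * (Nat.log 2 i + 1))) :
    TransformTime D TFTSize (fun n => (350 + 4 * K) * (n * (Nat.log 2 n + 1))) (tftProg P) :=
  fun _ _ _ hd hω _ hσ _ _ _ he => ((wp_tftProg h hT hd hω hσ).of_exec he).1 trivial

theorem transformTime_itftProg (h : TimedTransform D DFTSize κ True T P Q)
    (hT : ∀ i, 1 ≤ i → T i ≤ K * (i * (Nat.log 2 i + 1))) :
    TransformTime D TFTSize (fun n => (350 + 4 * K) * (n * (Nat.log 2 n + 1))) (itftProg Q) := by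
  intro n p ω hd hω σ hσ W t σ' he
  obtain ⟨f, hf⟩ := hω.exists_eq_tftArr hd.1 (σ.arr ())
  exact ((wp_itftProg h hT hd hω hσ hf).of_exec he).1 trivial

end

/-! ### Register counts -/

theorem Stmt.numRegs_rename_le {ι κ : Type} (f : ι → κ) (d : ℕ) (s : Stmt ι) :
    (s.rename f d).numRegs ≤ s.numRegs + d := by
  induction s with
  | skip => simp [Stmt.rename, Stmt.numRegs]
  | op i => cases i <;> simp only [Stmt.rename, Stmt.numRegs, Instr.rename, Instr.numRegs] <;> omega
  | seq s s' h h' => simp only [Stmt.rename, Stmt.numRegs]; omega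
  | ite c s s' h h' =>
    cases c <;> simp only [Stmt.rename, Stmt.numRegs, Test.rename, Test.numRegs] <;> omega
  | loop c s h =>
    cases c <;> simp only [Stmt.rename, Stmt.numRegs, Test.rename, Test.numRegs] <;> omega

theorem numRegs_block_nil {ι : Type} : (block ([] : List (Stmt ι))).numRegs = 0 := rfl

theorem numRegs_block_cons {ι : Type} (s : Stmt ι) (l : List (Stmt ι)) :
    (block (s :: l)).numRegs = max s.numRegs (block l).numRegs := rfl

/-- The registers of the transform are shifted by 16, and the call itself writes registers 16 and
17, whence 18. -/
theorem numRegs_callTransform_le (P : Stmt Unit) (A : Arr) {pl po xr : ℕ} (hl : pl < 16)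
    (ho : po < 16) (hx : xr < 16) : (callTransform P A pl po xr).numRegs ≤ 18 + P.numRegs := by
  have := Stmt.numRegs_rename_le (fun _ => A) 16 P
  simp only [callTransform, numRegs_block_cons, numRegs_block_nil, Stmt.numRegs, Instr.numRegs, Nat.max_le, Nat.add_one_le_iff, Nat.max_lt]
  and_intros <;> omega

theorem numRegs_partTFT_le (P : Stmt Unit) (A : Arr) {pl ps pL : ℕ} (hl : pl < 16)
    (hs : ps < 16) (hL : pL < 16) : (partTFT P A pl ps pL).numRegs ≤ 18 + P.numRegs := by
  have := numRegs_callTransform_le P A (xr := xG) hL hL (by decide)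
  simp only [partTFT, loadTwist, scale, fold, loadRoot, numRegs_block_cons, numRegs_block_nil,
    Stmt.numRegs, Instr.numRegs, Test.numRegs, Nat.max_le, Nat.add_one_le_iff, Nat.max_lt]
  and_intros <;> first
    | omega
    | exact Nat.lt_of_lt_of_le (show _ < 18 by decide) (Nat.le_add_right 18 _)

theorem numRegs_partTFTInv_le (P : Stmt Unit) (A : Arr) {pl ps pL : ℕ} (hl : pl < 16)
    (hs : ps < 16) (hL : pL < 16) : (partTFTInv P A pl ps pL).numRegs ≤ 18 + P.numRegs := by
  have := numRegs_callTransform_le P A (xr := xG) hL hL (by decide)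
  simp only [partTFTInv, loadTwist, scale, unfold, loadRoot, numRegs_block_cons,
    numRegs_block_nil, Stmt.numRegs, Instr.numRegs, Test.numRegs, Nat.max_le, Nat.add_one_le_iff, Nat.max_lt]
  and_intros <;> first
    | omega
    | exact Nat.lt_of_lt_of_le (show _ < 18 by decide) (Nat.le_add_right 18 _)

theorem numRegs_fftAccu_le (dft idft tft itft : Stmt Unit) :
    (fftAccu dft idft tft itft).numRegs ≤
      18 + max (max dft.numRegs idft.numRegs) (max tft.numRegs itft.numRegs) := by
  have h1 := numRegs_callTransform_le tft .c (pl := pLen) (po := pOrd) (xr := xW) (by decide)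
    (by decide) (by decide)
  have h2 := numRegs_callTransform_le itft .c (pl := pLen) (po := pOrd) (xr := xW) (by decide)
    (by decide) (by decide)
  have h3 := numRegs_partTFT_le dft .b (pl := pN) (ps := pOff) (pL := pLb) (by decide)
    (by decide) (by decide)
  have h4 := numRegs_partTFT_le dft .a (pl := pM) (ps := pOffA) (pL := pLa) (by decide)
    (by decide) (by decide)
  have h5 := numRegs_partTFTInv_le idft .b (pl := pN) (ps := pOff) (pL := pLb) (by decide)
    (by decide) (by decide)
  have h6 := numRegs_partTFTInv_le idft .a (pl := pM) (ps := pOffA) (pL := pLa) (by decide)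
    (by decide) (by decide)
  simp only [fftAccu, iteration, loadPow2, mulAcc, numRegs_block_cons, numRegs_block_nil,
    Stmt.numRegs, Instr.numRegs, Test.numRegs, Nat.max_le, Nat.add_one_le_iff, Nat.max_lt]
  and_intros <;> first
    | omega
    | exact Nat.lt_of_lt_of_le (show _ < 18 by decide) (Nat.le_add_right 18 _)

/-! ### Conclusion -/

theorem accumulatesProduct_fftAccu {D : Type*} [CommRing D] {κ κ₁ : ℕ}
    {dft idft tft itft : Stmt Unit} (h : OverPlaceTransform D DFTSize κ dft idft)
    (h₁ : OverPlaceTransform D TFTSize κ₁ tft itft) :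
    AccumulatesProduct D (κ + 2 * κ₁ + 4) (fftAccu dft idft tft itft) := by
  intro m n σ hσ
  -- Correctness assumes no time bounds, so the time guard is `False` and the bounds are dummies.
  refine (wp_fftAccu (T := fun _ => 0) (T₁ := fun _ => 0) (K := 0) (K₁ := 0)
    (h.timed False.elim False.elim) (h₁.timed False.elim False.elim) (by simp) (by simp) hσ).mono ?_
  rintro t σ' ⟨-, hA, hB, hC⟩
  refine ⟨fun i _ => by rw [hA], fun i _ => by rw [hB], ?_⟩
  rw [hC, toPoly_mulArr hσ.one_le (hσ.one_le.trans hσ.le)]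

end FFTAccu

open AlgRAM FFTAccu in
theorem mainTheorem8 :
    -- in-place: a constant number of registers besides those of the transforms
    (∃ s : ℕ, ∀ dft idft tft itft : Stmt Unit,
      (fftAccu dft idft tft itft).numRegs ≤
        s + max (max dft.numRegs idft.numRegs) (max tft.numRegs itft.numRegs)) ∧
    -- correct, with no memory but the arrays and registers, and with `a` and `b` restored
    (∀ κ κ₁ : ℕ, ∃ κ' : ℕ, ∀ (dft idft tft itft : Stmt Unit) (D : Type*) [CommRing D],
      OverPlaceTransform D DFTSize κ dft idft → OverPlaceTransform D TFTSize κ₁ tft itft →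
      AccumulatesProduct D κ' (fftAccu dft idft tft itft)) ∧
    -- running time `O(n log n)`, if the transforms take time `O(n log n)`
    (∀ T T₁ : ℕ → ℕ, IsQuasiLinear T → IsQuasiLinear T₁ → ∃ T' : ℕ → ℕ, IsQuasiLinear T' ∧
      ∀ (κ κ₁ : ℕ) (dft idft tft itft : Stmt Unit) (D : Type*) [CommRing D],
        OverPlaceTransform D DFTSize κ dft idft → OverPlaceTransform D TFTSize κ₁ tft itft →
        TransformTime D DFTSize T dft → TransformTime D DFTSize T idft →
        TransformTime D TFTSize T₁ tft → TransformTime D TFTSize T₁ itft →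
        MulTime D T' (fftAccu dft idft tft itft)) ∧
    -- such TFT programs exist whenever the DFT programs take time `O(n log n)`
    (∀ T : ℕ → ℕ, IsQuasiLinear T → ∃ T₁ : ℕ → ℕ, IsQuasiLinear T₁ ∧ ∀ κ : ℕ, ∃ κ₁ : ℕ,
      ∀ dft idft : Stmt Unit, ∃ tft itft : Stmt Unit, ∀ (D : Type*) [CommRing D],
        OverPlaceTransform D DFTSize κ dft idft →
        TransformTime D DFTSize T dft → TransformTime D DFTSize T idft →
        OverPlaceTransform D TFTSize κ₁ tft itft ∧
        TransformTime D TFTSize T₁ tft ∧ TransformTime D TFTSize T₁ itft) := by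
  refine ⟨⟨18, numRegs_fftAccu_le⟩,
    fun κ κ₁ => ⟨κ + 2 * κ₁ + 4, fun _ _ _ _ D _ h h₁ => accumulatesProduct_fftAccu h h₁⟩, ?_, ?_⟩
  · intro T T₁ hT hT₁
    obtain ⟨K, hK⟩ := hT.exists_le
    obtain ⟨K₁, hK₁⟩ := hT₁.exists_le
    refine ⟨_, isQuasiLinear_mul_log (800 + 8 * K + 8 * K₁), ?_⟩
    intro κ κ₁ dft idft tft itft D _ h h₁ hP hQ hP₁ hQ₁ m n σ hσ W t σ' he
    -- The given run may have any word bound; it is compared with the run that is known to halt.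
    exact ((wp_fftAccu (h.timed (τ := True) (fun _ => hP) fun _ => hQ)
      (h₁.timed (fun _ => hP₁) fun _ => hQ₁) hK hK₁ hσ).of_exec he).1 trivial
  · intro T hT
    obtain ⟨K, hK⟩ := hT.exists_le
    refine ⟨_, isQuasiLinear_mul_log (350 + 4 * K), fun κ => ⟨κ + 4, fun dft idft =>
      ⟨tftProg dft, itftProg idft, fun D _ h hP hQ => ?_⟩⟩⟩
    have ht := h.timed (τ := True) (fun _ => hP) fun _ => hQ
    exact ⟨overPlaceTransform_tftProg ht hK, transformTime_tftProg ht hK,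
      transformTime_itftProg ht hK⟩
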